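/- Let $H$ be a quasitriangular Hopf algebra over a field $\Bbbk$ with invertible antipode $S$ and $R$-matrix $R=R_{[1]}\otimes R_{[2]}$ ($R$ is invertible, $R\Delta(h)=\Delta^{\mathrm{op}}(h)R$, $(\Delta\otimes\mathrm{id})(R)=R_{13}R_{23}$, $(\mathrm{id}\otimes\Delta)(R)=R_{13}R_{12}$; copies of $R$ are written $R^1,R^2,\dots$). Let $H^\circ\subset H^*$ be the span of the matrix coefficients of finite-dimensional left $H$-modules, with product $(\varphi\star\psi)(h)=\varphi(h_{(1)})\psi(h_{(2)})$ and actions $(a\triangleright\varphi)(h)=\varphi(ha)$, $(\varphi\triangleleft a)(h)=\varphi(ah)$. Put $\mathrm{coad}^r(h)(\varphi)=S(h_{(2)})\triangleright\varphi\triangleleft h_{(1)}$ and $\mathsf D(h)(\psi)=S(h_{(1)})\triangleright\psi\triangleleft h_{(2)}$. Let $\mathcal L_{0,1}(H)$ be $H^\circ$ with the action $\mathrm{coad}^r$, unit $\varepsilon$ and product $\varphi\psi=\bigl(R^2_{[2]}S(R^1_{[2]})\triangleright\varphi\bigr)\star\bigl(R^2_{[1]}\triangleright\psi\triangleleft R^1_{[1]}\bigr)$.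 Let $\mathcal L_{1,0}(H)$ be $H^\circ\otimes H^\circ$ with the diagonal action (also denoted $\mathrm{coad}^r$), with the product such that $\mathfrak i_b(\varphi)=\varphi\otimes\varepsilon$ and $\mathfrak i_a(\varphi)=\varepsilon\otimes\varphi$ are algebra morphisms on $\mathcal L_{0,1}(H)$, $\mathfrak i_b(\beta)\mathfrak i_a(\alpha)=\beta\otimes\alpha$ and $$\mathfrak i_a(\alpha)\mathfrak i_b(\beta)=\mathfrak i_b\bigl(R^4_{[2]}R^3_{[1]}\triangleright\beta\triangleleft R^1_{[1]}R^2_{[1]}\bigr)\,\mathfrak i_a\bigl(R^3_{[2]}S(R^1_{[2]})\triangleright\alpha\triangleleft R^2_{[2]}R^4_{[1]}\bigr).$$ Let $\mathcal L_{g,n}(H)=\mathcal L_{1,0}(H)^{\widetilde\otimes g}\,\widetilde\otimes\,\mathcal L_{0,1}(H)^{\widetilde\otimes n}$, where $A\,\widetilde\otimes\,B$ is the right $H$-module-algebra $A\otimes B$ with diagonal action and product $(a\otimes b)(a'\otimes b')=a(a'\cdot R_{[1]})\otimes(b\cdot R_{[2]})b'$, the dot being the right $H$-actions. Let $\mathfrak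 e_1,\dots,\mathfrak e_{g+n}$ be the embeddings of the factors. Put $\Phi_{0,1}:\mathcal L_{0,1}(H)\to H$, $\Phi_{0,1}(\varphi)=(\varphi\otimes\mathrm{id})(RR')$ with $R'=R_{[2]}\otimes R_{[1]}$; $H$ is factorizable if $\Phi_{0,1}$ is bijective. Let $\rho_{1,0}:\mathcal L_{1,0}(H)\to\mathrm{End}_\Bbbk(H^\circ)$ be given by $\rho_{1,0}(\beta\otimes\alpha)=\rho_b(\beta)\circ\rho_a(\alpha)$, where $$\rho_b(\varphi)(\psi)=\bigl(R^1_{[2]}R^2_{[2]}\triangleright\varphi\triangleleft R^3_{[1]}R^1_{[1]}\bigr)\star\bigl(R^3_{[2]}R^2_{[1]}\triangleright\psi\bigr),\qquad \rho_a(\varphi)(\psi)=\Phi_{0,1}(\varphi)\triangleright\psi.$$ For all $g,n\ge 0$, the above makes $\mathcal L_{g,n}(H)$ an (associative, unital) right $H$-module-algebra, and: 1. There is a unique morphism of algebras $\Phi'_{g,n}:\mathcal L_{g,n}(H)\to\mathrm{End}_\Bbbk(H^\circ)^{\otimes g}\otimes H^{\otimes n}$ (target with the tensor-wise product) such that $$\Phi'_{g,n}(\mathfrak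 e_i(x))=\mathsf D(R_{[1](1)})\otimes\dots\otimes\mathsf D(R_{[1](i-1)})\otimes\rho_{1,0}\bigl(\mathrm{coad}^r(R_{[2]})(x)\bigr)\otimes\mathrm{id}_{H^\circ}^{\otimes(g-i)}\otimes1_H^{\otimes n}$$ for $1\le i\le g$, $x\in\mathcal L_{1,0}(H)$, and $$\Phi'_{g,n}(\mathfrak e_{g+j}(\varphi))=\mathsf D(R_{[1](1)})\otimes\dots\otimes\mathsf D(R_{[1](g)})\otimes S(R_{[1](g+1)})\otimes\dots\otimes S(R_{[1](g+j-1)})\otimes\Phi_{0,1}\bigl(\mathrm{coad}^r(R_{[2]})(\varphi)\bigr)\otimes1_H^{\otimes(n-j)}$$ for $1\le j\le n$, $\varphi\in\mathcal L_{0,1}(H)$. 2. The target is a right $H$-module-algebra for the action by which $h\in H$ sends $E_1\otimes\dots\otimes E_g\otimes k_1\otimes\dots\otimes k_n$ to $$\bigotimes_{i=1}^g\mathsf D(h_{(i)})\circ E_i\circ\mathsf D\bigl(S^{-1}(h_{(2g+2n+1-i)})\bigr)\ \otimes\ \bigotimes_{j=1}^n S(h_{(g+j)})\,k_j\,h_{(g+2n+1-j)},$$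 and $\Phi'_{g,n}$ is a morphism of $H$-module-algebras. 3. If $H$ is finite-dimensional and factorizable, then $\Phi'_{g,n}$ is an isomorphism; in particular $\mathcal L_{g,0}(H)$ is then isomorphic to the algebra of square matrices of size $\dim(H)^g$ over $\Bbbk$. -/

import Mathlib

open scoped TensorProduct

noncomputable section

namespace QuantumModuli

universe u v w

/-! ## Quasitriangular Hopf algebras -/

/-- A universal R-matrix on a Hopf algebra `H`: an invertible element `R` of `H ⊗ H` such that
`R Δ(h) = Δᵒᵖ(h) R`, `(Δ ⊗ id)(R) = R₁₃ R₂₃` and `(id ⊗ Δ)(R) = R₁₃ R₁₂`. The last two identities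
are written in the algebra `(H ⊗ H) ⊗ H`. -/
structure RMatrix (k : Type u) [Field k] (H : Type v) [Ring H] [HopfAlgebra k H] where
  /-- the element `R` -/
  elt : H ⊗[k] H
  isUnit_elt : IsUnit elt
  quasi_cocomm : ∀ h : H,
    elt * Coalgebra.comul h = TensorProduct.comm k H H (Coalgebra.comul h) * elt
  comul_left :
    TensorProduct.map Coalgebra.comul LinearMap.id elt =
      TensorProduct.map
          (Algebra.TensorProduct.includeLeft : H →ₐ[k] H ⊗[k] H).toLinearMap LinearMap.id elt *
        TensorProduct.map
          (Algebra.TensorProduct.includeRight : H →ₐ[k] H ⊗[k] H).toLinearMap LinearMap.id elt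
  comul_right :
    (TensorProduct.assoc k H H H).symm
        (TensorProduct.map LinearMap.id Coalgebra.comul elt) =
      TensorProduct.map
          (Algebra.TensorProduct.includeLeft : H →ₐ[k] H ⊗[k] H).toLinearMap LinearMap.id elt *
        elt ⊗ₜ[k] (1 : H)

section RMatrix

variable {k : Type u} [Field k] {H : Type v} [Ring H] [HopfAlgebra k H]

/-- The number of terms in a decomposition `R = ∑ i, R₁ᵢ ⊗ R₂ᵢ`. The decomposition is chosen once
and for all; it is only ever used in expressions that are linear in each copy of `R`, so that the
result does not depend on it. -/
def RMatrix.card (R : RMatrix k H) : ℕ := (TensorProduct.exists_sum_tmul_eq R.elt).choose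

/-- The first tensor legs `R₁ᵢ` of `R = ∑ i, R₁ᵢ ⊗ R₂ᵢ`. -/
def RMatrix.fst (R : RMatrix k H) : Fin R.card → H :=
  (TensorProduct.exists_sum_tmul_eq R.elt).choose_spec.choose

/-- The second tensor legs `R₂ᵢ` of `R = ∑ i, R₁ᵢ ⊗ R₂ᵢ`. -/
def RMatrix.snd (R : RMatrix k H) : Fin R.card → H :=
  (TensorProduct.exists_sum_tmul_eq R.elt).choose_spec.choose_spec.choose

theorem RMatrix.elt_eq_sum (R : RMatrix k H) : R.elt = ∑ i, R.fst i ⊗ₜ[k] R.snd i :=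
  (TensorProduct.exists_sum_tmul_eq R.elt).choose_spec.choose_spec.choose_spec

end RMatrix

/-! ## The restricted dual -/

section RestrictedDual

variable {k : Type u} [Field k] {H : Type v} [Ring H] [HopfAlgebra k H]

/-- The matrix coefficient `h ↦ σ (h · x)` of a left `H`-module `X`. -/
def matrixCoeff {X : Type w} [AddCommGroup X] [Module k X]
    (ρ : H →ₐ[k] Module.End k X) (σ : Module.Dual k X) (x : X) : Module.Dual k H :=
  σ ∘ₗ LinearMap.applyₗ x ∘ₗ ρ.toLinearMap

variable (k H) in
/-- The restricted dual `H°`: the span of the matrix coefficients of the finite-dimensional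
left `H`-modules. -/
def restrictedDual : Submodule k (Module.Dual k H) :=
  Submodule.span k {φ | ∃ (X : Type u) (_ : AddCommGroup X) (_ : Module k X)
    (_ : FiniteDimensional k X) (ρ : H →ₐ[k] Module.End k X) (σ : Module.Dual k X) (x : X),
    φ = matrixCoeff ρ σ x}

theorem lact_mem (a : H) (φ : Module.Dual k H) (hφ : φ ∈ restrictedDual k H) :
    φ ∘ₗ LinearMap.mulRight k a ∈ restrictedDual k H := by
  induction hφ using Submodule.span_induction with
  | mem φ h =>
    obtain ⟨X, _, _, _, ρ, σ, x, rfl⟩ := h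
    refine Submodule.subset_span ⟨X, _, _, ‹_›, ρ, σ, ρ a x, ?_⟩
    ext h
    simp [matrixCoeff]
  | zero => simp
  | add x y _ _ hx hy => rw [LinearMap.add_comp]; exact add_mem hx hy
  | smul c x _ hx => rw [LinearMap.smul_comp]; exact Submodule.smul_mem _ c hx

theorem ract_mem (a : H) (φ : Module.Dual k H) (hφ : φ ∈ restrictedDual k H) :
    φ ∘ₗ LinearMap.mulLeft k a ∈ restrictedDual k H := by
  induction hφ using Submodule.span_induction with
  | mem φ h =>
    obtain ⟨X, _, _, _, ρ, σ, x, rfl⟩ := h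
    refine Submodule.subset_span ⟨X, _, _, ‹_›, ρ, σ ∘ₗ ρ a, x, ?_⟩
    ext h
    simp [matrixCoeff]
  | zero => simp
  | add x y _ _ hx hy => rw [LinearMap.add_comp]; exact add_mem hx hy
  | smul c x _ hx => rw [LinearMap.smul_comp]; exact Submodule.smul_mem _ c hx

/-- The convolution product of linear forms, `(φ ⋆ ψ)(h) = φ(h₍₁₎) ψ(h₍₂₎)`. -/
def dualStar : Module.Dual k H →ₗ[k] Module.Dual k H →ₗ[k] Module.Dual k H :=
  LinearMap.mk₂ k
    (fun φ ψ => LinearMap.mul' k k ∘ₗ TensorProduct.map φ ψ ∘ₗ Coalgebra.comul)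
    (fun φ φ' ψ => by simp [TensorProduct.map_add_left, LinearMap.add_comp, LinearMap.comp_add])
    (fun c φ ψ => by simp [TensorProduct.map_smul_left, LinearMap.smul_comp, LinearMap.comp_smul])
    (fun φ ψ ψ' => by simp [TensorProduct.map_add_right, LinearMap.add_comp, LinearMap.comp_add])
    (fun c φ ψ => by simp [TensorProduct.map_smul_right, LinearMap.smul_comp, LinearMap.comp_smul])

theorem dualStar_apply (φ ψ : Module.Dual k H) (h : H) :
    dualStar φ ψ h = LinearMap.mul' k k (TensorProduct.map φ ψ (Coalgebra.comul h)) := rfl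

theorem dualStar_mem (φ ψ : Module.Dual k H) (hφ : φ ∈ restrictedDual k H)
    (hψ : ψ ∈ restrictedDual k H) : dualStar φ ψ ∈ restrictedDual k H := by
  induction hφ using Submodule.span_induction with
  | mem φ h =>
    induction hψ using Submodule.span_induction with
    | mem ψ h' =>
      obtain ⟨X, _, _, _, ρ, σ, x, rfl⟩ := h
      obtain ⟨Y, _, _, _, ρ', τ, y, rfl⟩ := h'
      refine Submodule.subset_span ⟨X ⊗[k] Y, inferInstance, inferInstance, inferInstance,
        ((Module.endTensorEndAlgHom (R := k) (S := k) (A := k) (M := X) (N := Y)).comp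
          (Algebra.TensorProduct.map ρ ρ')).comp (Bialgebra.comulAlgHom k H),
        LinearMap.mul' k k ∘ₗ TensorProduct.map σ τ, x ⊗ₜ y, ?_⟩
      ext h
      simp only [dualStar_apply, matrixCoeff, LinearMap.comp_apply, AlgHom.toLinearMap_apply,
        AlgHom.comp_apply, Bialgebra.comulAlgHom_apply, LinearMap.applyₗ_apply_apply]
      generalize (Coalgebra.comul h : H ⊗[k] H) = t
      induction t with
      | zero => simp
      | add a b ha hb => simp only [map_add, LinearMap.add_apply, ha, hb]
      | tmul a b => simp [Module.endTensorEndAlgHom_apply]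
    | zero => simp
    | add x y _ _ hx hy => rw [map_add]; exact add_mem hx hy
    | smul c x _ hx => rw [map_smul]; exact Submodule.smul_mem _ c hx
  | zero => simp
  | add x y _ _ hx hy => rw [map_add]; exact add_mem hx hy
  | smul c x _ hx => rw [map_smul]; exact Submodule.smul_mem _ c hx

theorem counit_mem : (Coalgebra.counit : Module.Dual k H) ∈ restrictedDual k H := by
  refine Submodule.subset_span ⟨k, inferInstance, inferInstance, inferInstance,
    (Algebra.lmul k k).comp (Bialgebra.counitAlgHom k H), LinearMap.id, 1, ?_⟩
  ext h
  simp [matrixCoeff]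

/-- The left coregular action on `H°`: `(a ▷ φ)(h) = φ(h a)`. -/
def lact : H →ₗ[k] restrictedDual k H →ₗ[k] restrictedDual k H :=
  LinearMap.mk₂ k (fun a φ => ⟨φ.1 ∘ₗ LinearMap.mulRight k a, lact_mem a φ.1 φ.2⟩)
    (fun a b φ => by ext h; simp [mul_add])
    (fun c a φ => by ext h; simp)
    (fun a φ ψ => by ext h; simp)
    (fun c a φ => by ext h; simp)

/-- The right coregular action on `H°`: `ract a φ = φ ◁ a`, with `(φ ◁ a)(h) = φ(a h)`. -/
def ract : H →ₗ[k] restrictedDual k H →ₗ[k] restrictedDual k H :=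
  LinearMap.mk₂ k (fun a φ => ⟨φ.1 ∘ₗ LinearMap.mulLeft k a, ract_mem a φ.1 φ.2⟩)
    (fun a b φ => by ext h; simp [add_mul])
    (fun c a φ => by ext h; simp)
    (fun a φ ψ => by ext h; simp)
    (fun c a φ => by ext h; simp)

/-- The product `⋆` of `H°`, dual to the coproduct of `H`. -/
def star : restrictedDual k H →ₗ[k] restrictedDual k H →ₗ[k] restrictedDual k H :=
  LinearMap.mk₂ k (fun φ ψ => ⟨dualStar φ.1 ψ.1, dualStar_mem φ.1 ψ.1 φ.2 ψ.2⟩)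
    (fun a b φ => by ext h; simp)
    (fun c a φ => by ext h; simp)
    (fun a φ ψ => by ext h; simp)
    (fun c a φ => by ext h; simp)

variable (k H) in
/-- The counit `ε` of `H`, as an element of `H°`. -/
def eps : restrictedDual k H := ⟨Coalgebra.counit, counit_mem⟩

/-- The right coadjoint action `coadʳ(h)(φ) = S(h₍₂₎) ▷ φ ◁ h₍₁₎`. -/
def coad : H →ₗ[k] restrictedDual k H →ₗ[k] restrictedDual k H :=
  TensorProduct.lift
      (((LinearMap.mul k (Module.End k (restrictedDual k H))).compl₁₂
        (lact ∘ₗ HopfAlgebra.antipode k) ract).flip) ∘ₗ Coalgebra.comul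

/-- The right action `D(h)(ψ) = S(h₍₁₎) ▷ ψ ◁ h₍₂₎` of `H` on `H°`. -/
def DAct : H →ₗ[k] Module.End k (restrictedDual k H) :=
  TensorProduct.lift
      ((LinearMap.mul k (Module.End k (restrictedDual k H))).compl₁₂
        (lact ∘ₗ HopfAlgebra.antipode k) ract) ∘ₗ Coalgebra.comul

end RestrictedDual

/-! ## Module-algebras and their braided tensor products -/

section ModuleAlgebra

/-- The structure maps of a right `H`-module-algebra on the vector space `A`: product, unit, and
right action `act h x = x ◂ h`. The axioms are stated in `HModAlg.IsModuleAlgebra`. -/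
structure HModAlg (k : Type u) [Field k] (H : Type v) [Ring H] [HopfAlgebra k H]
    (A : Type w) [AddCommMonoid A] [Module k A] where
  /-- the product -/
  mul : A →ₗ[k] A →ₗ[k] A
  /-- the unit -/
  one : A
  /-- the right action of `H` -/
  act : H →ₗ[k] A →ₗ[k] A

variable {k : Type u} [Field k] {H : Type v} [Ring H] [HopfAlgebra k H]
variable {A : Type*} [AddCommMonoid A] [Module k A] {B : Type*} [AddCommMonoid B] [Module k B]

/-- The diagonal action `(x ⊗ y) ◂ h = (x ◂ h₍₁₎) ⊗ (y ◂ h₍₂₎)` on a tensor product. -/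
def tensorAct (actA : H →ₗ[k] A →ₗ[k] A) (actB : H →ₗ[k] B →ₗ[k] B) :
    H →ₗ[k] (A ⊗[k] B) →ₗ[k] (A ⊗[k] B) :=
  TensorProduct.homTensorHomMap (RingHom.id k) A B A B ∘ₗ TensorProduct.map actA actB ∘ₗ
    Coalgebra.comul

/-- The axioms of a right `H`-module-algebra: an associative unital algebra with a right
`H`-module structure such that `(x y) ◂ h = (x ◂ h₍₁₎) (y ◂ h₍₂₎)` and `1 ◂ h = ε(h) 1`. -/
structure HModAlg.IsModuleAlgebra (X : HModAlg k H A) : Prop where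
  mul_assoc : ∀ x y z, X.mul (X.mul x y) z = X.mul x (X.mul y z)
  one_mul : ∀ x, X.mul X.one x = x
  mul_one : ∀ x, X.mul x X.one = x
  act_one : ∀ x, X.act 1 x = x
  act_mul : ∀ h h' x, X.act (h * h') x = X.act h' (X.act h x)
  mul_act : ∀ h x y,
    X.act h (X.mul x y) = TensorProduct.lift X.mul (tensorAct X.act X.act h (x ⊗ₜ[k] y))
  one_act : ∀ h, X.act h X.one = (Coalgebra.counit h : k) • X.one

/-- `f` is a morphism of unital algebras. -/
def HModAlg.IsAlgMorphism (X : HModAlg k H A) (Y : HModAlg k H B) (f : A →ₗ[k] B) : Prop :=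
  (∀ x y, f (X.mul x y) = Y.mul (f x) (f y)) ∧ f X.one = Y.one

/-- `f` commutes with the actions of `H`. -/
def HModAlg.IsEquivariant (X : HModAlg k H A) (Y : HModAlg k H B) (f : A →ₗ[k] B) : Prop :=
  ∀ h x, f (X.act h x) = Y.act h (f x)

/-- The product on `A ⊗ B` with exchange map `τ`: if `τ (b ⊗ a') = ∑ a'' ⊗ b''` then
`(a ⊗ b) (a' ⊗ b') = ∑ a a'' ⊗ b'' b'`. -/
def twistedMul (mulA : A →ₗ[k] A →ₗ[k] A) (mulB : B →ₗ[k] B →ₗ[k] B)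
    (τ : B ⊗[k] A →ₗ[k] A ⊗[k] B) : (A ⊗[k] B) →ₗ[k] (A ⊗[k] B) →ₗ[k] (A ⊗[k] B) :=
  TensorProduct.curry
    (TensorProduct.map (TensorProduct.lift mulA) (TensorProduct.lift mulB) ∘ₗ
      (TensorProduct.tensorTensorTensorAssoc k A A B B).symm.toLinearMap ∘ₗ
      TensorProduct.map (TensorProduct.map LinearMap.id τ) LinearMap.id ∘ₗ
      (TensorProduct.tensorTensorTensorAssoc k A B A B).toLinearMap)

theorem twistedMul_tmul (mulA : A →ₗ[k] A →ₗ[k] A) (mulB : B →ₗ[k] B →ₗ[k] B)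
    (τ : B ⊗[k] A →ₗ[k] A ⊗[k] B) (a a' : A) (b b' : B) :
    twistedMul mulA mulB τ (a ⊗ₜ b) (a' ⊗ₜ b') =
      TensorProduct.map (mulA a) (mulB.flip b') (τ (b ⊗ₜ a')) := by
  simp only [twistedMul, TensorProduct.curry_apply, LinearMap.comp_apply,
    LinearEquiv.coe_coe, TensorProduct.tensorTensorTensorAssoc_tmul, TensorProduct.map_tmul,
    LinearMap.id_apply]
  generalize τ (b ⊗ₜ a') = t
  induction t with
  | zero => simp
  | add x y hx hy => simp only [map_add, TensorProduct.tmul_add, TensorProduct.add_tmul, hx, hy]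
  | tmul x y => simp

/-- The braiding `c(y ⊗ x) = (x ◂ R₁) ⊗ (y ◂ R₂)` of right `H`-modules. -/
def braiding (R : RMatrix k H) (actA : H →ₗ[k] A →ₗ[k] A) (actB : H →ₗ[k] B →ₗ[k] B) :
    B ⊗[k] A →ₗ[k] A ⊗[k] B :=
  (∑ i, TensorProduct.map (actA (R.fst i)) (actB (R.snd i))) ∘ₗ
    (TensorProduct.comm k B A).toLinearMap

/-- The braided tensor product of module-algebras:
`(a ⊗ b) (a' ⊗ b') = a (a' ◂ R₁) ⊗ (b ◂ R₂) b'`, with the diagonal action. -/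
def braidedTensor (R : RMatrix k H) (X : HModAlg k H A) (Y : HModAlg k H B) :
    HModAlg k H (A ⊗[k] B) where
  mul := twistedMul X.mul Y.mul (braiding R X.act Y.act)
  one := X.one ⊗ₜ Y.one
  act := tensorAct X.act Y.act

variable (k A) in
/-- The identification `A^{⊗m} ⊗ A ≃ A^{⊗(m+1)}`. -/
def snocEquiv (m : ℕ) :
    (⨂[k] _ : Fin m, A) ⊗[k] A ≃ₗ[k] (⨂[k] _ : Fin (m + 1), A) :=
  TensorProduct.congr (LinearEquiv.refl k _)
      (PiTensorProduct.subsingletonEquiv (R := k) (s := fun _ : Fin 1 => A) 0).symm ≪≫ₗ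
    TensorPower.mulEquiv

theorem snocEquiv_tprod_tmul (m : ℕ) (x : Fin m → A) (a : A) :
    snocEquiv k A m (PiTensorProduct.tprod k x ⊗ₜ a) =
      PiTensorProduct.tprod k (Fin.snoc x a : Fin (m + 1) → A) := by
  simp only [snocEquiv, LinearEquiv.trans_apply, TensorProduct.congr_tmul, LinearEquiv.refl_apply,
    PiTensorProduct.subsingletonEquiv_symm_apply', TensorPower.mulEquiv,
    PiTensorProduct.tmulEquiv_apply, PiTensorProduct.reindex_tprod]
  congr 1
  funext i
  refine Fin.lastCases ?_ (fun j => ?_) i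
  · rw [Fin.snoc_last, finSumFinEquiv_symm_last]
    rfl
  · rw [Fin.snoc_castSucc]
    exact congrArg _ (finSumFinEquiv_symm_apply_castAdd (m := m) (n := 1) j)

/-- The diagonal action on `A^{⊗m}`. -/
def powAct (X : HModAlg k H A) : (m : ℕ) →
    H →ₗ[k] (⨂[k] _ : Fin m, A) →ₗ[k] (⨂[k] _ : Fin m, A)
  | 0 => (Coalgebra.counit : H →ₗ[k] k).smulRight LinearMap.id
  | m + 1 => (snocEquiv k A m).conj.toLinearMap ∘ₗ tensorAct (powAct X m) X.act

/-- The product of the iterated braided tensor product `A^{⊗m}`, bracketed from the left. -/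
def powMul (R : RMatrix k H) (X : HModAlg k H A) : (m : ℕ) →
    (⨂[k] _ : Fin m, A) →ₗ[k] (⨂[k] _ : Fin m, A) →ₗ[k] (⨂[k] _ : Fin m, A)
  | 0 => (PiTensorProduct.isEmptyEquiv (Fin 0)).toLinearMap.smulRight LinearMap.id
  | m + 1 =>
    ((twistedMul (powMul R X m) X.mul (braiding R (powAct X m) X.act)).compl₁₂
      (snocEquiv k A m).symm.toLinearMap (snocEquiv k A m).symm.toLinearMap).compr₂
      (snocEquiv k A m).toLinearMap

/-- The iterated braided tensor product `A ⊗̃ ⋯ ⊗̃ A` (`m` factors). -/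
def braidedPow (R : RMatrix k H) (X : HModAlg k H A) (m : ℕ) :
    HModAlg k H (⨂[k] _ : Fin m, A) where
  mul := powMul R X m
  one := PiTensorProduct.tprod k (fun _ => X.one)
  act := powAct X m

end ModuleAlgebra

/-! ## The algebras `L₀,₁(H)`, `L₁,₀(H)`, `L_{g,n}(H)` -/

section ModuliAlgebras

variable {k : Type u} [Field k] {H : Type v} [Ring H] [HopfAlgebra k H]

/-- `L₀,₁(H)`: the vector space `H°` with the product
`φ ψ = (R²₂ S(R¹₂) ▷ φ) ⋆ (R²₁ ▷ ψ ◁ R¹₁)`, where `R¹`, `R²` are two copies of `R` (indexed by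
`i₁`, `i₂`), and the right coadjoint action. -/
def L01 (R : RMatrix k H) : HModAlg k H (restrictedDual k H) where
  mul := ∑ i₁, ∑ i₂, star.compl₁₂
    (lact (R.snd i₂ * HopfAlgebra.antipode k (R.snd i₁)))
    (lact (R.fst i₂) ∘ₗ ract (R.fst i₁))
  one := eps k H
  act := coad

/-- The exchange map of `L₁,₀(H)`:
`α ⊗ β ↦ (R⁴₂ R³₁ ▷ β ◁ R¹₁ R²₁) ⊗ (R³₂ S(R¹₂) ▷ α ◁ R²₂ R⁴₁)`. -/
def exchange10 (R : RMatrix k H) :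
    restrictedDual k H ⊗[k] restrictedDual k H →ₗ[k]
      restrictedDual k H ⊗[k] restrictedDual k H :=
  (∑ i₁, ∑ i₂, ∑ i₃, ∑ i₄, TensorProduct.map
    (lact (R.snd i₄ * R.fst i₃) ∘ₗ ract (R.fst i₁ * R.fst i₂))
    (lact (R.snd i₃ * HopfAlgebra.antipode k (R.snd i₁)) ∘ₗ ract (R.snd i₂ * R.fst i₄))) ∘ₗ
    (TensorProduct.comm k (restrictedDual k H) (restrictedDual k H)).toLinearMap

/-- `L₁,₀(H)`: the vector space `H° ⊗ H°` with the product determined by: `β ↦ β ⊗ ε` and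
`α ↦ ε ⊗ α` are algebra morphisms from `L₀,₁(H)`, `(β ⊗ ε) (ε ⊗ α) = β ⊗ α`, and
`(ε ⊗ α) (β ⊗ ε) = exchange10 (α ⊗ β)`; the action is the diagonal coadjoint action. -/
def L10 (R : RMatrix k H) : HModAlg k H (restrictedDual k H ⊗[k] restrictedDual k H) where
  mul := twistedMul (L01 R).mul (L01 R).mul (exchange10 R)
  one := eps k H ⊗ₜ eps k H
  act := tensorAct coad coad

variable (k H) in
/-- The vector space `(H° ⊗ H°)^{⊗g} ⊗ (H°)^{⊗n}` underlying `L_{g,n}(H)`. -/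
abbrev LgnSpace (g n : ℕ) : Type (max u v) :=
  (⨂[k] _ : Fin g, restrictedDual k H ⊗[k] restrictedDual k H) ⊗[k]
    (⨂[k] _ : Fin n, restrictedDual k H)

/-- `L_{g,n}(H)`: the braided tensor product of `g` copies of `L₁,₀(H)` and `n` copies
of `L₀,₁(H)`. -/
def Lgn (R : RMatrix k H) (g n : ℕ) : HModAlg k H (LgnSpace k H g n) :=
  braidedTensor R (braidedPow R (L10 R) g) (braidedPow R (L01 R) n)

/-- The embedding `𝔢ᵢ : L₁,₀(H) → L_{g,n}(H)` of the `i`-th factor, for `1 ≤ i ≤ g`. -/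
def embL10 (R : RMatrix k H) (g n : ℕ) (i : Fin g)
    (x : restrictedDual k H ⊗[k] restrictedDual k H) : LgnSpace k H g n :=
  PiTensorProduct.tprod k (Function.update (fun _ => (L10 R).one) i x) ⊗ₜ
    PiTensorProduct.tprod k (fun _ => (L01 R).one)

/-- The embedding `𝔢_{g+j} : L₀,₁(H) → L_{g,n}(H)` of the `(g+j)`-th factor, for `1 ≤ j ≤ n`. -/
def embL01 (R : RMatrix k H) (g n : ℕ) (j : Fin n) (φ : restrictedDual k H) :
    LgnSpace k H g n :=
  PiTensorProduct.tprod k (fun _ => (L10 R).one) ⊗ₜ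
    PiTensorProduct.tprod k (Function.update (fun _ => (L01 R).one) j φ)

/-! ## The representation of `L₁,₀(H)` on `H°` and the map `Φ₀,₁` -/

/-- `Φ₀,₁(φ) = (φ ⊗ id)(R R')`, where `R'` is the flip of `R`. -/
def Phi01 (R : RMatrix k H) : restrictedDual k H →ₗ[k] H :=
  LinearMap.applyₗ (R.elt * TensorProduct.comm k H H R.elt) ∘ₗ
    (TensorProduct.lid k H).toLinearMap.compRight k ∘ₗ
    (TensorProduct.mapBilinear (RingHom.id k) H H k H).flip LinearMap.id ∘ₗ
    (restrictedDual k H).subtype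

theorem Phi01_apply (R : RMatrix k H) (φ : restrictedDual k H) :
    Phi01 R φ = TensorProduct.lid k H
      (TensorProduct.map φ.1 LinearMap.id (R.elt * TensorProduct.comm k H H R.elt)) := rfl

/-- `H` is factorizable if `Φ₀,₁` is bijective. -/
def IsFactorizable (R : RMatrix k H) : Prop := Function.Bijective (Phi01 R)

/-- The action of `(φ ⊗ ε)` on `H°`:
`ψ ↦ (R¹₂ R²₂ ▷ φ ◁ R³₁ R¹₁) ⋆ (R³₂ R²₁ ▷ ψ)`. -/
def repB (R : RMatrix k H) : restrictedDual k H →ₗ[k] Module.End k (restrictedDual k H) :=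
  ∑ i₁, ∑ i₂, ∑ i₃, star.compl₁₂
    (lact (R.snd i₁ * R.snd i₂) ∘ₗ ract (R.fst i₃ * R.fst i₁))
    (lact (R.snd i₃ * R.fst i₂))

/-- The action of `(ε ⊗ φ)` on `H°`: `ψ ↦ Φ₀,₁(φ) ▷ ψ`. -/
def repA (R : RMatrix k H) : restrictedDual k H →ₗ[k] Module.End k (restrictedDual k H) :=
  lact ∘ₗ Phi01 R

/-- The representation `ρ₁,₀ : L₁,₀(H) → End(H°)`, sending `β ⊗ α` to the action of `β ⊗ ε`
composed with that of `ε ⊗ α`. -/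
def rho10 (R : RMatrix k H) :
    restrictedDual k H ⊗[k] restrictedDual k H →ₗ[k] Module.End k (restrictedDual k H) :=
  TensorProduct.lift
    ((LinearMap.mul k (Module.End k (restrictedDual k H))).compl₁₂ (repB R) (repA R))

/-! ## Iterated coproducts and the target `End(H°)^{⊗g} ⊗ H^{⊗n}` -/

variable (k H) in
/-- The iterated coproduct `h ↦ h₍₁₎ ⊗ ⋯ ⊗ h₍ₘ₎` (the counit for `m = 0`). -/
def iterComul : (m : ℕ) → H →ₗ[k] (⨂[k] _ : Fin m, H)
  | 0 => (PiTensorProduct.isEmptyEquiv (Fin 0)).symm.toLinearMap ∘ₗ Coalgebra.counit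
  | m + 1 => (snocEquiv k H m).toLinearMap ∘ₗ
      TensorProduct.map (iterComul m) LinearMap.id ∘ₗ Coalgebra.comul

variable {B : Type w} [Semiring B] [Algebra k B]

theorem fill_update (F : H →ₗ[k] B) (N m : ℕ) (hm : m ≤ N) (z : Fin N → B) (c : Fin m → H)
    (p : Fin m) (x : H) :
    (fun t : Fin N => if h : t.1 < m then F (Function.update c p x ⟨t.1, h⟩) else z t) =
      Function.update (fun t : Fin N => if h : t.1 < m then F (c ⟨t.1, h⟩) else z t)
        (Fin.castLE hm p) (F x) := by
  funext t
  by_cases ht : t = Fin.castLE hm p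
  · subst ht
    simp
  · rw [Function.update_of_ne ht]
    by_cases h : t.1 < m
    · have : (⟨t.1, h⟩ : Fin m) ≠ p := fun e => ht (by ext; simp [← e])
      simp [h, Function.update_of_ne this]
    · simp [h]

/-- `(c₁, …, cₘ) ↦ F(c₁) ⊗ ⋯ ⊗ F(cₘ) ⊗ z_{m+1} ⊗ ⋯ ⊗ z_N`. -/
def fillMultilinear (F : H →ₗ[k] B) (N m : ℕ) (hm : m ≤ N) (z : Fin N → B) :
    MultilinearMap k (fun _ : Fin m => H) (⨂[k] _ : Fin N, B) :=
  MultilinearMap.mk'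
    (fun c => PiTensorProduct.tprod k
      (fun t : Fin N => if h : t.1 < m then F (c ⟨t.1, h⟩) else z t))
    (fun c p x y => by
      simp only [fill_update F N m hm, map_add, MultilinearMap.map_update_add])
    (fun c p a x => by
      simp only [fill_update F N m hm, map_smul, MultilinearMap.map_update_smul])

/-- `h ↦ F(h₍₁₎) ⊗ ⋯ ⊗ F(h₍ₘ₎) ⊗ z_{m+1} ⊗ ⋯ ⊗ z_N`, for `m ≤ N`. -/
def legs (F : H →ₗ[k] B) (N m : ℕ) (hm : m ≤ N) (z : Fin N → B) :
    H →ₗ[k] (⨂[k] _ : Fin N, B) :=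
  PiTensorProduct.lift (fillMultilinear F N m hm z) ∘ₗ iterComul k H m

/-- `h ↦ F(h₍₁₎) ⊗ ⋯ ⊗ F(h₍ₘ₎)`. -/
def allLegs (F : H →ₗ[k] B) (m : ℕ) : H →ₗ[k] (⨂[k] _ : Fin m, B) :=
  PiTensorProduct.map (fun _ => F) ∘ₗ iterComul k H m

/-- `h ↦ F(h₍ₘ₎) ⊗ ⋯ ⊗ F(h₍₁₎)`. -/
def allLegsRev (F : H →ₗ[k] B) (m : ℕ) : H →ₗ[k] (⨂[k] _ : Fin m, B) :=
  PiTensorProduct.lift (((PiTensorProduct.tprod k).compLinearMap (fun _ => F)).domDomCongr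
    (Fin.revPerm (n := m))) ∘ₗ iterComul k H m

/-- The algebra `E^{⊗g} ⊗ K^{⊗n}`, with its tensor-wise product. -/
abbrev TensorAlg (k : Type u) [Field k] (E K : Type*) [Semiring E] [Algebra k E]
    [Semiring K] [Algebra k K] (g n : ℕ) : Type _ :=
  (⨂[k] _ : Fin g, E) ⊗[k] (⨂[k] _ : Fin n, K)

variable (k H) in
/-- The algebra `End(H°)^{⊗g} ⊗ H^{⊗n}`, with its tensor-wise product. -/
abbrev Target (g n : ℕ) : Type (max u v) :=
  TensorAlg k (Module.End k (restrictedDual k H)) H g n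

variable (k H) in
/-- `h ↦ D(h₍₁₎) ⊗ ⋯ ⊗ D(h₍g₎) ⊗ S(h₍g+1₎) ⊗ ⋯ ⊗ S(h₍g+n₎)`. -/
def targetLeft (g n : ℕ) : H →ₗ[k] Target k H g n :=
  TensorProduct.map (allLegs DAct g) (allLegs (HopfAlgebra.antipode k) n) ∘ₗ Coalgebra.comul

/-- The inverse of the antipode. -/
def antipodeInv (hS : Function.Bijective (HopfAlgebra.antipode k : H →ₗ[k] H)) : H →ₗ[k] H :=
  (LinearEquiv.ofBijective (HopfAlgebra.antipode k : H →ₗ[k] H) hS).symm.toLinearMap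

/-- `h ↦ D(S⁻¹(h₍g+n₎)) ⊗ ⋯ ⊗ D(S⁻¹(h₍n+1₎)) ⊗ h₍n₎ ⊗ ⋯ ⊗ h₍₁₎`. -/
def targetRight (hS : Function.Bijective (HopfAlgebra.antipode k : H →ₗ[k] H)) (g n : ℕ) :
    H →ₗ[k] Target k H g n :=
  TensorProduct.map (allLegsRev (DAct ∘ₗ antipodeInv hS) g) (allLegsRev LinearMap.id n) ∘ₗ
    (TensorProduct.comm k H H).toLinearMap ∘ₗ Coalgebra.comul

/-- The target as a right `H`-module-algebra. By coassociativity,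
`x ◂ h = targetLeft(h₍₁₎) x targetRight(h₍₂₎)` is the action
`(E₁ ⊗ ⋯ ⊗ E_g ⊗ k₁ ⊗ ⋯ ⊗ k_n) ◂ h = ⨂ᵢ D(h₍ᵢ₎) ∘ Eᵢ ∘ D(S⁻¹(h₍2g+2n+1-i₎)) ⊗
⨂ⱼ S(h₍g+j₎) kⱼ h₍g+2n+1-j₎`. -/
def target (hS : Function.Bijective (HopfAlgebra.antipode k : H →ₗ[k] H)) (g n : ℕ) :
    HModAlg k H (Target k H g n) where
  mul := LinearMap.mul k (Target k H g n)
  one := 1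
  act := TensorProduct.lift
      ((LinearMap.mul k (Module.End k (Target k H g n))).compl₁₂
        (LinearMap.mul k (Target k H g n) ∘ₗ targetLeft k H g n)
        ((LinearMap.mul k (Target k H g n)).flip ∘ₗ targetRight hS g n)) ∘ₗ Coalgebra.comul

/-! ## The defining formulas of the Alekseev morphism -/

/-- `D(R₁₍₁₎) ⊗ ⋯ ⊗ D(R₁₍ᵢ₋₁₎) ⊗ ρ₁,₀(x ◂ R₂) ⊗ id^{⊗(g-i)} ⊗ 1^{⊗n}`. (The index `i : Fin g`
starts at `0`, so that `i.1` factors precede it.) -/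
def formulaL10 (R : RMatrix k H) (g n : ℕ) (i : Fin g)
    (x : restrictedDual k H ⊗[k] restrictedDual k H) : Target k H g n :=
  ∑ r, legs DAct g i.1 i.isLt.le
      (Function.update (fun _ => 1) i (rho10 R ((L10 R).act (R.snd r) x))) (R.fst r) ⊗ₜ[k]
    (1 : ⨂[k] _ : Fin n, H)

/-- `D(R₁₍₁₎) ⊗ ⋯ ⊗ D(R₁₍g₎) ⊗ S(R₁₍g+1₎) ⊗ ⋯ ⊗ S(R₁₍g+j-1₎) ⊗ Φ₀,₁(φ ◂ R₂) ⊗ 1^{⊗(n-j)}`. (The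
index `j : Fin n` starts at `0`, so that `j.1` factors of `H^{⊗n}` precede it.) -/
def formulaL01 (R : RMatrix k H) (g n : ℕ) (j : Fin n) (φ : restrictedDual k H) :
    Target k H g n :=
  ∑ r, TensorProduct.map (allLegs DAct g)
      (legs (HopfAlgebra.antipode k) n j.1 j.isLt.le
        (Function.update (fun _ => 1) j (Phi01 R ((L01 R).act (R.snd r) φ))))
      (Coalgebra.comul (R.fst r))

end ModuliAlgebras

end QuantumModuli

end

/-! Let `B` be an algebra with an algebra morphism ν : H → B. It is a right module-algebra for the
adjoint action b ◂ h = ν(S(h₍₁₎)) b ν(h₍₂₎). The proof rests on one construction for such actions.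
Let f : X → B and f' : X' → B' be morphisms of module-algebras for ν and ν', and put 𝓡 = (ν ⊗
ν')(R). Then a ⊗ a' ↦ (f(a) ⊗ 1) 𝓡 (1 ⊗ f'(a')) 𝓡⁻¹ is a morphism from the braided tensor product of
X and X' to the ordinary tensor product B ⊗ B', and it is equivariant for the adjoint action given
by h ↦ ν(h₍₂₎) ⊗ ν'(h₍₁₎). Conjugation by 𝓡 undoes the braiding. When expanded, it is a ⊗ a' ↦ f(a)
ν(S(R₁)) ⊗ f'(a' ◂ R₂), which is the shape of the required formulas (`combine_tmul_conj`,
`combine_isAdjointMorphism`). It is bijective when f and f' are (`combine_bijective`). Iteration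
gives the Alekseev morphism, and the target action is the resulting adjoint action
(`target_eq_adjoint`).

The building blocks are Φ₀,₁, with ν = id, and ρ₁,₀, with ν ∘ S = D. To treat them, the right
translations are twisted by S⁻¹, so that the translations L(h) = h ▷ · and Y(h) = · ◁ S⁻¹(h) are
commuting algebra morphisms from H to End(H°). The product of L₀,₁, the exchange map of L₁,₀ and the
map ρ_b are then given by products of elements ∑ f(R₁) g(R₂) and their inverses, where f and g are
built from translations of the tensor slots. Associativity, the hexagon relations for the exchange,
the representation property and equivariance become identities in an arbitrary algebra. They follow
from the R-matrix axioms (`el_conv_left`, `el_conv_right`, `el_mul_conv`) and the naturality of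
these elements under conjugation (`mul_el_of_intertwines`).

Uniqueness holds because a ⊗ b = (a ⊗ 1)(1 ⊗ b), so that the embedded factors generate. For
bijectivity, ρ₁,₀ is id ⊗ Φ₀,₁, followed by an invertible operator, followed by the Heisenberg
representation β ⊗ h ↦ β ⋆ (h ▷ ·). The latter is injective when H° is the whole dual, and the
dimensions agree (`rho10_bijective`). -/

noncomputable section

namespace QuantumModuli

universe u v w

set_option linter.unusedSectionVars false

/-! ## Convolution of linear maps from a Hopf algebra to an algebra -/

section Convolution

variable {k : Type*} [Field k] {H : Type*} [Ring H] [HopfAlgebra k H]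
variable {E : Type*} [Ring E] [Algebra k E]

/-- The values of `f` commute with those of `g`. -/
class Commuting (f g : H →ₗ[k] E) : Prop where
  comm : ∀ a b, f a * g b = g b * f a

/-- The linear map `f` is a morphism of unital algebras. -/
class IsHom (f : H →ₗ[k] E) : Prop where
  map_one : f 1 = 1
  map_mul : ∀ a b, f (a * b) = f a * f b

/-- The convolution product of linear maps, `(f ⊛ g)(h) = f(h₍₁₎) g(h₍₂₎)`. -/
def conv (f g : H →ₗ[k] E) : H →ₗ[k] E :=
  LinearMap.mul' k E ∘ₗ TensorProduct.map f g ∘ₗ Coalgebra.comul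

local infixr:75 " ⊛ " => conv

instance (priority := low) Commuting.symm {f g : H →ₗ[k] E} [h : Commuting f g] : Commuting g f :=
  ⟨fun a b => (h.comm b a).symm⟩

theorem conv_apply (f g : H →ₗ[k] E) {h : H} {ι : Type*} (r : Coalgebra.Repr k h ι) :
    (f ⊛ g) h = ∑ i ∈ r.index, f (r.left i) * g (r.right i) := by
  simp [conv, ← r.eq]

theorem conv_assoc (f g p : H →ₗ[k] E) : (f ⊛ g) ⊛ p = f ⊛ g ⊛ p :=
  congrArg WithConv.ofConv
    (mul_assoc (WithConv.toConv f) (WithConv.toConv g) (WithConv.toConv p))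

/-- The unit of the convolution product. -/
def convUnit : H →ₗ[k] E := Algebra.linearMap k E ∘ₗ Coalgebra.counit

theorem convUnit_conv (f : H →ₗ[k] E) : convUnit ⊛ f = f :=
  congrArg WithConv.ofConv (one_mul (WithConv.toConv f))

theorem conv_convUnit (f : H →ₗ[k] E) : f ⊛ convUnit = f :=
  congrArg WithConv.ofConv (mul_one (WithConv.toConv f))

/-- The linear map `f ∘ S`. -/
def anti (f : H →ₗ[k] E) : H →ₗ[k] E := f ∘ₗ HopfAlgebra.antipode k

theorem anti_apply (f : H →ₗ[k] E) (h : H) : anti f h = f (HopfAlgebra.antipode k h) := rfl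

theorem conv_anti (f : H →ₗ[k] E) [IsHom f] : f ⊛ anti f = convUnit := by
  ext h
  rw [conv_apply f _ (Coalgebra.Repr.arbitrary k h)]
  simp only [anti_apply, ← IsHom.map_mul, ← map_sum, HopfAlgebra.sum_mul_antipode_eq_smul, map_smul,
    IsHom.map_one (f := f)]
  simp [convUnit, Algebra.algebraMap_eq_smul_one]

theorem anti_conv (f : H →ₗ[k] E) [IsHom f] : anti f ⊛ f = convUnit := by
  ext h
  rw [conv_apply _ _ (Coalgebra.Repr.arbitrary k h)]
  simp only [anti_apply, ← IsHom.map_mul, ← map_sum, HopfAlgebra.sum_antipode_mul_eq_smul, map_smul,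
    IsHom.map_one (f := f)]
  simp [convUnit, Algebra.algebraMap_eq_smul_one]

instance Commuting.conv_left (f g p : H →ₗ[k] E) [hf : Commuting f p] [hg : Commuting g p] :
    Commuting (f ⊛ g) p := ⟨fun a b => by
  rw [conv_apply _ _ (Coalgebra.Repr.arbitrary k a), Finset.sum_mul, Finset.mul_sum]
  refine Finset.sum_congr rfl fun i _ => ?_
  rw [mul_assoc, hg.comm, ← mul_assoc, hf.comm, mul_assoc]⟩

instance Commuting.conv_right (f g p : H →ₗ[k] E) [hf : Commuting p f] [hg : Commuting p g] :
    Commuting p (f ⊛ g) :=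
  (@Commuting.conv_left _ _ _ _ _ _ _ _ f g p hf.symm hg.symm).symm

instance Commuting.anti_left (f p : H →ₗ[k] E) [hf : Commuting f p] : Commuting (anti f) p :=
  ⟨fun _ _ => hf.comm _ _⟩

/-- Δ is multiplicative, and commutation reorders the four factors. Thus the diagonal action on
several commuting slots is again available as an algebra morphism. -/
instance IsHom.conv (f g : H →ₗ[k] E) [IsHom f] [IsHom g] [hfg : Commuting f g] :
    IsHom (f ⊛ g) where
  map_one := by
    simp [QuantumModuli.conv, Bialgebra.comul_one, Algebra.TensorProduct.one_def,
      IsHom.map_one (f := f), IsHom.map_one (f := g)]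
  map_mul a b := by
    simp only [QuantumModuli.conv, LinearMap.comp_apply, Bialgebra.comul_mul]
    generalize (Coalgebra.comul a : H ⊗[k] H) = s
    generalize (Coalgebra.comul b : H ⊗[k] H) = t
    induction s with
    | zero => simp
    | add x y hx hy => simp only [add_mul, map_add, hx, hy]
    | tmul x y =>
      induction t with
      | zero => simp
      | add x y hx hy => simp only [mul_add, map_add, hx, hy]
      | tmul z w =>
        simp only [Algebra.TensorProduct.tmul_mul_tmul, TensorProduct.map_tmul,
          LinearMap.mul'_apply, IsHom.map_mul]
        rw [mul_assoc, ← mul_assoc (f z), hfg.comm, mul_assoc, ← mul_assoc]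

theorem conv_comm (f g : H →ₗ[k] E) (hfg : Commuting f g) (h : H) :
    (f ⊛ g) h = LinearMap.mul' k E (TensorProduct.map g f
      (TensorProduct.comm k H H (Coalgebra.comul h))) := by
  rw [conv_apply _ _ (Coalgebra.Repr.arbitrary k h), ← (Coalgebra.Repr.arbitrary k h).eq]
  simp [hfg.comm]

end Convolution

/-! ### Anti-comultiplicativity of the antipode -/

section Antipode

variable {k : Type*} [Field k] {H : Type*} [Ring H] [HopfAlgebra k H]

local infixr:75 " ⊛ " => conv

/-- Uniqueness of convolution inverses: with f, g the two inclusions into `H ⊗ H`, one has Δ = f ⊛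
g. Then Δ ∘ S is a right inverse of Δ, and (g ∘ S) ⊛ (f ∘ S) is a left inverse. -/
theorem comul_antipode (h : H) :
    Coalgebra.comul (HopfAlgebra.antipode k h) =
      TensorProduct.map (HopfAlgebra.antipode k) (HopfAlgebra.antipode k)
        (TensorProduct.comm k H H (Coalgebra.comul h)) := by
  let f : H →ₗ[k] H ⊗[k] H := (Algebra.TensorProduct.includeLeft : H →ₐ[k] H ⊗[k] H).toLinearMap
  let g : H →ₗ[k] H ⊗[k] H := (Algebra.TensorProduct.includeRight : H →ₐ[k] H ⊗[k] H).toLinearMap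
  have : IsHom f := ⟨map_one (Algebra.TensorProduct.includeLeft : H →ₐ[k] H ⊗[k] H),
    map_mul (Algebra.TensorProduct.includeLeft : H →ₐ[k] H ⊗[k] H)⟩
  have : IsHom g := ⟨map_one (Algebra.TensorProduct.includeRight : H →ₐ[k] H ⊗[k] H),
    map_mul (Algebra.TensorProduct.includeRight : H →ₐ[k] H ⊗[k] H)⟩
  have : Commuting f g := ⟨fun a b => by simp [f, g]⟩
  have : Commuting g f := inferInstance
  have hfg : f ⊛ g = Coalgebra.comul := by
    ext h
    rw [conv_apply _ _ (Coalgebra.Repr.arbitrary k h)]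
    simp [f, g, (Coalgebra.Repr.arbitrary k h).eq]
  have h1 : (f ⊛ g) ⊛ (Coalgebra.comul ∘ₗ HopfAlgebra.antipode k) = convUnit := by
    rw [hfg]
    exact congrArg WithConv.ofConv (LinearMap.comul_right_inv (R := k) (C := H))
  have h2 : (anti g ⊛ anti f) ⊛ (f ⊛ g) = convUnit := by
    rw [conv_assoc, ← conv_assoc (anti f), anti_conv, convUnit_conv, anti_conv]
  have h3 : Coalgebra.comul ∘ₗ HopfAlgebra.antipode k = anti g ⊛ anti f := by
    rw [← convUnit_conv (Coalgebra.comul ∘ₗ HopfAlgebra.antipode k), ← h2, conv_assoc, h1,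
      conv_convUnit]
  have := LinearMap.congr_fun h3 h
  rw [LinearMap.comp_apply] at this
  rw [this, conv_apply _ _ (Coalgebra.Repr.arbitrary k h), ← (Coalgebra.Repr.arbitrary k h).eq]
  simp [anti_apply, f, g]

variable {E : Type*} [Ring E] [Algebra k E]

theorem anti_conv_eq (f g : H →ₗ[k] E) [hfg : Commuting f g] :
    anti (f ⊛ g) = anti g ⊛ anti f := by
  ext h
  rw [anti_apply, conv, LinearMap.comp_apply, LinearMap.comp_apply, comul_antipode,
    conv_apply _ _ (Coalgebra.Repr.arbitrary k h), ← (Coalgebra.Repr.arbitrary k h).eq]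
  simp [anti_apply, hfg.comm]

end Antipode

/-! ## The images of the R-matrix in an algebra -/

namespace RMatrix

variable {k : Type*} [Field k] {H : Type*} [Ring H] [HopfAlgebra k H] (R : RMatrix k H)
variable {E : Type*} [Ring E] [Algebra k E]

local infixr:75 " ⊛ " => conv

theorem sum_comul_fst :
    ∑ i, (Coalgebra.comul (R.fst i) : H ⊗[k] H) ⊗ₜ[k] R.snd i =
      ∑ i, ∑ j, (R.fst i ⊗ₜ[k] R.fst j) ⊗ₜ[k] (R.snd i * R.snd j) := by
  have := R.comul_left
  rw [R.elt_eq_sum] at this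
  simpa [Finset.sum_mul_sum] using this

theorem sum_comul_snd :
    ∑ i, R.fst i ⊗ₜ[k] (Coalgebra.comul (R.snd i) : H ⊗[k] H) =
      ∑ i, ∑ j, (R.fst i * R.fst j) ⊗ₜ[k] (R.snd j ⊗ₜ[k] R.snd i) := by
  have := congrArg (TensorProduct.assoc k H H H) R.comul_right
  rw [R.elt_eq_sum] at this
  simpa [Finset.sum_mul_sum, TensorProduct.sum_tmul] using this

/-- `∑ f(R₁) g(R₂)`. -/
def el (f g : H →ₗ[k] E) : E := ∑ i, f (R.fst i) * g (R.snd i)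

/-- `∑ f(S(R₁)) g(R₂)`. -/
def inv (f g : H →ₗ[k] E) : E := ∑ i, f (HopfAlgebra.antipode k (R.fst i)) * g (R.snd i)

theorem inv_eq (f g : H →ₗ[k] E) : R.inv f g = R.el (anti f) g := rfl

theorem el_eq (f g : H →ₗ[k] E) :
    R.el f g = LinearMap.mul' k E (TensorProduct.map f g R.elt) := by
  simp [R.elt_eq_sum, el]

/-- The axiom (Δ ⊗ id)(R) = R₁₃R₂₃ read in `E`. Neither `f` nor `g` has to be multiplicative, so
either may be composed with the antipode. -/
theorem el_conv_left (f g p : H →ₗ[k] E) [IsHom p] [hg : Commuting g p] :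
    R.el (f ⊛ g) p = R.el f p * R.el g p := by
  have := congrArg (LinearMap.mul' k E ∘ₗ
    TensorProduct.map (LinearMap.mul' k E ∘ₗ TensorProduct.map f g) p) R.sum_comul_fst
  simp only [map_sum, LinearMap.comp_apply, TensorProduct.map_tmul, LinearMap.mul'_apply] at this
  simp only [el, conv, LinearMap.comp_apply, this, Finset.sum_mul_sum]
  refine Finset.sum_congr rfl fun i _ => Finset.sum_congr rfl fun j _ => ?_
  rw [IsHom.map_mul, mul_assoc, ← mul_assoc (g _), hg.comm]
  simp only [mul_assoc]

/-- The axiom (id ⊗ Δ)(R) = R₁₃R₁₂ read in `E`. The order of the two slots is reversed. -/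
theorem el_conv_right (f g p : H →ₗ[k] E) [IsHom f] [hf : Commuting f p] [hg : Commuting g p] :
    R.el f (g ⊛ p) = R.el f p * R.el f g := by
  have := congrArg (LinearMap.mul' k E ∘ₗ
    TensorProduct.map f (LinearMap.mul' k E ∘ₗ TensorProduct.map g p)) R.sum_comul_snd
  simp only [map_sum, LinearMap.comp_apply, TensorProduct.map_tmul, LinearMap.mul'_apply] at this
  simp only [el, conv, LinearMap.comp_apply, this, Finset.sum_mul_sum]
  refine Finset.sum_congr rfl fun i _ => Finset.sum_congr rfl fun j _ => ?_
  rw [IsHom.map_mul, mul_assoc, mul_assoc, ← mul_assoc (p _), ← hf.comm, mul_assoc, hg.comm]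

/-- The axiom R Δ = Δᵒᵖ R read in `E`: conjugation by an image of R swaps the two commuting actions
in a convolution product. -/
theorem el_mul_conv (f g : H →ₗ[k] E) [IsHom f] [IsHom g] [hfg : Commuting f g] (h : H) :
    R.el f g * (f ⊛ g) h = (g ⊛ f) h * R.el f g := by
  have hmul : ∀ s t : H ⊗[k] H, LinearMap.mul' k E (TensorProduct.map f g (s * t)) =
      LinearMap.mul' k E (TensorProduct.map f g s) *
        LinearMap.mul' k E (TensorProduct.map f g t) := by
    intro s t
    induction s with
    | zero => simp
    | add x y hx hy => simp only [add_mul, map_add, hx, hy]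
    | tmul x y =>
      induction t with
      | zero => simp
      | add x y hx hy => simp only [mul_add, map_add, hx, hy]
      | tmul z w =>
        simp only [Algebra.TensorProduct.tmul_mul_tmul, TensorProduct.map_tmul,
          LinearMap.mul'_apply, IsHom.map_mul]
        rw [mul_assoc, ← mul_assoc (f z), hfg.comm, mul_assoc, ← mul_assoc]
  have := congrArg (LinearMap.mul' k E ∘ₗ TensorProduct.map f g) (R.quasi_cocomm h)
  simp only [LinearMap.comp_apply, hmul, ← el_eq] at this
  rw [conv_comm g f (Commuting.symm)]
  exact this

theorem mul'_map_counit_comul (h : H) : LinearMap.mul' k k (TensorProduct.map Coalgebra.counit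
    Coalgebra.counit (Coalgebra.comul h : H ⊗[k] H)) = Coalgebra.counit h := by
  rw [← (Coalgebra.Repr.arbitrary k h).eq]
  simp

/-- Applying ε ⊗ ε ⊗ id to (Δ ⊗ id)(R) = R₁₃R₂₃ shows that (ε ⊗ id)(R) is idempotent. It is also
invertible, as the image of R under an algebra morphism, hence equal to 1. -/
theorem sum_counit_smul_snd : ∑ i, (Coalgebra.counit (R.fst i) : k) • R.snd i = 1 := by
  have h : TensorProduct.lid k H (TensorProduct.map Coalgebra.counit LinearMap.id R.elt) *
      TensorProduct.lid k H (TensorProduct.map Coalgebra.counit LinearMap.id R.elt) =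
      TensorProduct.lid k H (TensorProduct.map Coalgebra.counit LinearMap.id R.elt) := by
    have := congrArg ((TensorProduct.lid k H).toLinearMap ∘ₗ TensorProduct.map
      (LinearMap.mul' k k ∘ₗ TensorProduct.map Coalgebra.counit Coalgebra.counit) LinearMap.id)
      R.sum_comul_fst
    rw [R.elt_eq_sum]
    simp only [map_sum, LinearMap.comp_apply, TensorProduct.map_tmul, LinearMap.mul'_apply,
      LinearEquiv.coe_coe, TensorProduct.lid_tmul, LinearMap.id_apply, Finset.sum_mul_sum,
      smul_mul_smul_comm] at this ⊢
    rw [← this]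
    refine Finset.sum_congr rfl fun i _ => ?_
    rw [mul'_map_counit_comul]
  have hu : IsUnit (TensorProduct.lid k H
      (TensorProduct.map Coalgebra.counit LinearMap.id R.elt)) :=
    R.isUnit_elt.map (((Algebra.TensorProduct.lid k H).toAlgHom.comp
      (Algebra.TensorProduct.map (Bialgebra.counitAlgHom k H) (AlgHom.id k H))) :
        H ⊗[k] H →ₐ[k] H)
  have := hu.mul_eq_left.mp h
  rw [R.elt_eq_sum] at this
  simpa using this

theorem sum_counit_smul_fst : ∑ i, (Coalgebra.counit (R.snd i) : k) • R.fst i = 1 := by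
  have h : TensorProduct.rid k H (TensorProduct.map LinearMap.id Coalgebra.counit R.elt) *
      TensorProduct.rid k H (TensorProduct.map LinearMap.id Coalgebra.counit R.elt) =
      TensorProduct.rid k H (TensorProduct.map LinearMap.id Coalgebra.counit R.elt) := by
    have := congrArg ((TensorProduct.rid k H).toLinearMap ∘ₗ TensorProduct.map LinearMap.id
      (LinearMap.mul' k k ∘ₗ TensorProduct.map Coalgebra.counit Coalgebra.counit))
      R.sum_comul_snd
    rw [R.elt_eq_sum]
    simp only [map_sum, LinearMap.comp_apply, TensorProduct.map_tmul, LinearMap.mul'_apply,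
      LinearEquiv.coe_coe, TensorProduct.rid_tmul, LinearMap.id_apply, Finset.sum_mul_sum,
      smul_mul_smul_comm] at this ⊢
    refine Eq.trans (Finset.sum_congr rfl fun i _ => Finset.sum_congr rfl fun j _ => ?_)
      (this.symm.trans (Finset.sum_congr rfl fun i _ => ?_))
    · rw [mul_comm (Coalgebra.counit (R.snd i) : k)]
    · rw [mul'_map_counit_comul]
  have hu : IsUnit (TensorProduct.rid k H
      (TensorProduct.map LinearMap.id Coalgebra.counit R.elt)) :=
    R.isUnit_elt.map (((Algebra.TensorProduct.rid k k H).toAlgHom.comp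
      (Algebra.TensorProduct.map (AlgHom.id k H) (Bialgebra.counitAlgHom k H))) :
        H ⊗[k] H →ₐ[k] H)
  have := hu.mul_eq_left.mp h
  rw [R.elt_eq_sum] at this
  simpa using this

theorem el_convUnit_left (f : H →ₗ[k] E) [IsHom f] : R.el convUnit f = 1 := by
  simp only [el, convUnit, LinearMap.comp_apply, Algebra.linearMap_apply, ← Algebra.smul_def,
    ← map_smul, ← map_sum, sum_counit_smul_snd, IsHom.map_one]

theorem el_convUnit_right (f : H →ₗ[k] E) [IsHom f] : R.el f convUnit = 1 := by
  simp only [el, convUnit, LinearMap.comp_apply, Algebra.linearMap_apply, ← Algebra.commutes,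
    ← Algebra.smul_def, ← map_smul, ← map_sum, sum_counit_smul_fst, IsHom.map_one]

/-- This is (S ⊗ id)(R) = R⁻¹: the product collapses by the hexagon axiom to the image of R under (f
∘ S) ⊛ f, which is the convolution unit. -/
theorem inv_mul_el (f g : H →ₗ[k] E) [IsHom f] [IsHom g] [Commuting f g] :
    R.inv f g * R.el f g = 1 := by
  rw [inv_eq, ← el_conv_left, anti_conv, el_convUnit_left]

theorem el_mul_inv (f g : H →ₗ[k] E) [IsHom f] [IsHom g] [Commuting f g] :
    R.el f g * R.inv f g = 1 := by
  rw [inv_eq, ← el_conv_left, conv_anti, el_convUnit_left]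

/-- `∑ f(R₁R'₁) g(R'₂ S(R₂)) = 1`. -/
theorem sum_mul_el_mul (f g : H →ₗ[k] E) [IsHom f] [IsHom g] [Commuting f g] :
    ∑ i, f (R.fst i) * R.el f g * g (HopfAlgebra.antipode k (R.snd i)) = 1 := by
  have := congrArg (LinearMap.mul' k E ∘ₗ TensorProduct.map f (LinearMap.mul' k E ∘ₗ
    TensorProduct.map g (anti g))) R.sum_comul_snd
  simp only [map_sum, LinearMap.comp_apply, TensorProduct.map_tmul, LinearMap.mul'_apply,
    IsHom.map_mul] at this
  have h2 := R.el_convUnit_right f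
  rw [← conv_anti g] at h2
  simp only [el, conv, LinearMap.comp_apply] at h2
  rw [← h2, this]
  simp only [el, Finset.mul_sum, Finset.sum_mul]
  simp only [mul_assoc, anti_apply]

/-- `(S ⊗ S)(R) = R`. -/
theorem el_anti_anti (f g : H →ₗ[k] E) [IsHom f] [IsHom g] [hfg : Commuting f g] :
    R.el (anti f) (anti g) = R.el f g := by
  -- Since `R.inv f g` is inverse to `R.el f g`, it is enough that it has the left-hand side as a
  -- right inverse too. This comes from applying f ∘ S and g ⊛ (g ∘ S) to the two sides of (id ⊗
  -- Δ)(R) = R₁₃R₁₂.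
  have h1 : R.inv f g * R.el (anti f) (anti g) = 1 := by
    have := congrArg (LinearMap.mul' k E ∘ₗ TensorProduct.map (anti f) (LinearMap.mul' k E ∘ₗ
      TensorProduct.map g (anti g))) R.sum_comul_snd
    simp only [map_sum, LinearMap.comp_apply, TensorProduct.map_tmul, LinearMap.mul'_apply,
      anti_apply, HopfAlgebra.antipode_mul_antidistrib, IsHom.map_mul] at this
    have h2 : R.el (anti f) convUnit = 1 := by
      simp only [el, convUnit, LinearMap.comp_apply, Algebra.linearMap_apply, ← Algebra.commutes,
        ← Algebra.smul_def, ← map_smul, ← map_sum, sum_counit_smul_fst]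
      rw [anti_apply, HopfAlgebra.antipode_one, IsHom.map_one]
    rw [← conv_anti g] at h2
    simp only [el, conv, LinearMap.comp_apply] at h2
    simp only [anti_apply] at h2
    rw [← h2, this, Finset.sum_comm]
    simp only [el, inv, Finset.sum_mul_sum, anti_apply]
    refine Finset.sum_congr rfl fun i _ => Finset.sum_congr rfl fun j _ => ?_
    rw [mul_assoc, mul_assoc, ← mul_assoc (g _), ← hfg.comm, mul_assoc]
  rw [← one_mul (R.el (anti f) (anti g)), ← R.el_mul_inv f g, mul_assoc, h1, mul_one]

section Natural

variable {R}

/-- Naturality of the images of R. Taking for u another image of R, which swaps two actions by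
`el_mul_conv`, produces every Yang–Baxter type relation needed below. -/
theorem mul_el_of_intertwines {u : E} {f g f' g' : H →ₗ[k] E} (hf : ∀ h, u * f h = f' h * u)
    (hg : ∀ h, u * g h = g' h * u) : u * R.el f g = R.el f' g' * u := by
  simp only [el, Finset.mul_sum, Finset.sum_mul]
  refine Finset.sum_congr rfl fun i _ => ?_
  rw [← mul_assoc, hf, mul_assoc, hg, mul_assoc]

theorem mul_inv_of_intertwines {u : E} {f g f' g' : H →ₗ[k] E} (hf : ∀ h, u * f h = f' h * u)
    (hg : ∀ h, u * g h = g' h * u) : u * R.inv f g = R.inv f' g' * u :=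
  mul_el_of_intertwines (R := R) (f := anti f) (f' := anti f') (fun _ => hf _) hg

theorem mul_conv_of_intertwines {u : E} {f g f' g' : H →ₗ[k] E} (hf : ∀ h, u * f h = f' h * u)
    (hg : ∀ h, u * g h = g' h * u) (h : H) : u * (f ⊛ g) h = (f' ⊛ g') h * u := by
  rw [conv_apply _ _ (Coalgebra.Repr.arbitrary k h), conv_apply _ _ (Coalgebra.Repr.arbitrary k h),
    Finset.mul_sum, Finset.sum_mul]
  refine Finset.sum_congr rfl fun i _ => ?_
  rw [← mul_assoc, hf, mul_assoc, hg, mul_assoc]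

theorem inv_mul_conv (f g : H →ₗ[k] E) [IsHom f] [IsHom g] [Commuting f g] (h : H) :
    R.inv f g * (g ⊛ f) h = (f ⊛ g) h * R.inv f g := by
  rw [← mul_one ((g ⊛ f) h), ← R.el_mul_inv f g, ← mul_assoc ((g ⊛ f) h), ← el_mul_conv,
    ← mul_assoc, ← mul_assoc, R.inv_mul_el, one_mul]

/-- Inversion of `el_conv_left`, which reverses the order of the factors. -/
theorem inv_conv_left (f g p : H →ₗ[k] E) [IsHom f] [IsHom g] [IsHom p] [hfg : Commuting f g]
    [hf : Commuting f p] [hg : Commuting g p] :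
    R.inv (f ⊛ g) p = R.inv g p * R.inv f p := by
  have h := R.el_conv_left f g p
  rw [← one_mul (R.inv g p * R.inv f p), ← R.inv_mul_el (f ⊛ g) p, h]
  rw [mul_assoc, mul_assoc, ← mul_assoc (R.el g p), el_mul_inv, one_mul, el_mul_inv, mul_one]

theorem inv_conv_right (f g p : H →ₗ[k] E) [IsHom f] [IsHom g] [IsHom p] [hfg : Commuting f g]
    [hf : Commuting f p] [hg : Commuting g p] :
    R.inv f (g ⊛ p) = R.inv f g * R.inv f p := by
  have h := R.el_conv_right f g p
  rw [← one_mul (R.inv f g * R.inv f p), ← R.inv_mul_el f (g ⊛ p), h]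
  rw [mul_assoc, mul_assoc, ← mul_assoc (R.el f g), el_mul_inv, one_mul, el_mul_inv, mul_one]

end Natural

/-- A commutation of two elements, each an image of `R`. -/
theorem el_commute_of {u : E} {f g : H →ₗ[k] E} (hf : ∀ h, u * f h = f h * u)
    (hg : ∀ h, u * g h = g h * u) : u * R.el f g = R.el f g * u :=
  mul_el_of_intertwines hf hg

theorem mul_comm_of_commuting (f g : H →ₗ[k] E) (p : H →ₗ[k] E) [hf : Commuting f p]
    [hg : Commuting g p] (h : H) : R.el f g * p h = p h * R.el f g :=
  (el_commute_of R (fun x => (hf.comm x h).symm) (fun x => (hg.comm x h).symm)).symm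

theorem inv_mul_comm_of_commuting (f g : H →ₗ[k] E) (p : H →ₗ[k] E) [hf : Commuting f p]
    [hg : Commuting g p] (h : H) : R.inv f g * p h = p h * R.inv f g :=
  R.mul_comm_of_commuting (anti f) g p h

theorem el_comm_el (f g p q : H →ₗ[k] E) [Commuting f p] [Commuting g p] [Commuting f q]
    [Commuting g q] : R.el f g * R.el p q = R.el p q * R.el f g :=
  mul_el_of_intertwines (R.mul_comm_of_commuting f g p) (R.mul_comm_of_commuting f g q)

theorem inv_comm_el (f g p q : H →ₗ[k] E) [Commuting f p] [Commuting g p] [Commuting f q]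
    [Commuting g q] : R.inv f g * R.el p q = R.el p q * R.inv f g :=
  R.el_comm_el (anti f) g p q

end RMatrix

/-! ## Identities between images of the R-matrix -/

namespace RMatrix

variable {k : Type*} [Field k] {H : Type*} [Ring H] [HopfAlgebra k H] (R : RMatrix k H)
variable {E : Type*} [Ring E] [Algebra k E]

local infixr:75 " ⊛ " => conv

/-- `∑ f(R₁R'₂) g(R₂R'₁)`. -/
def monodromy (f g : H →ₗ[k] E) : E := R.el f g * R.el g f

theorem monodromy_mul_conv (f g : H →ₗ[k] E) [IsHom f] [IsHom g] [Commuting f g] (h : H) :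
    R.monodromy f g * (g ⊛ f) h = (g ⊛ f) h * R.monodromy f g := by
  rw [monodromy, mul_assoc, el_mul_conv, ← mul_assoc, el_mul_conv, mul_assoc]

/-- With M the monodromy, write f(h) = g(S(h₍₁₎)) g(h₍₂₎) f(h₍₃₎). The last two factors form g ⊛ f
and commute with M; then f cancels against f ∘ S. This turns the coadjoint action on the first leg
of RR' into the adjoint action on the second, so it gives the equivariance of Φ₀,₁. -/
theorem mul_monodromy_mul_anti (f g : H →ₗ[k] E) [IsHom f] [IsHom g] [Commuting f g] :
    (LinearMap.mulRight k (R.monodromy f g) ∘ₗ f) ⊛ anti f =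
      (LinearMap.mulRight k (R.monodromy f g) ∘ₗ anti g) ⊛ g := by
  have h1 : f = anti g ⊛ g ⊛ f := by rw [← conv_assoc, anti_conv, convUnit_conv]
  have h2 : LinearMap.mulRight k (R.monodromy f g) ∘ₗ (anti g ⊛ (g ⊛ f)) =
      (LinearMap.mulRight k (R.monodromy f g) ∘ₗ anti g) ⊛ (g ⊛ f) := by
    ext h
    rw [LinearMap.comp_apply, conv_apply _ _ (Coalgebra.Repr.arbitrary k h),
      conv_apply _ _ (Coalgebra.Repr.arbitrary k h)]
    simp only [LinearMap.mulRight_apply, Finset.sum_mul, LinearMap.comp_apply, mul_assoc,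
      monodromy_mul_conv]
  have h4 : LinearMap.mulRight k (R.monodromy f g) ∘ₗ f =
      LinearMap.mulRight k (R.monodromy f g) ∘ₗ (anti g ⊛ (g ⊛ f)) := by rw [← h1]
  rw [h4, h2, conv_assoc, conv_assoc, conv_anti, conv_convUnit]

/-- The identity behind the multiplicativity of Φ₀,₁: f and g are the slots paired with the two
forms, and p is the slot of the result. The sum and the factor `R.el g f` are the two copies of R in
the product of L₀,₁. -/
theorem sum_mul_monodromy (f g p : H →ₗ[k] E) [IsHom f] [IsHom g] [IsHom p] [Commuting f g]
    [Commuting f p] [Commuting g p] :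
    ∑ i, g (R.fst i) * R.monodromy (f ⊛ g) p * R.el g f *
        f (HopfAlgebra.antipode k (R.snd i)) = R.monodromy f p * R.monodromy g p := by
  have h1 : R.monodromy (f ⊛ g) p * R.el g f =
      R.el g f * R.el g p * R.monodromy f p * R.el p g := by
    have e1 : R.monodromy (f ⊛ g) p * R.el g f = R.el g f * R.monodromy (g ⊛ f) p := by
      rw [monodromy, monodromy, mul_assoc, ← mul_assoc (R.el g f)]
      rw [mul_el_of_intertwines (u := R.el g f) (f := g ⊛ f) (f' := f ⊛ g) (g := p) (g' := p)
        (R.el_mul_conv g f) (R.mul_comm_of_commuting g f p), mul_assoc,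
        mul_el_of_intertwines (u := R.el g f) (f := p) (f' := p) (g := g ⊛ f) (g' := f ⊛ g)
        (R.mul_comm_of_commuting g f p) (R.el_mul_conv g f)]
    rw [e1, monodromy, monodromy, el_conv_left, el_conv_right]
    simp only [mul_assoc]
  -- The left factors combine to the image of R on g and p ⊛ f, and the monodromy of f and p
  -- commutes with p ⊛ f. What remains around `R.el g f` is the sum in `sum_mul_el_mul`.
  have h2 : R.el g f * R.el g p * R.monodromy f p = R.monodromy f p * (R.el g f * R.el g p) := by
    rw [← el_conv_right]
    exact (mul_el_of_intertwines
      (fun x => by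
        rw [monodromy, mul_assoc, mul_comm_of_commuting, ← mul_assoc, mul_comm_of_commuting,
          mul_assoc])
      (R.monodromy_mul_conv f p)).symm
  have h3 : ∀ i, g (R.fst i) * R.monodromy (f ⊛ g) p * R.el g f *
        f (HopfAlgebra.antipode k (R.snd i)) = R.monodromy f p * (g (R.fst i) * R.el g f *
        f (HopfAlgebra.antipode k (R.snd i))) * R.monodromy g p := by
    intro i
    have e2 : ∀ x, R.monodromy f p * g x = g x * R.monodromy f p := fun x => by
      rw [monodromy, mul_assoc, mul_comm_of_commuting, ← mul_assoc, mul_comm_of_commuting,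
        mul_assoc]
    have e3 : ∀ x, R.monodromy g p * f x = f x * R.monodromy g p := fun x => by
      rw [monodromy, mul_assoc, mul_comm_of_commuting, ← mul_assoc, mul_comm_of_commuting,
        mul_assoc]
    rw [mul_assoc (g _), h1, h2]
    simp only [mul_assoc]
    rw [← mul_assoc (R.el g p) (R.el p g)]
    change g _ * (R.monodromy f p * (R.el g f * (R.monodromy g p * _))) = _
    rw [e3, ← mul_assoc, ← e2]
    simp only [mul_assoc]
  simp only [h3]
  rw [← Finset.sum_mul, ← Finset.mul_sum, sum_mul_el_mul, mul_one]

/-! ### Identities for the product of L₀,₁ -/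

section Product

variable (L₁ L₂ L₃ Y₁ Y₂ Y₃ : H →ₗ[k] E) [IsHom L₁] [IsHom L₂] [IsHom L₃] [IsHom Y₁] [IsHom Y₂]
  [IsHom Y₃] [Commuting L₁ L₂] [Commuting L₁ L₃] [Commuting L₂ L₃] [Commuting Y₁ Y₂]
  [Commuting Y₁ Y₃] [Commuting Y₂ Y₃] [Commuting L₁ Y₁] [Commuting L₁ Y₂] [Commuting L₁ Y₃]
  [Commuting L₂ Y₁] [Commuting L₂ Y₂] [Commuting L₂ Y₃] [Commuting L₃ Y₁] [Commuting L₃ Y₂]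
  [Commuting L₃ Y₃]

/-- Associativity of L₀,₁, where `Lᵢ`, `Yᵢ` are the translations of slot i. The left side is (xy)z:
the image of R on slots 3 and 2 is split off by the hexagon and moved to the right. On its way it
changes (L₃ ⊛ Y₃) ⊛ L₂ into L₂ ⊛ (L₃ ⊛ Y₃), which gives x(yz). -/
theorem product_assoc :
    R.el (L₃ ⊛ Y₃) (L₁ ⊛ L₂) * R.el (L₂ ⊛ Y₂) L₁ =
      R.el ((L₂ ⊛ L₃) ⊛ (Y₃ ⊛ Y₂)) L₁ * R.el (L₃ ⊛ Y₃) L₂ := by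
  have h : ∀ x, R.el (L₃ ⊛ Y₃) L₂ * ((L₃ ⊛ Y₃) ⊛ (L₂ ⊛ Y₂)) x =
      ((L₂ ⊛ L₃) ⊛ (Y₃ ⊛ Y₂)) x * R.el (L₃ ⊛ Y₃) L₂ := by
    rw [← conv_assoc _ L₂, conv_assoc L₂ L₃, ← conv_assoc L₃ Y₃, ← conv_assoc L₂]
    exact mul_conv_of_intertwines (R.el_mul_conv _ _) (R.mul_comm_of_commuting _ _ _)
  rw [← mul_el_of_intertwines h (R.mul_comm_of_commuting _ _ L₁),
    el_conv_left R (L₃ ⊛ Y₃) (L₂ ⊛ Y₂) L₁, el_conv_right R (L₃ ⊛ Y₃) L₁ L₂, mul_assoc]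

/-- Rebracketed, the left side acts through L₁ ⊛ (L₂ ⊛ Y₂) followed by Y₁, and the image of R in the
product swaps exactly the first two actions. Hence the action on a product becomes the diagonal
action on its factors. -/
theorem product_equivariant (x : H) :
    ((L₁ ⊛ L₂) ⊛ (Y₂ ⊛ Y₁)) x * R.el (L₂ ⊛ Y₂) L₁ =
      R.el (L₂ ⊛ Y₂) L₁ * ((L₂ ⊛ Y₂) ⊛ (L₁ ⊛ Y₁)) x := by
  rw [conv_assoc, ← conv_assoc L₂, ← conv_assoc, ← conv_assoc (L₂ ⊛ Y₂)]
  exact (mul_conv_of_intertwines (R.el_mul_conv _ _) (R.mul_comm_of_commuting _ _ _) x).symm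

end Product

/-! ### Hexagons and equivariance for the exchange operator of L₁,₀ -/

section Exchange

/-- The part of the exchange operator of `L₁,₀(H)` which does not involve the right
translations of the first factor. -/
def partialExchange (L L' Y' : H →ₗ[k] E) : E := R.inv Y' L * R.el L L'

/-- The exchange operator of `L₁,₀(H)`, in terms of the translations `L`, `Y` of the first factor
and `L'`, `Y'` of the second factor. -/
def exchange (L Y L' Y' : H →ₗ[k] E) : E := R.partialExchange L L' Y' * R.el Y (L' ⊛ Y')

theorem exchange_eq (L Y L' Y' : H →ₗ[k] E) [IsHom Y] [Commuting Y Y'] [Commuting L' Y'] :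
    R.exchange L Y L' Y' = R.inv Y' L * R.el L L' * R.el Y Y' * R.el Y L' := by
  rw [exchange, partialExchange, el_conv_right]
  simp only [mul_assoc]

section

variable (L Y L' Y' : H →ₗ[k] E) [IsHom L] [IsHom Y] [IsHom L'] [IsHom Y'] [Commuting L Y]
  [Commuting L L'] [Commuting L Y'] [Commuting Y L'] [Commuting Y Y'] [Commuting L' Y']

/-- The factor on L, L' moves L past L', and the inverse factor on Y', L moves L past Y'. The
partial exchange therefore carries L across the whole action of the second factor, although it is
not the image of R on L and L' ⊛ Y'. -/
theorem partialExchange_mul (x : H) :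
    R.partialExchange L L' Y' * (L ⊛ L' ⊛ Y') x =
      ((L' ⊛ Y') ⊛ L) x * R.partialExchange L L' Y' := by
  rw [partialExchange, mul_assoc, ← conv_assoc,
    mul_conv_of_intertwines (R.el_mul_conv _ _) (R.mul_comm_of_commuting _ _ _),
    ← mul_assoc, conv_assoc,
    mul_conv_of_intertwines (R.inv_mul_comm_of_commuting _ _ _) (R.inv_mul_conv _ _),
    ← conv_assoc, mul_assoc]

theorem partialExchange_comm (f : H →ₗ[k] E) [Commuting L f] [Commuting L' f] [Commuting Y' f]
    (x : H) : R.partialExchange L L' Y' * f x = f x * R.partialExchange L L' Y' := by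
  rw [partialExchange, mul_assoc, mul_comm_of_commuting, ← mul_assoc, inv_mul_comm_of_commuting,
    mul_assoc]

theorem exchange_mul (x : H) :
    R.exchange L Y L' Y' * ((L ⊛ Y) ⊛ (L' ⊛ Y')) x =
      ((L' ⊛ Y') ⊛ (L ⊛ Y)) x * R.exchange L Y L' Y' := by
  rw [exchange, mul_assoc, conv_assoc,
    mul_conv_of_intertwines (R.mul_comm_of_commuting _ _ _) (R.el_mul_conv _ _), ← mul_assoc,
    ← conv_assoc, mul_conv_of_intertwines (R.partialExchange_mul L L' Y')
      (R.partialExchange_comm L L' Y' Y), conv_assoc, mul_assoc]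

end

section

variable (L₁ Y₁ L₂ Y₂ L' Y' : H →ₗ[k] E) [IsHom L₁] [IsHom Y₁] [IsHom L₂] [IsHom Y₂] [IsHom L']
  [IsHom Y'] [Commuting L₁ Y₁] [Commuting L₂ Y₂] [Commuting L₁ L₂] [Commuting L₁ Y₂]
  [Commuting Y₁ L₂] [Commuting Y₁ Y₂] [Commuting L₁ L'] [Commuting L₁ Y'] [Commuting Y₁ L']
  [Commuting Y₁ Y'] [Commuting L₂ L'] [Commuting L₂ Y'] [Commuting Y₂ L'] [Commuting Y₂ Y']
  [Commuting L' Y']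

theorem partialExchange_conv :
    R.partialExchange (L₁ ⊛ L₂) L' Y' =
      R.partialExchange L₁ L' Y' * R.partialExchange L₂ L' Y' := by
  simp only [partialExchange, inv_conv_right, el_conv_left, mul_assoc]
  rw [← mul_assoc (R.inv Y' L₂), inv_comm_el, mul_assoc]

/-- Moving the second factor past a product in the first factor. -/
theorem exchange_product_left :
    R.exchange (L₁ ⊛ L₂) (Y₂ ⊛ Y₁) L' Y' * R.el (L₂ ⊛ Y₂) L₁ =
      R.el (L₂ ⊛ Y₂) L₁ * R.exchange L₂ Y₂ L' Y' * R.exchange L₁ Y₁ L' Y' := by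
  have e1 : R.partialExchange (L₁ ⊛ L₂) L' Y' * R.el L₂ L₁ =
      R.el L₂ L₁ * (R.partialExchange L₂ L' Y' * R.partialExchange L₁ L' Y') := by
    rw [← partialExchange_conv R L₂ L₁ L' Y', partialExchange, partialExchange, mul_assoc,
      ← mul_el_of_intertwines (R.el_mul_conv L₂ L₁) (R.mul_comm_of_commuting L₂ L₁ L'),
      ← mul_assoc, ← mul_inv_of_intertwines (R.mul_comm_of_commuting L₂ L₁ Y')
        (R.el_mul_conv L₂ L₁), mul_assoc]
  -- A Yang–Baxter relation: by the hexagon, the last two factors form the image of R on Y₂ and L₁ ⊛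
  -- (L' ⊛ Y'), whose second action is reordered by the partial exchange.
  have e2 : R.partialExchange L₁ L' Y' * (R.el Y₂ (L' ⊛ Y') * R.el Y₂ L₁) =
      R.el Y₂ L₁ * R.el Y₂ (L' ⊛ Y') * R.partialExchange L₁ L' Y' := by
    rw [← el_conv_right, ← el_conv_right]
    exact mul_el_of_intertwines (R.partialExchange_comm L₁ L' Y' Y₂)
      (R.partialExchange_mul L₁ L' Y')
  have e3 : R.partialExchange L₂ L' Y' * R.el Y₂ L₁ = R.el Y₂ L₁ * R.partialExchange L₂ L' Y' :=
    mul_el_of_intertwines (R.partialExchange_comm L₂ L' Y' Y₂)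
      (R.partialExchange_comm L₂ L' Y' L₁)
  calc R.exchange (L₁ ⊛ L₂) (Y₂ ⊛ Y₁) L' Y' * R.el (L₂ ⊛ Y₂) L₁
      = R.partialExchange (L₁ ⊛ L₂) L' Y' * R.el Y₂ (L' ⊛ Y') *
          (R.el Y₁ (L' ⊛ Y') * R.el (L₂ ⊛ Y₂) L₁) := by
        rw [exchange, el_conv_left R Y₂ Y₁]; simp only [mul_assoc]
    _ = R.partialExchange (L₁ ⊛ L₂) L' Y' * (R.el Y₂ (L' ⊛ Y') * R.el L₂ L₁) * R.el Y₂ L₁ *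
          R.el Y₁ (L' ⊛ Y') := by
        rw [el_comm_el, el_conv_left R L₂ Y₂]; simp only [mul_assoc]
    _ = R.el L₂ L₁ * R.partialExchange L₂ L' Y' * (R.partialExchange L₁ L' Y' *
          (R.el Y₂ (L' ⊛ Y') * R.el Y₂ L₁)) * R.el Y₁ (L' ⊛ Y') := by
        rw [R.el_comm_el Y₂ (L' ⊛ Y') L₂ L₁, ← mul_assoc, e1]; simp only [mul_assoc]
    _ = R.el L₂ L₁ * (R.partialExchange L₂ L' Y' * R.el Y₂ L₁) * R.el Y₂ (L' ⊛ Y') *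
          (R.partialExchange L₁ L' Y' * R.el Y₁ (L' ⊛ Y')) := by
        rw [e2]; simp only [mul_assoc]
    _ = _ := by
        rw [e3, el_conv_left R L₂ Y₂, exchange, exchange]; simp only [mul_assoc]

/-- Moving a product in the second factor past the first factor. -/
theorem exchange_product_right :
    R.exchange L' Y' (L₁ ⊛ L₂) (Y₂ ⊛ Y₁) * R.el (L₂ ⊛ Y₂) L₁ =
      R.el (L₂ ⊛ Y₂) L₁ * R.exchange L' Y' L₁ Y₁ * R.exchange L' Y' L₂ Y₂ := by
  have e1 : R.el Y' ((L₁ ⊛ L₂) ⊛ (Y₂ ⊛ Y₁)) * R.el (L₂ ⊛ Y₂) L₁ =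
      R.el (L₂ ⊛ Y₂) L₁ * (R.el Y' (L₁ ⊛ Y₁) * R.el Y' (L₂ ⊛ Y₂)) := by
    rw [← el_conv_right]
    exact (mul_el_of_intertwines (R.mul_comm_of_commuting _ _ Y')
      (fun x => (R.product_equivariant L₁ L₂ Y₁ Y₂ x).symm)).symm
  -- The last two factors form the image of R on L' ⊛ (L₂ ⊛ Y₂) and L₁, whose first action is
  -- reordered by the partial exchange.
  have e2 : R.partialExchange L' L₂ Y₂ * (R.el L' L₁ * R.el (L₂ ⊛ Y₂) L₁) =
      R.el (L₂ ⊛ Y₂) L₁ * R.el L' L₁ * R.partialExchange L' L₂ Y₂ := by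
    rw [← el_conv_left, ← el_conv_left]
    exact mul_el_of_intertwines (R.partialExchange_mul L' L₂ Y₂)
      (R.partialExchange_comm L' L₂ Y₂ L₁)
  have e3 : R.partialExchange L' L₂ Y₂ * R.el Y' (L₁ ⊛ Y₁) =
      R.el Y' (L₁ ⊛ Y₁) * R.partialExchange L' L₂ Y₂ :=
    mul_el_of_intertwines (R.partialExchange_comm L' L₂ Y₂ Y')
      (R.partialExchange_comm L' L₂ Y₂ (L₁ ⊛ Y₁))
  have e4 : R.partialExchange L' (L₁ ⊛ L₂) (Y₂ ⊛ Y₁) =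
      R.inv Y₁ L' * R.partialExchange L' L₂ Y₂ * R.el L' L₁ := by
    simp only [partialExchange, inv_conv_left, el_conv_right, mul_assoc]
  calc R.exchange L' Y' (L₁ ⊛ L₂) (Y₂ ⊛ Y₁) * R.el (L₂ ⊛ Y₂) L₁
      = R.inv Y₁ L' * (R.partialExchange L' L₂ Y₂ * (R.el L' L₁ * R.el (L₂ ⊛ Y₂) L₁)) *
          R.el Y' (L₁ ⊛ Y₁) * R.el Y' (L₂ ⊛ Y₂) := by
        rw [exchange, e4, mul_assoc, e1]; simp only [mul_assoc]
    _ = (R.inv Y₁ L' * R.el (L₂ ⊛ Y₂) L₁) * R.el L' L₁ *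
          (R.partialExchange L' L₂ Y₂ * R.el Y' (L₁ ⊛ Y₁)) * R.el Y' (L₂ ⊛ Y₂) := by
        rw [e2]; simp only [mul_assoc]
    _ = _ := by
        rw [e3, inv_comm_el, exchange, exchange, partialExchange, partialExchange]
        simp only [mul_assoc]

end

end Exchange

/-! ### Identities for the representation of L₁,₀ -/

section Representation

/-- The operator defining the action of `φ ⊗ ε ∈ L₁,₀(H)` on `H°`, in terms of the translations
`L`, `Y` of `φ` and the left translations `L'` of `ψ`. -/
def repOp (L Y L' : H →ₗ[k] E) : E := R.inv Y (L ⊛ L') * R.el L' L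

variable (L₁ L₂ L₃ Y₁ Y₂ : H →ₗ[k] E) [IsHom L₁] [IsHom L₂] [IsHom L₃] [IsHom Y₁] [IsHom Y₂]
  [Commuting L₁ L₂] [Commuting L₁ L₃] [Commuting L₂ L₃] [Commuting Y₁ Y₂]
  [Commuting L₁ Y₁] [Commuting L₁ Y₂] [Commuting L₂ Y₁] [Commuting L₂ Y₂] [Commuting L₃ Y₁]
  [Commuting L₃ Y₂]

/-- Representation property of ρ_b, with slots 1 and 2 for the two forms and slot 3 for the vector.
The factors involving left translations only are reordered by Yang–Baxter; then the factor on Y₂, L₁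
coming from the product of L₀,₁ cancels an inverse. -/
theorem repOp_product :
    R.repOp (L₁ ⊛ L₂) (Y₂ ⊛ Y₁) L₃ * R.el (L₂ ⊛ Y₂) L₁ =
      R.repOp L₁ Y₁ (L₂ ⊛ L₃) * R.repOp L₂ Y₂ L₃ := by
  have e1 : R.el L₃ L₂ * (R.el L₃ L₁ * R.el L₂ L₁) = R.el (L₂ ⊛ L₃) L₁ * R.el L₃ L₂ := by
    rw [← el_conv_left]
    exact mul_el_of_intertwines (R.el_mul_conv L₃ L₂) (R.mul_comm_of_commuting _ _ _)
  have e2 : R.inv Y₂ (L₁ ⊛ L₂ ⊛ L₃) * R.el (L₂ ⊛ L₃) L₁ =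
      R.el (L₂ ⊛ L₃) L₁ * (R.inv Y₂ (L₂ ⊛ L₃) * R.inv Y₂ L₁) := by
    rw [← inv_conv_right]
    exact (mul_inv_of_intertwines (R.mul_comm_of_commuting _ _ Y₂) (R.el_mul_conv _ _)).symm
  have e3 : R.inv Y₂ L₁ * (R.el L₃ L₂ * R.el Y₂ L₁) = R.el L₃ L₂ := by
    rw [el_comm_el, ← mul_assoc, inv_mul_el, one_mul]
  calc R.repOp (L₁ ⊛ L₂) (Y₂ ⊛ Y₁) L₃ * R.el (L₂ ⊛ Y₂) L₁
      = R.inv Y₁ (L₁ ⊛ L₂ ⊛ L₃) * R.inv Y₂ (L₁ ⊛ L₂ ⊛ L₃) *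
          (R.el L₃ L₂ * (R.el L₃ L₁ * R.el L₂ L₁)) * R.el Y₂ L₁ := by
        rw [repOp, conv_assoc, inv_conv_left, el_conv_right R L₃, el_conv_left R L₂]
        simp only [mul_assoc]
    _ = R.inv Y₁ (L₁ ⊛ L₂ ⊛ L₃) * R.el (L₂ ⊛ L₃) L₁ * R.inv Y₂ (L₂ ⊛ L₃) *
          (R.inv Y₂ L₁ * (R.el L₃ L₂ * R.el Y₂ L₁)) := by
        rw [e1, mul_assoc (R.inv Y₁ _), ← mul_assoc (R.inv Y₂ _), e2]
        simp only [mul_assoc]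
    _ = _ := by
        rw [e3, repOp, repOp]; simp only [mul_assoc]

/-- The two factors of the operator swap L₂ with L₁, and then L₁ ⊛ L₂ with Y₁, while Y₂ commutes
with both. This gives the equivariance of ρ_b. -/
theorem conv_mul_repOp (x : H) :
    ((Y₂ ⊛ Y₁) ⊛ (L₁ ⊛ L₂)) x * R.repOp L₁ Y₁ L₂ =
      R.repOp L₁ Y₁ L₂ * ((Y₂ ⊛ L₂) ⊛ (L₁ ⊛ Y₁)) x := by
  rw [conv_assoc, conv_assoc, ← conv_assoc L₂]
  refine (mul_conv_of_intertwines (u := R.repOp L₁ Y₁ L₂) (fun y => ?_) (fun y => ?_) x).symm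
  · rw [repOp, mul_assoc, mul_comm_of_commuting, ← mul_assoc, inv_mul_comm_of_commuting, mul_assoc]
  · rw [repOp, mul_assoc,
      mul_conv_of_intertwines (R.el_mul_conv _ _) (R.mul_comm_of_commuting _ _ _), ← mul_assoc,
      inv_mul_conv, mul_assoc]

/-- Here `A` acts on the copy of H paired with α, so the identity moves ρ_a(α) past ρ_b(β). The
monodromy commutes with (L₁ ⊛ L₂) ⊛ A; passing it through the inverse factor creates the two factors
in Y₁ and A (`e3`). It then passes `R.el L₂ L₁` (`e2`) and is expanded by the hexagons (`e1`). -/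
theorem monodromy_mul_repOp (A : H →ₗ[k] E) [IsHom A] [Commuting A L₁] [Commuting A L₂]
    [Commuting A Y₁] :
    R.monodromy A (L₁ ⊛ L₂) * R.repOp L₁ Y₁ L₂ =
      R.repOp L₁ Y₁ L₂ * R.inv Y₁ A * R.el A L₁ * R.monodromy A L₂ * R.el L₁ A * R.el Y₁ A := by
  have e1 : R.el A L₁ * R.monodromy A L₂ * R.el L₁ A = R.monodromy A (L₂ ⊛ L₁) := by
    rw [monodromy, monodromy, el_conv_right, el_conv_left]; simp only [mul_assoc]
  have e2 : R.el L₂ L₁ * R.monodromy A (L₂ ⊛ L₁) = R.monodromy A (L₁ ⊛ L₂) * R.el L₂ L₁ := by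
    rw [monodromy, ← mul_assoc,
      mul_el_of_intertwines (R.mul_comm_of_commuting _ _ A) (R.el_mul_conv L₂ L₁), mul_assoc,
      mul_el_of_intertwines (R.el_mul_conv L₂ L₁) (R.mul_comm_of_commuting _ _ A), monodromy,
      mul_assoc]
  have e3 : R.monodromy A (L₁ ⊛ L₂) * R.inv Y₁ (L₁ ⊛ L₂) =
      R.inv Y₁ (L₁ ⊛ L₂) * R.inv Y₁ A * R.monodromy A (L₁ ⊛ L₂) * R.el Y₁ A := by
    have h1 : R.monodromy A (L₁ ⊛ L₂) * R.inv Y₁ ((L₁ ⊛ L₂) ⊛ A) =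
        R.inv Y₁ ((L₁ ⊛ L₂) ⊛ A) * R.monodromy A (L₁ ⊛ L₂) :=
      mul_inv_of_intertwines (fun y => by
        rw [monodromy, mul_assoc, mul_comm_of_commuting, ← mul_assoc, mul_comm_of_commuting,
          mul_assoc]) (R.monodromy_mul_conv A (L₁ ⊛ L₂))
    rw [inv_conv_right Y₁ (L₁ ⊛ L₂) A] at h1
    rw [← h1, mul_assoc, mul_assoc, inv_mul_el, mul_one]
  calc R.monodromy A (L₁ ⊛ L₂) * R.repOp L₁ Y₁ L₂
      = R.inv Y₁ (L₁ ⊛ L₂) * R.inv Y₁ A * R.monodromy A (L₁ ⊛ L₂) *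
          (R.el Y₁ A * R.el L₂ L₁) := by
        rw [repOp, ← mul_assoc, e3]; simp only [mul_assoc]
    _ = R.inv Y₁ (L₁ ⊛ L₂) * R.inv Y₁ A * (R.el L₂ L₁ * R.monodromy A (L₂ ⊛ L₁)) *
          R.el Y₁ A := by
        rw [el_comm_el, e2]; simp only [mul_assoc]
    _ = R.inv Y₁ (L₁ ⊛ L₂) * (R.inv Y₁ A * R.el L₂ L₁) * (R.el A L₁ * R.monodromy A L₂ *
          R.el L₁ A) * R.el Y₁ A := by
        rw [e1]; simp only [mul_assoc]
    _ = _ := by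
        rw [inv_comm_el, repOp]; simp only [mul_assoc]

end Representation

end RMatrix

/-! ## Twisted products of module-algebras -/

section TwistedProduct

variable {k : Type*} [Field k] {H : Type*} [Ring H] [HopfAlgebra k H]

local infixr:75 " ⊛ " => conv

/-- The map `p ⊗ ((q ⊗ r) ⊗ s) ↦ (p ⊗ q) ⊗ (r ⊗ s)`. -/
def regroup : H ⊗[k] ((H ⊗[k] H) ⊗[k] H) →ₗ[k] (H ⊗[k] H) ⊗[k] (H ⊗[k] H) :=
  (TensorProduct.assoc k (H ⊗[k] H) H H).toLinearMap ∘ₗ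
    LinearMap.rTensor H (TensorProduct.assoc k H H H).symm.toLinearMap ∘ₗ
      (TensorProduct.assoc k H (H ⊗[k] H) H).symm.toLinearMap

@[simp]
theorem regroup_tmul (p q r s : H) :
    regroup (k := k) (p ⊗ₜ ((q ⊗ₜ r) ⊗ₜ s)) = (p ⊗ₜ q) ⊗ₜ (r ⊗ₜ s) := rfl

/-- Both sides are convolution products of the four inclusions of H in its fourth tensor power,
bracketed differently. Coassociativity thus reduces to `conv_assoc`. -/
theorem map_comul_comul (h : H) :
    TensorProduct.map Coalgebra.comul Coalgebra.comul (Coalgebra.comul h : H ⊗[k] H) =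
      regroup (TensorProduct.map LinearMap.id (TensorProduct.map Coalgebra.comul LinearMap.id)
        (TensorProduct.map LinearMap.id Coalgebra.comul (Coalgebra.comul h : H ⊗[k] H))) := by
  let l : H ⊗[k] H →ₐ[k] (H ⊗[k] H) ⊗[k] (H ⊗[k] H) := Algebra.TensorProduct.includeLeft
  let r : H ⊗[k] H →ₐ[k] (H ⊗[k] H) ⊗[k] (H ⊗[k] H) := Algebra.TensorProduct.includeRight
  let i : H →ₐ[k] H ⊗[k] H := Algebra.TensorProduct.includeLeft
  let j : H →ₐ[k] H ⊗[k] H := Algebra.TensorProduct.includeRight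
  have key := LinearMap.congr_fun (show
    ((l.comp i).toLinearMap ⊛ (l.comp j).toLinearMap) ⊛ (r.comp i).toLinearMap ⊛
      (r.comp j).toLinearMap = (l.comp i).toLinearMap ⊛ ((l.comp j).toLinearMap ⊛
      (r.comp i).toLinearMap) ⊛ (r.comp j).toLinearMap by simp only [conv_assoc]) h
  have h1 : (LinearMap.mul' k _ ∘ₗ TensorProduct.map
      ((l.comp i).toLinearMap ⊛ (l.comp j).toLinearMap)
      ((r.comp i).toLinearMap ⊛ (r.comp j).toLinearMap)) =
      TensorProduct.map Coalgebra.comul Coalgebra.comul := by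
    ext x y
    simp only [TensorProduct.AlgebraTensorModule.curry_apply, TensorProduct.curry_apply,
      LinearMap.coe_restrictScalars, LinearMap.comp_apply, TensorProduct.map_tmul,
      conv_apply _ _ (Coalgebra.Repr.arbitrary k x), conv_apply _ _ (Coalgebra.Repr.arbitrary k y)]
    conv_rhs => rw [← (Coalgebra.Repr.arbitrary k x).eq, ← (Coalgebra.Repr.arbitrary k y).eq]
    simp [l, r, i, j, TensorProduct.sum_tmul, TensorProduct.tmul_sum]
  have h2 : (LinearMap.mul' k _ ∘ₗ TensorProduct.map (l.comp i).toLinearMap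
      (((l.comp j).toLinearMap ⊛ (r.comp i).toLinearMap) ⊛ (r.comp j).toLinearMap)) =
      regroup ∘ₗ TensorProduct.map LinearMap.id
        (TensorProduct.map Coalgebra.comul LinearMap.id) ∘ₗ
          TensorProduct.map LinearMap.id Coalgebra.comul := by
    ext x y
    simp only [TensorProduct.AlgebraTensorModule.curry_apply, TensorProduct.curry_apply,
      LinearMap.coe_restrictScalars, LinearMap.comp_apply, TensorProduct.map_tmul,
      conv_apply _ _ (Coalgebra.Repr.arbitrary k y)]
    conv_rhs => rw [← (Coalgebra.Repr.arbitrary k y).eq]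
    simp only [map_sum, TensorProduct.map_tmul, LinearMap.mul'_apply,
      TensorProduct.tmul_sum]
    refine Finset.sum_congr rfl fun a _ => ?_
    rw [conv_apply _ _ (Coalgebra.Repr.arbitrary k _),
      ← (Coalgebra.Repr.arbitrary k ((Coalgebra.Repr.arbitrary k y).left a)).eq]
    simp [l, r, i, j, TensorProduct.sum_tmul, TensorProduct.tmul_sum, Finset.sum_mul,
      Finset.mul_sum]
  rw [← h1]
  exact key.trans (LinearMap.congr_fun h2 _)

variable {A : Type*} [AddCommMonoid A] [Module k A] {B : Type*} [AddCommMonoid B] [Module k B]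

theorem tensorAct_tmul (p : H →ₗ[k] A →ₗ[k] A) (q : H →ₗ[k] B →ₗ[k] B) (h : H) (a : A) (b : B) :
    tensorAct p q h (a ⊗ₜ b) = TensorProduct.map (p.flip a) (q.flip b) (Coalgebra.comul h) := by
  simp only [tensorAct, LinearMap.comp_apply]
  generalize (Coalgebra.comul h : H ⊗[k] H) = t
  induction t with
  | zero => simp
  | add x y hx hy => simp only [map_add, LinearMap.add_apply, hx, hy]
  | tmul x y => simp

theorem tensorAct_one {p : H →ₗ[k] A →ₗ[k] A} {q : H →ₗ[k] B →ₗ[k] B} (hp : ∀ a, p 1 a = a)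
    (hq : ∀ b, q 1 b = b) (x : A ⊗[k] B) : tensorAct p q 1 x = x := by
  induction x with
  | zero => simp
  | add x y hx hy => rw [map_add, hx, hy]
  | tmul a b => simp [tensorAct_tmul, Bialgebra.comul_one, Algebra.TensorProduct.one_def, hp, hq]

theorem tensorAct_mul {p : H →ₗ[k] A →ₗ[k] A} {q : H →ₗ[k] B →ₗ[k] B}
    (hp : ∀ h h' a, p (h * h') a = p h' (p h a)) (hq : ∀ h h' b, q (h * h') b = q h' (q h b))
    (h h' : H) (x : A ⊗[k] B) :
    tensorAct p q (h * h') x = tensorAct p q h' (tensorAct p q h x) := by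
  simp only [tensorAct, LinearMap.comp_apply, Bialgebra.comul_mul]
  generalize (Coalgebra.comul h : H ⊗[k] H) = s
  generalize (Coalgebra.comul h' : H ⊗[k] H) = t
  induction s with
  | zero => simp
  | add x y hx hy => simp only [add_mul, map_add, LinearMap.add_apply, hx, hy]
  | tmul c d =>
    induction t with
    | zero => simp
    | add x y hx hy => simp only [mul_add, map_add, LinearMap.add_apply, hx, hy]
    | tmul e f =>
      induction x with
      | zero => simp
      | add x y hx hy => simp only [map_add, hx, hy]
      | tmul a b => simp [hp, hq]

theorem tensorAct_counit_smul {p : H →ₗ[k] A →ₗ[k] A} {q : H →ₗ[k] B →ₗ[k] B} {a : A} {b : B}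
    (hp : ∀ h, p h a = (Coalgebra.counit h : k) • a)
    (hq : ∀ h, q h b = (Coalgebra.counit h : k) • b) (h : H) :
    tensorAct p q h (a ⊗ₜ b) = (Coalgebra.counit h : k) • (a ⊗ₜ[k] b) := by
  rw [tensorAct_tmul]
  conv_rhs => rw [← RMatrix.mul'_map_counit_comul]
  generalize (Coalgebra.comul h : H ⊗[k] H) = t
  induction t with
  | zero => simp
  | add x y hx hy => simp only [map_add, add_smul, hx, hy]
  | tmul x y => simp [hp, hq, ← TensorProduct.smul_tmul', smul_smul, mul_comm]

/-- The structure maps of a product with exchange map `τ`. -/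
def twisted (X : HModAlg k H A) (Y : HModAlg k H B) (τ : B ⊗[k] A →ₗ[k] A ⊗[k] B) :
    HModAlg k H (A ⊗[k] B) where
  mul := twistedMul X.mul Y.mul τ
  one := X.one ⊗ₜ Y.one
  act := tensorAct X.act Y.act

variable {ι : Type*} [Fintype ι]

/-- `h_left` and `h_right` are the hexagon relations of τ with the two products. The finite family
presenting τ makes it possible to state them on elements. The criterion covers both the braided
tensor products and L₁,₀, whose exchange map is not the braiding. -/
theorem twisted_isModuleAlgebra {X : HModAlg k H A} {Y : HModAlg k H B}
    (hX : X.IsModuleAlgebra) (hY : Y.IsModuleAlgebra) {τ : B ⊗[k] A →ₗ[k] A ⊗[k] B}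
    (f : ι → A →ₗ[k] A) (g : ι → B →ₗ[k] B) (hτ : ∀ a b, τ (b ⊗ₜ a) = ∑ i, f i a ⊗ₜ g i b)
    (h_left : ∀ a a' b, ∑ i, f i (X.mul a a') ⊗ₜ[k] g i b =
      ∑ i, ∑ j, X.mul (f i a) (f j a') ⊗ₜ[k] g j (g i b))
    (h_right : ∀ a b b', ∑ i, f i a ⊗ₜ[k] g i (Y.mul b b') =
      ∑ i, ∑ j, f j (f i a) ⊗ₜ[k] Y.mul (g j b) (g i b'))
    (h_one_left : ∀ b, ∑ i, f i X.one ⊗ₜ[k] g i b = X.one ⊗ₜ b)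
    (h_one_right : ∀ a, ∑ i, f i a ⊗ₜ[k] g i Y.one = a ⊗ₜ Y.one)
    (h_act : ∀ h a b, tensorAct X.act Y.act h (τ (b ⊗ₜ a)) =
      τ (tensorAct Y.act X.act h (b ⊗ₜ a))) :
    (twisted X Y τ).IsModuleAlgebra := by
  have hmul : ∀ a b a' b', twistedMul X.mul Y.mul τ (a ⊗ₜ b) (a' ⊗ₜ b') =
      ∑ i, X.mul a (f i a') ⊗ₜ[k] Y.mul (g i b) b' := by
    intro a b a' b'
    simp [twistedMul_tmul, hτ]
  refine ⟨?_, ?_, ?_, tensorAct_one hX.act_one hY.act_one, tensorAct_mul hX.act_mul hY.act_mul,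
    ?_, tensorAct_counit_smul hX.one_act hY.one_act⟩
  · intro x y z
    simp only [twisted]
    induction x with
    | zero => simp
    | add x x' hx hx' => simp only [map_add, LinearMap.add_apply, hx, hx']
    | tmul a b =>
    induction y with
    | zero => simp
    | add x x' hx hx' => simp only [map_add, LinearMap.add_apply, hx, hx']
    | tmul a' b' =>
    induction z with
    | zero => simp
    | add x x' hx hx' => simp only [map_add, hx, hx']
    | tmul a'' b'' =>
    simp only [hmul, map_sum, LinearMap.sum_apply]
    have e1 : ∀ i, ∑ j, X.mul (X.mul a (f i a')) (f j a'') ⊗ₜ[k]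
        Y.mul (g j (Y.mul (g i b) b')) b'' =
        ∑ j, ∑ l, X.mul a (X.mul (f i a') (f l (f j a''))) ⊗ₜ[k]
          Y.mul (Y.mul (g l (g i b)) (g j b')) b'' := by
      intro i
      have := congrArg (TensorProduct.map (X.mul a ∘ₗ X.mul (f i a')) (Y.mul.flip b''))
        (h_right a'' (g i b) b')
      simpa only [map_sum, TensorProduct.map_tmul, LinearMap.comp_apply, LinearMap.flip_apply,
        hX.mul_assoc] using this
    have e2 : ∀ j, ∑ i, X.mul a (f i (X.mul a' (f j a''))) ⊗ₜ[k]
        Y.mul (g i b) (Y.mul (g j b') b'') =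
        ∑ i, ∑ l, X.mul a (X.mul (f i a') (f l (f j a''))) ⊗ₜ[k]
          Y.mul (g l (g i b)) (Y.mul (g j b') b'') := by
      intro j
      have := congrArg (TensorProduct.map (X.mul a) (Y.mul.flip (Y.mul (g j b') b'')))
        (h_left a' (f j a'') b)
      simpa only [map_sum, TensorProduct.map_tmul, LinearMap.comp_apply, LinearMap.flip_apply]
        using this
    simp only [e1, e2, hY.mul_assoc]
    rw [Finset.sum_comm]
  · intro x
    simp only [twisted]
    induction x with
    | zero => simp
    | add x x' hx hx' => simp only [map_add, hx, hx']
    | tmul a b =>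
      rw [twistedMul_tmul, hτ, h_one_right, TensorProduct.map_tmul, hX.one_mul,
        LinearMap.flip_apply, hY.one_mul]
  · intro x
    simp only [twisted]
    induction x with
    | zero => simp
    | add x x' hx hx' => simp only [map_add, LinearMap.add_apply, hx, hx']
    | tmul a b =>
      rw [twistedMul_tmul, hτ, h_one_left, TensorProduct.map_tmul, hX.mul_one,
        LinearMap.flip_apply, hY.mul_one]
  · intro h x y
    simp only [twisted]
    induction x with
    | zero => simp
    | add x x' hx hx' =>
      simp only [map_add, LinearMap.add_apply, hx, hx', TensorProduct.add_tmul]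
    | tmul a b =>
    induction y with
    | zero => simp
    | add x x' hx hx' =>
      simp only [map_add, hx, hx', TensorProduct.tmul_add]
    | tmul a' b' =>
    have hL : ∀ x y z w, tensorAct X.act Y.act h (X.mul x y ⊗ₜ Y.mul z w) =
        TensorProduct.map (TensorProduct.lift X.mul ∘ₗ TensorProduct.map (X.act.flip x)
          (X.act.flip y)) (TensorProduct.lift Y.mul ∘ₗ TensorProduct.map (Y.act.flip z)
          (Y.act.flip w)) (TensorProduct.map Coalgebra.comul Coalgebra.comul
            (Coalgebra.comul h : H ⊗[k] H)) := by
      intro x y z w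
      rw [tensorAct_tmul, TensorProduct.map_map]
      congr 2
      · ext h; simp [hX.mul_act, tensorAct_tmul]
      · ext h; simp [hY.mul_act, tensorAct_tmul]
    have hR : TensorProduct.lift (twistedMul X.mul Y.mul τ)
        (tensorAct (tensorAct X.act Y.act) (tensorAct X.act Y.act) h
          ((a ⊗ₜ b) ⊗ₜ[k] (a' ⊗ₜ b'))) =
        TensorProduct.lift (twistedMul X.mul Y.mul τ) (TensorProduct.map
          (TensorProduct.map (X.act.flip a) (Y.act.flip b))
          (TensorProduct.map (X.act.flip a') (Y.act.flip b'))
          (TensorProduct.map Coalgebra.comul Coalgebra.comul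
            (Coalgebra.comul h : H ⊗[k] H))) := by
      rw [tensorAct_tmul, TensorProduct.map_map]
      congr 3
      · ext h; simp [tensorAct_tmul]
      · ext h; simp [tensorAct_tmul]
    rw [hR, hmul, map_sum]
    simp only [hL, map_comul_comul]
    generalize TensorProduct.map LinearMap.id Coalgebra.comul (Coalgebra.comul h : H ⊗[k] H) = t
    induction t with
    | zero => simp
    | add x y hx hy => simp only [map_add, Finset.sum_add_distrib, hx, hy]
    | tmul p u =>
    induction u with
    | zero => simp
    | add x y hx hy =>
      simp only [map_add, TensorProduct.tmul_add, Finset.sum_add_distrib, hx, hy]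
    | tmul c s =>
    simp only [TensorProduct.map_tmul, LinearMap.id_apply]
    -- Of the four legs of h, the outer ones p and s only meet a and b'. The two middle ones are the
    -- coproduct of c and act on the arguments of τ, where `h_act` applies.
    have key := congrArg (TensorProduct.map (X.mul (X.act p a))
      (Y.mul.flip (Y.act s b'))) (h_act c a' b)
    rw [hτ, map_sum] at key
    simp only [tensorAct_tmul] at key
    rw [map_sum] at key
    convert key using 1
    · refine Finset.sum_congr rfl fun i _ => ?_
      generalize (Coalgebra.comul c : H ⊗[k] H) = t
      induction t with
      | zero => simp
      | add x y hx hy => simp only [map_add, TensorProduct.tmul_add, TensorProduct.add_tmul, hx, hy]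
      | tmul x y => simp
    · generalize (Coalgebra.comul c : H ⊗[k] H) = t
      induction t with
      | zero => simp
      | add x y hx hy => simp only [map_add, TensorProduct.tmul_add, TensorProduct.add_tmul, hx, hy]
      | tmul x y => simp [twistedMul_tmul]

end TwistedProduct

/-! ### Braided tensor products and powers are module-algebras -/

section BraidedTensor

variable {k : Type*} [Field k] {H : Type*} [Ring H] [HopfAlgebra k H]
variable {A : Type*} [AddCommMonoid A] [Module k A] {B : Type*} [AddCommMonoid B] [Module k B]

theorem braiding_tmul (R : RMatrix k H) (p : H →ₗ[k] A →ₗ[k] A) (q : H →ₗ[k] B →ₗ[k] B) (a : A)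
    (b : B) : braiding R p q (b ⊗ₜ a) = ∑ i, p (R.fst i) a ⊗ₜ[k] q (R.snd i) b := by
  simp [braiding]

theorem braiding_act (R : RMatrix k H) {p : H →ₗ[k] A →ₗ[k] A} {q : H →ₗ[k] B →ₗ[k] B}
    (hp : ∀ h h' a, p (h * h') a = p h' (p h a)) (hq : ∀ h h' b, q (h * h') b = q h' (q h b))
    (h : H) (a : A) (b : B) :
    tensorAct p q h (braiding R p q (b ⊗ₜ a)) = braiding R p q (tensorAct q p h (b ⊗ₜ a)) := by
  have key := congrArg (TensorProduct.map (p.flip a) (q.flip b)) (R.quasi_cocomm h)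
  rw [braiding_tmul, map_sum]
  simp only [tensorAct_tmul]
  rw [R.elt_eq_sum, Finset.sum_mul, Finset.mul_sum, map_sum, map_sum] at key
  convert key using 1
  · refine Finset.sum_congr rfl fun i _ => ?_
    generalize (Coalgebra.comul h : H ⊗[k] H) = t
    induction t with
    | zero => simp
    | add x y hx hy => simp only [map_add, mul_add, hx, hy]
    | tmul x y => simp [hp, hq]
  · generalize (Coalgebra.comul h : H ⊗[k] H) = t
    induction t with
    | zero => simp
    | add x y hx hy => simp only [map_add, add_mul, Finset.sum_add_distrib, hx, hy]
    | tmul x y => simp [hp, hq, braiding_tmul]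

/-- The R-matrix axioms match the criterion one by one: (Δ ⊗ id)(R) and (id ⊗ Δ)(R) give the
hexagons, the counit identities give the units, and R Δ = Δᵒᵖ R gives equivariance of the braiding.
-/
theorem braidedTensor_isModuleAlgebra (R : RMatrix k H) {X : HModAlg k H A} {Y : HModAlg k H B}
    (hX : X.IsModuleAlgebra) (hY : Y.IsModuleAlgebra) :
    (braidedTensor R X Y).IsModuleAlgebra := by
  refine twisted_isModuleAlgebra hX hY (fun i => X.act (R.fst i)) (fun i => Y.act (R.snd i))
    (braiding_tmul R X.act Y.act) ?_ ?_ ?_ ?_ (braiding_act R hX.act_mul hY.act_mul)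
  · intro a a' b
    have := congrArg (TensorProduct.map (TensorProduct.lift X.mul ∘ₗ TensorProduct.map
      (X.act.flip a) (X.act.flip a')) (Y.act.flip b)) R.sum_comul_fst
    simp only [map_sum, TensorProduct.map_tmul, LinearMap.comp_apply, LinearMap.flip_apply,
      TensorProduct.lift.tmul, hY.act_mul] at this
    simpa only [hX.mul_act, tensorAct_tmul] using this
  · intro a b b'
    have := congrArg (TensorProduct.map (X.act.flip a) (TensorProduct.lift Y.mul ∘ₗ
      TensorProduct.map (Y.act.flip b) (Y.act.flip b'))) R.sum_comul_snd
    simp only [map_sum, TensorProduct.map_tmul, LinearMap.comp_apply, LinearMap.flip_apply,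
      TensorProduct.lift.tmul, hX.act_mul] at this
    simpa only [hY.mul_act, tensorAct_tmul] using this
  · intro b
    simp only [hX.one_act, TensorProduct.smul_tmul]
    rw [← TensorProduct.tmul_sum]
    simp only [← LinearMap.map_smul₂]
    rw [← LinearMap.sum_apply, ← map_sum, R.sum_counit_smul_snd, hY.act_one]
  · intro a
    simp only [hY.one_act, ← TensorProduct.smul_tmul]
    rw [← TensorProduct.sum_tmul]
    simp only [← LinearMap.map_smul₂]
    rw [← LinearMap.sum_apply, ← map_sum, R.sum_counit_smul_fst, hX.act_one]

/-- Transport of structure along a linear equivalence. -/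
def HModAlg.transport (X : HModAlg k H A) (e : A ≃ₗ[k] B) : HModAlg k H B where
  mul := (X.mul.compl₁₂ e.symm.toLinearMap e.symm.toLinearMap).compr₂ e.toLinearMap
  one := e X.one
  act := e.conj.toLinearMap ∘ₗ X.act

theorem HModAlg.IsModuleAlgebra.transport {X : HModAlg k H A} (hX : X.IsModuleAlgebra)
    (e : A ≃ₗ[k] B) : (X.transport e).IsModuleAlgebra where
  mul_assoc x y z := by simp [HModAlg.transport, hX.mul_assoc]
  one_mul x := by simp [HModAlg.transport, hX.one_mul]
  mul_one x := by simp [HModAlg.transport, hX.mul_one]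
  act_one x := by simp [HModAlg.transport, hX.act_one, LinearEquiv.conj_apply]
  act_mul h h' x := by simp [HModAlg.transport, hX.act_mul, LinearEquiv.conj_apply]
  mul_act h x y := by
    simp only [HModAlg.transport, LinearMap.compr₂_apply, LinearMap.compl₁₂_apply,
      LinearEquiv.coe_coe, LinearMap.comp_apply, LinearEquiv.conj_apply, tensorAct_tmul,
      LinearEquiv.symm_apply_apply, hX.mul_act]
    generalize (Coalgebra.comul h : H ⊗[k] H) = t
    induction t with
    | zero => simp
    | add x y hx hy => simp only [map_add, hx, hy]
    | tmul x y => simp [LinearEquiv.conj_apply]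
  one_act h := by simp [HModAlg.transport, hX.one_act, LinearEquiv.conj_apply]

theorem braidedPow_succ (R : RMatrix k H) (X : HModAlg k H A) (m : ℕ) :
    braidedPow R X (m + 1) =
      (braidedTensor R (braidedPow R X m) X).transport (snocEquiv k A m) := by
  simp only [braidedPow, HModAlg.transport, braidedTensor, snocEquiv_tprod_tmul, HModAlg.mk.injEq]
  refine ⟨rfl, ?_, rfl⟩
  congr 1
  funext i
  refine Fin.lastCases ?_ (fun j => ?_) i <;> simp

theorem braidedPow_isModuleAlgebra (R : RMatrix k H) {X : HModAlg k H A}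
    (hX : X.IsModuleAlgebra) (m : ℕ) : (braidedPow R X m).IsModuleAlgebra := by
  induction m with
  | succ m ih =>
    rw [braidedPow_succ]
    exact (braidedTensor_isModuleAlgebra R ih hX).transport _
  | zero =>
    -- The empty power is k with the trivial action: every element is a scalar multiple of the unit.
    have hone : (braidedPow R X 0).one = PiTensorProduct.tprod k (fun i : Fin 0 => i.elim0) := by
      simp only [braidedPow]; congr 1; funext i; exact i.elim0
    have hx : ∀ x : ⨂[k] _ : Fin 0, A, PiTensorProduct.isEmptyEquiv (Fin 0) x •
        (braidedPow R X 0).one = x := by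
      intro x
      conv_rhs => rw [← (PiTensorProduct.isEmptyEquiv (Fin 0)).symm_apply_apply x]
      rw [PiTensorProduct.isEmptyEquiv_symm_apply, hone]
      congr 2
    have hone' : PiTensorProduct.isEmptyEquiv (Fin 0) (braidedPow R X 0).one = 1 := by
      rw [hone, PiTensorProduct.isEmptyEquiv_apply_tprod]
    refine ⟨fun x y z => ?_, fun x => ?_, fun x => ?_, fun x => ?_, fun h h' x => ?_,
      fun h x y => ?_, fun h => ?_⟩
    · simp [braidedPow, powMul, smul_smul, mul_comm]
    · change PiTensorProduct.isEmptyEquiv (Fin 0) (braidedPow R X 0).one • x = x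
      rw [hone', one_smul]
    · exact hx x
    · simp [braidedPow, powAct]
    · simp [braidedPow, powAct, smul_smul]
    · simp only [braidedPow, powAct, tensorAct_tmul]
      have := RMatrix.mul'_map_counit_comul (k := k) h
      rw [LinearMap.smulRight_apply, LinearMap.smul_apply, ← this]
      generalize (Coalgebra.comul h : H ⊗[k] H) = t
      induction t with
      | zero => simp
      | add x y hx hy => simp only [map_add, add_smul, hx, hy]
      | tmul x y => simp [powMul, smul_smul, mul_left_comm, mul_assoc]
    · simp [braidedPow, powAct]

end BraidedTensor

/-! ## Adjoint actions -/

section Adjoint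

variable {k : Type*} [Field k] {H : Type*} [Ring H] [HopfAlgebra k H]
variable {B : Type*} [Ring B] [Algebra k B]

local infixr:75 " ⊛ " => conv

/-- The adjoint action `b ◂ h = ν(S(h₍₁₎)) b ν(h₍₂₎)`. -/
def adjointAct (ν : H →ₗ[k] B) : H →ₗ[k] B →ₗ[k] B :=
  LinearMap.mk₂ k (fun h b => ((LinearMap.mulRight k b ∘ₗ anti ν) ⊛ ν) h)
    (fun h h' b => map_add _ _ _)
    (fun c h b => map_smul _ _ _)
    (fun h b b' => by
      simp only [conv_apply _ _ (Coalgebra.Repr.arbitrary k h)]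
      simp [mul_add, add_mul, Finset.sum_add_distrib])
    (fun c h b => by
      simp only [conv_apply _ _ (Coalgebra.Repr.arbitrary k h)]
      simp [Finset.smul_sum])

/-- The algebra `B` with the adjoint action of `H` given by `ν`. -/
def adjoint (ν : H →ₗ[k] B) : HModAlg k H B where
  mul := LinearMap.mul k B
  one := 1
  act := adjointAct ν

theorem adjointAct_apply (ν : H →ₗ[k] B) (h : H) (b : B) :
    adjointAct ν h b = ((LinearMap.mulRight k b ∘ₗ anti ν) ⊛ ν) h := rfl

theorem adjointAct_repr (ν : H →ₗ[k] B) (b : B) {h : H} {ι : Type*} (r : Coalgebra.Repr k h ι) :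
    adjointAct ν h b =
      ∑ i ∈ r.index, ν (HopfAlgebra.antipode k (r.left i)) * b * ν (r.right i) := by
  rw [adjointAct_apply, conv_apply _ _ r]
  simp [anti_apply]

theorem conv_mul_right (u : B) (f g : H →ₗ[k] B) :
    f ⊛ (LinearMap.mulRight k u ∘ₗ g) = LinearMap.mulRight k u ∘ₗ (f ⊛ g) := by
  ext h
  rw [LinearMap.comp_apply, conv_apply _ _ (Coalgebra.Repr.arbitrary k h),
    conv_apply _ _ (Coalgebra.Repr.arbitrary k h)]
  simp [mul_assoc]

theorem conv_mulRight_convUnit (u : B) (f : H →ₗ[k] B) :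
    f ⊛ (LinearMap.mulRight k u ∘ₗ convUnit) = LinearMap.mulRight k u ∘ₗ f := by
  rw [conv_mul_right, conv_convUnit]

theorem tensorAct_conv (p q : H →ₗ[k] B →ₗ[k] B) (h : H) (x y : B) :
    TensorProduct.lift (LinearMap.mul k B) (tensorAct p q h (x ⊗ₜ y)) =
      (p.flip x ⊛ q.flip y) h := by
  rw [tensorAct_tmul]
  rfl

/-- In (x ◂ h₍₁₎)(y ◂ h₍₂₎) the inner factors ν(h₍₂₎) ν(S(h₍₃₎)) cancel, which is the compatibility
with the product. -/
theorem adjoint_isModuleAlgebra (ν : H →ₗ[k] B) [IsHom ν] : (adjoint ν).IsModuleAlgebra where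
  mul_assoc := mul_assoc
  one_mul := one_mul
  mul_one := mul_one
  act_one x := by
    simp [adjoint, adjointAct_apply, conv, anti, Bialgebra.comul_one,
      Algebra.TensorProduct.one_def, IsHom.map_one (f := ν)]
  act_mul h h' x := by
    simp only [adjoint, adjointAct_apply, conv, LinearMap.comp_apply, Bialgebra.comul_mul]
    generalize (Coalgebra.comul h : H ⊗[k] H) = s
    generalize (Coalgebra.comul h' : H ⊗[k] H) = t
    induction t with
    | zero => simp
    | add x y hx hy => simp only [mul_add, map_add, hx, hy]
    | tmul z w =>
      simp only [TensorProduct.map_tmul, LinearMap.mul'_apply, LinearMap.comp_apply]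
      induction s with
      | zero => simp
      | add x y hx hy =>
        simp only [LinearMap.mulRight_apply] at hx hy ⊢
        simp only [add_mul, map_add, hx, hy, mul_add]
      | tmul x y =>
        simp [anti_apply, HopfAlgebra.antipode_mul_antidistrib, IsHom.map_mul, mul_assoc]
  mul_act h x y := by
    have e : ∀ z, (adjointAct ν).flip z = (LinearMap.mulRight k z ∘ₗ anti ν) ⊛ ν := fun z => rfl
    rw [adjoint, tensorAct_conv, e, e, conv_assoc, ← conv_assoc ν, conv_mul_right, conv_anti,
      ← conv_assoc, conv_mulRight_convUnit, adjointAct_apply, ← LinearMap.comp_assoc]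
    congr 2
    congr 1
    ext z
    simp [mul_assoc]
  one_act h := by
    have : LinearMap.mulRight k (1 : B) ∘ₗ anti ν = anti ν := by ext; simp
    rw [adjoint, adjointAct_apply, this, anti_conv]
    simp [convUnit, Algebra.algebraMap_eq_smul_one]

end Adjoint

/-! ### Conjugation of adjoint actions by images of R -/

section AdjointConjugation

variable {k : Type*} [Field k] {H : Type*} [Ring H] [HopfAlgebra k H] (R : RMatrix k H)
variable {E : Type*} [Ring E] [Algebra k E]

local infixr:75 " ⊛ " => conv

theorem adjointAct_conv_anti (f : H →ₗ[k] E) [IsHom f] (b : E) :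
    (adjointAct f).flip b ⊛ anti f = LinearMap.mulRight k b ∘ₗ anti f := by
  change ((LinearMap.mulRight k b ∘ₗ anti f) ⊛ f) ⊛ anti f = _
  rw [conv_assoc, conv_anti, conv_convUnit]

/-- Since b commutes with g, the inner factors g(S(h)) and g(h) meet and cancel. On a tensor product
of algebras, an element of one factor therefore only sees the morphism of that factor. -/
theorem adjointAct_conv (f g : H →ₗ[k] E) [IsHom f] [IsHom g] [Commuting f g] {b : E}
    (hb : ∀ h, b * g h = g h * b) (h : H) : adjointAct (g ⊛ f) h b = adjointAct f h b := by
  have e : LinearMap.mulRight k b ∘ₗ (anti f ⊛ anti g) =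
      (LinearMap.mulRight k b ∘ₗ anti f) ⊛ anti g := by
    ext h
    rw [LinearMap.comp_apply, conv_apply _ _ (Coalgebra.Repr.arbitrary k h),
      conv_apply _ _ (Coalgebra.Repr.arbitrary k h), map_sum]
    refine Finset.sum_congr rfl fun i _ => ?_
    simp only [LinearMap.mulRight_apply, LinearMap.comp_apply, anti_apply, mul_assoc, hb]
  rw [adjointAct_apply, anti_conv_eq, e, conv_assoc, ← conv_assoc (anti g), anti_conv,
    convUnit_conv, adjointAct_apply]

theorem adjointAct_conj (f g : H →ₗ[k] E) [IsHom f] [IsHom g] [Commuting f g] (y : E) (h : H) :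
    adjointAct (g ⊛ f) h (R.el f g * y * R.inv f g) =
      R.el f g * adjointAct (f ⊛ g) h y * R.inv f g := by
  rw [adjointAct_repr _ _ (Coalgebra.Repr.arbitrary k h),
    adjointAct_repr _ _ (Coalgebra.Repr.arbitrary k h), Finset.mul_sum, Finset.sum_mul]
  refine Finset.sum_congr rfl fun i _ => ?_
  simp only [mul_assoc]
  rw [RMatrix.inv_mul_conv]
  simp only [← mul_assoc]
  rw [R.el_mul_conv f g]

/-- This links the formula of the theorem to conjugation. By (id ⊗ Δ)(R) = R₁₃R₁₂ the sum involves
two copies of R, with S applied to both legs of one and to the first leg of the other. Since (S ⊗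
S)(R) = R and (S ⊗ id)(R) = R⁻¹, these are the conjugating element and its inverse. -/
theorem sum_anti_mul_adjointAct (f g : H →ₗ[k] E) [IsHom f] [IsHom g] [hfg : Commuting f g] {b : E}
    (hb : ∀ h, b * f h = f h * b) :
    ∑ i, f (HopfAlgebra.antipode k (R.fst i)) * adjointAct g (R.snd i) b =
      R.el f g * b * R.inv f g := by
  have := congrArg (LinearMap.mul' k E ∘ₗ TensorProduct.map (anti f) (LinearMap.mul' k E ∘ₗ
    TensorProduct.map (LinearMap.mulRight k b ∘ₗ anti g) g)) R.sum_comul_snd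
  simp only [map_sum, LinearMap.comp_apply, TensorProduct.map_tmul, LinearMap.mul'_apply,
    anti_apply, HopfAlgebra.antipode_mul_antidistrib, IsHom.map_mul,
    LinearMap.mulRight_apply] at this
  refine Eq.trans this ?_
  rw [← R.el_anti_anti f g]
  simp only [RMatrix.el, RMatrix.inv, Finset.sum_mul, Finset.mul_sum, anti_apply]
  refine Finset.sum_congr rfl fun i _ => Finset.sum_congr rfl fun j _ => ?_
  simp only [mul_assoc]
  rw [← mul_assoc b, hb, mul_assoc, ← mul_assoc (g _) (f _), ← hfg.comm, mul_assoc]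

theorem map_adjointAct {E' : Type*} [Ring E'] [Algebra k E'] (φ : E →ₐ[k] E') (ν : H →ₗ[k] E)
    (h : H) (b : E) :
    φ (adjointAct ν h b) = adjointAct (φ.toLinearMap ∘ₗ ν) h (φ b) := by
  rw [adjointAct_repr _ _ (Coalgebra.Repr.arbitrary k h),
    adjointAct_repr _ _ (Coalgebra.Repr.arbitrary k h)]
  simp

end AdjointConjugation

/-! ### From a braided to an ordinary tensor product -/

section Combine

variable {k : Type*} [Field k] {H : Type*} [Ring H] [HopfAlgebra k H] (R : RMatrix k H)
variable {A : Type*} [AddCommMonoid A] [Module k A] {A' : Type*} [AddCommMonoid A'] [Module k A']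
variable {B : Type*} [Ring B] [Algebra k B] {B' : Type*} [Ring B'] [Algebra k B']

local infixr:75 " ⊛ " => conv

instance IsHom.comp (φ : B →ₐ[k] B') (f : H →ₗ[k] B) [IsHom f] :
    IsHom (φ.toLinearMap ∘ₗ f) where
  map_one := by simp [IsHom.map_one (f := f)]
  map_mul a b := by simp [IsHom.map_mul (f := f)]

/-- `f` is a morphism of module-algebras to the algebra `B` with the adjoint action. -/
def IsAdjointMorphism (X : HModAlg k H A) (ν : H →ₗ[k] B) (f : A →ₗ[k] B) : Prop :=
  X.IsAlgMorphism (adjoint ν) f ∧ X.IsEquivariant (adjoint ν) f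

/-- The map `h ↦ ν(h) ⊗ 1`. -/
def leftMap (B' : Type*) [Ring B'] [Algebra k B'] (ν : H →ₗ[k] B) : H →ₗ[k] B ⊗[k] B' :=
  (Algebra.TensorProduct.includeLeft : B →ₐ[k] B ⊗[k] B').toLinearMap ∘ₗ ν

/-- The map `h ↦ 1 ⊗ ν(h)`. -/
def rightMap (B : Type*) [Ring B] [Algebra k B] (ν : H →ₗ[k] B') : H →ₗ[k] B ⊗[k] B' :=
  (Algebra.TensorProduct.includeRight : B' →ₐ[k] B ⊗[k] B').toLinearMap ∘ₗ ν

theorem leftMap_apply (ν : H →ₗ[k] B) (h : H) : leftMap B' ν h = ν h ⊗ₜ[k] (1 : B') := rfl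

theorem rightMap_apply (ν : H →ₗ[k] B') (h : H) : rightMap B ν h = (1 : B) ⊗ₜ[k] ν h := rfl

instance (ν : H →ₗ[k] B) [IsHom ν] : IsHom (leftMap B' ν) := IsHom.comp _ _

instance (ν : H →ₗ[k] B') [IsHom ν] : IsHom (rightMap B ν) := IsHom.comp _ _

instance (ν : H →ₗ[k] B) (ν' : H →ₗ[k] B') : Commuting (leftMap B' ν) (rightMap B ν') :=
  ⟨fun a b => by simp [leftMap_apply, rightMap_apply]⟩

/-- The morphism `h ↦ ν(h₍₂₎) ⊗ ν'(h₍₁₎)`. -/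
def tensorMoment (ν : H →ₗ[k] B) (ν' : H →ₗ[k] B') : H →ₗ[k] B ⊗[k] B' :=
  rightMap B ν' ⊛ leftMap B' ν

instance (ν : H →ₗ[k] B) (ν' : H →ₗ[k] B') [IsHom ν] [IsHom ν'] : IsHom (tensorMoment ν ν') :=
  inferInstanceAs (IsHom (rightMap B ν' ⊛ leftMap B' ν))

/-- The map `a ⊗ a' ↦ f(a) ν(S(R₁)) ⊗ f'(a' ◂ R₂)`. -/
def combine (ν : H →ₗ[k] B) (X' : HModAlg k H A') (f : A →ₗ[k] B) (f' : A' →ₗ[k] B') :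
    A ⊗[k] A' →ₗ[k] B ⊗[k] B' :=
  ∑ i, TensorProduct.map (LinearMap.mulRight k (anti ν (R.fst i)) ∘ₗ f) (f' ∘ₗ X'.act (R.snd i))

theorem combine_tmul (ν : H →ₗ[k] B) (X' : HModAlg k H A') (f : A →ₗ[k] B) (f' : A' →ₗ[k] B')
    (a : A) (a' : A') :
    combine R ν X' f f' (a ⊗ₜ a') =
      ∑ i, (f a * anti ν (R.fst i)) ⊗ₜ[k] f' (X'.act (R.snd i) a') := by
  simp [combine]

variable {ν : H →ₗ[k] B} {ν' : H →ₗ[k] B'} [IsHom ν] [IsHom ν'] {X : HModAlg k H A}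
  {X' : HModAlg k H A'} {f : A →ₗ[k] B} {f' : A' →ₗ[k] B'}

theorem combine_tmul_conj (hf' : X'.IsEquivariant (adjoint ν') f') (a : A) (a' : A') :
    combine R ν X' f f' (a ⊗ₜ a') = (f a ⊗ₜ[k] (1 : B')) *
      (R.el (leftMap B' ν) (rightMap B ν') * ((1 : B) ⊗ₜ[k] f' a') *
        R.inv (leftMap B' ν) (rightMap B ν')) := by
  rw [← sum_anti_mul_adjointAct R (leftMap B' ν) (rightMap B ν') (fun h => by
    simp [leftMap_apply]), combine_tmul, Finset.mul_sum]
  refine Finset.sum_congr rfl fun i _ => ?_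
  rw [hf', rightMap]
  have := map_adjointAct (Algebra.TensorProduct.includeRight : B' →ₐ[k] B ⊗[k] B') ν' (R.snd i)
    (f' a')
  simp only [Algebra.TensorProduct.includeRight_apply] at this
  rw [← this, leftMap_apply]
  simp [anti_apply, adjoint]

/-- Write C(y) for the conjugate of 1 ⊗ y by 𝓡, so that C is multiplicative. Only the exchange of
C(f'(a')) with f(b) ⊗ 1 has to match the braiding. For equivariance, f(a) ⊗ 1 commutes with ν', so
only ν acts on it; conjugation by 𝓡 reverses the order in the moment morphism, after which only ν'
acts on 1 ⊗ f'(a'). -/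
theorem combine_isAdjointMorphism (hX' : X'.IsModuleAlgebra) (hf : IsAdjointMorphism X ν f)
    (hf' : IsAdjointMorphism X' ν' f') :
    IsAdjointMorphism (braidedTensor R X X') (tensorMoment ν ν') (combine R ν X' f f') := by
  obtain ⟨⟨hfm, hf1⟩, hfe⟩ := hf
  obtain ⟨⟨hfm', hf1'⟩, hfe'⟩ := hf'
  -- The exchange relation: C(f'(a')) is expanded as a sum over R, and (Δ ⊗ id)(R) = R₁₃R₂₃ is
  -- combined with (b ◂ h₍₁₎) ν(S(h₍₂₎)) = ν(S(h)) b.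
  have hmove : ∀ b a', ∑ i, (f (X.act (R.fst i) b) ⊗ₜ[k] (1 : B')) *
      (R.el (leftMap B' ν) (rightMap B ν') * ((1 : B) ⊗ₜ[k] f' (X'.act (R.snd i) a')) *
        R.inv (leftMap B' ν) (rightMap B ν')) =
      (R.el (leftMap B' ν) (rightMap B ν') * ((1 : B) ⊗ₜ[k] f' a') *
        R.inv (leftMap B' ν) (rightMap B ν')) * (f b ⊗ₜ[k] (1 : B')) := by
    intro b a'
    have h0 : ∀ x, R.el (leftMap B' ν) (rightMap B ν') * ((1 : B) ⊗ₜ[k] f' x) *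
        R.inv (leftMap B' ν) (rightMap B ν') =
        ∑ i, anti ν (R.fst i) ⊗ₜ[k] f' (X'.act (R.snd i) x) := by
      intro x
      have h := combine_tmul_conj R (ν := ν) (f := LinearMap.id) hfe' (1 : B) x
      rw [combine_tmul, LinearMap.id_apply, ← Algebra.TensorProduct.one_def, one_mul] at h
      simp only [one_mul] at h
      exact h.symm
    have key := congrArg (TensorProduct.map (LinearMap.mul' k B ∘ₗ TensorProduct.map
      ((adjointAct ν).flip (f b)) (anti ν)) (f' ∘ₗ X'.act.flip a')) R.sum_comul_fst
    simp only [map_sum, TensorProduct.map_tmul] at key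
    have h1 : ∀ h : H, (LinearMap.mul' k B ∘ₗ TensorProduct.map ((adjointAct ν).flip (f b))
        (anti ν)) (Coalgebra.comul h) = anti ν h * f b := by
      intro h
      exact LinearMap.congr_fun (adjointAct_conv_anti ν (f b)) h
    simp only [h1] at key
    rw [h0, Finset.sum_mul]
    simp only [h0, Finset.mul_sum, Algebra.TensorProduct.tmul_mul_tmul, one_mul, mul_one]
    refine Eq.trans ?_ key.symm
    refine Finset.sum_congr rfl fun i _ => Finset.sum_congr rfl fun j _ => ?_
    simp [hfe _ b, adjoint, hX'.act_mul]
  refine ⟨⟨?_, ?_⟩, ?_⟩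
  · intro x y
    induction x with
    | zero => simp
    | add x x' hx hx' => simp only [map_add, LinearMap.add_apply, hx, hx']
    | tmul a a' =>
    induction y with
    | zero => simp
    | add x x' hx hx' => simp only [map_add, hx, hx']
    | tmul b b' =>
    have h1 : (braidedTensor R X X').mul (a ⊗ₜ a') (b ⊗ₜ b') =
        ∑ i, X.mul a (X.act (R.fst i) b) ⊗ₜ[k]
        X'.mul (X'.act (R.snd i) a') b' := by
      simp [braidedTensor, twistedMul_tmul, braiding_tmul]
    have hC : ∀ x y, R.el (leftMap B' ν) (rightMap B ν') * ((1 : B) ⊗ₜ[k] (x * y)) *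
        R.inv (leftMap B' ν) (rightMap B ν') = (R.el (leftMap B' ν) (rightMap B ν') *
        ((1 : B) ⊗ₜ[k] x) * R.inv (leftMap B' ν) (rightMap B ν')) *
        (R.el (leftMap B' ν) (rightMap B ν') *
        ((1 : B) ⊗ₜ[k] y) * R.inv (leftMap B' ν) (rightMap B ν')) := by
      intro x y
      have : ((1 : B) ⊗ₜ[k] (x * y)) = (1 ⊗ₜ[k] x) * (1 ⊗ₜ[k] y) := by simp
      rw [this]
      simp only [mul_assoc]
      rw [← mul_assoc (R.inv _ _) (R.el _ _), R.inv_mul_el, one_mul]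
    simp only [h1, map_sum, combine_tmul_conj R hfe', hfm, hfm']
    simp only [adjoint, LinearMap.mul_apply', hC]
    conv_rhs => rw [mul_assoc, ← mul_assoc _ (f b ⊗ₜ[k] (1 : B')), ← hmove, Finset.sum_mul,
      Finset.mul_sum]
    refine Finset.sum_congr rfl fun i _ => ?_
    rw [show ((f a * f (X.act (R.fst i) b)) ⊗ₜ[k] (1 : B')) =
      (f a ⊗ₜ[k] (1 : B')) * (f (X.act (R.fst i) b) ⊗ₜ[k] (1 : B')) by simp]
    simp only [mul_assoc]
  · change combine R ν X' f f' (X.one ⊗ₜ X'.one) = _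
    rw [combine_tmul_conj R hfe', hf1, hf1']
    simp only [adjoint]
    rw [← Algebra.TensorProduct.one_def, mul_one, R.el_mul_inv, one_mul]
  · intro h x
    induction x with
    | zero => simp
    | add x x' hx hx' => simp only [map_add, hx, hx']
    | tmul a a' =>
    have hL : ∀ h, adjointAct (tensorMoment ν ν') h (f a ⊗ₜ[k] (1 : B')) =
        f (X.act h a) ⊗ₜ[k] (1 : B') := by
      intro h
      rw [tensorMoment, adjointAct_conv (leftMap B' ν) (rightMap B ν') (fun h => by
        simp [rightMap_apply]), hfe]
      exact (map_adjointAct (Algebra.TensorProduct.includeLeft : B →ₐ[k] B ⊗[k] B') ν h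
        (f a)).symm
    have hR : ∀ h, adjointAct (tensorMoment ν ν') h (R.el (leftMap B' ν) (rightMap B ν') *
        ((1 : B) ⊗ₜ[k] f' a') * R.inv (leftMap B' ν) (rightMap B ν')) =
        R.el (leftMap B' ν) (rightMap B ν') * ((1 : B) ⊗ₜ[k] f' (X'.act h a')) *
          R.inv (leftMap B' ν) (rightMap B ν') := by
      intro h
      rw [tensorMoment, adjointAct_conj, adjointAct_conv (rightMap B ν') (leftMap B' ν) (fun h => by
        simp [leftMap_apply]), hfe']
      congr 2
      exact (map_adjointAct (Algebra.TensorProduct.includeRight : B' →ₐ[k] B ⊗[k] B') ν' h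
        (f' a')).symm
    have hmul := (adjoint_isModuleAlgebra (tensorMoment ν ν')).mul_act h (f a ⊗ₜ[k] (1 : B'))
      (R.el (leftMap B' ν) (rightMap B ν') *
        ((1 : B) ⊗ₜ[k] f' a') * R.inv (leftMap B' ν) (rightMap B ν'))
    rw [combine_tmul_conj R hfe']
    refine Eq.trans ?_ hmul.symm
    simp only [adjoint, tensorAct_tmul, braidedTensor]
    generalize (Coalgebra.comul h : H ⊗[k] H) = t
    induction t with
    | zero => simp
    | add x y hx hy => simp only [map_add, hx, hy]
    | tmul x y =>
      simp only [TensorProduct.map_tmul, LinearMap.flip_apply, TensorProduct.lift.tmul,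
        combine_tmul_conj R hfe', hL, hR, LinearMap.mul_apply']

theorem sum_antipode_mul_tmul_mul :
    ∑ i, ∑ j, (HopfAlgebra.antipode k (R.fst i) * R.fst j) ⊗ₜ[k] (R.snd i * R.snd j) = 1 ∧
    ∑ i, ∑ j, (R.fst i * HopfAlgebra.antipode k (R.fst j)) ⊗ₜ[k] (R.snd i * R.snd j) = 1 := by
  have h : IsHom (LinearMap.id : H →ₗ[k] H) := ⟨rfl, fun _ _ => rfl⟩
  have h1 := R.inv_mul_el (leftMap H LinearMap.id) (rightMap H LinearMap.id)
  have h2 := R.el_mul_inv (leftMap H LinearMap.id) (rightMap H LinearMap.id)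
  simp only [RMatrix.inv, RMatrix.el, leftMap_apply, rightMap_apply, Finset.sum_mul_sum,
    Algebra.TensorProduct.tmul_mul_tmul, one_mul, mul_one, LinearMap.id_apply] at h1 h2
  exact ⟨h1, h2⟩

/-- The map is f ⊗ id, followed by a twist T of B ⊗ A', followed by id ⊗ f'. Because A' is a right
H-module, T is inverted by the same formula without the antipode, by (S ⊗ id)(R) = R⁻¹. -/
theorem combine_bijective (hX' : X'.IsModuleAlgebra) (hf : Function.Bijective f)
    (hf' : Function.Bijective f') : Function.Bijective (combine R ν X' f f') := by
  let T : B ⊗[k] A' →ₗ[k] B ⊗[k] A' := ∑ i, TensorProduct.map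
    (LinearMap.mulRight k (anti ν (R.fst i))) (X'.act (R.snd i))
  let T' : B ⊗[k] A' →ₗ[k] B ⊗[k] A' := ∑ i, TensorProduct.map
    (LinearMap.mulRight k (ν (R.fst i))) (X'.act (R.snd i))
  have h1 : T' ∘ₗ T = LinearMap.id := by
    ext b a'
    have := congrArg (TensorProduct.map (LinearMap.mulLeft k b ∘ₗ ν) (X'.act.flip a'))
      (sum_antipode_mul_tmul_mul R).1
    simp only [map_sum, TensorProduct.map_tmul, LinearMap.comp_apply, IsHom.map_mul,
      LinearMap.flip_apply, hX'.act_mul, Algebra.TensorProduct.one_def, IsHom.map_one,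
      hX'.act_one, LinearMap.mulLeft_apply, mul_one] at this
    rw [Finset.sum_comm] at this
    simpa [T, T', LinearMap.sum_apply, anti_apply, mul_assoc] using this
  have h2 : T ∘ₗ T' = LinearMap.id := by
    ext b a'
    have := congrArg (TensorProduct.map (LinearMap.mulLeft k b ∘ₗ ν) (X'.act.flip a'))
      (sum_antipode_mul_tmul_mul R).2
    simp only [map_sum, TensorProduct.map_tmul, LinearMap.comp_apply, IsHom.map_mul,
      LinearMap.flip_apply, hX'.act_mul, Algebra.TensorProduct.one_def, IsHom.map_one,
      hX'.act_one, LinearMap.mulLeft_apply, mul_one] at this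
    rw [Finset.sum_comm] at this
    simpa [T, T', LinearMap.sum_apply, anti_apply, mul_assoc] using this
  have h3 : combine R ν X' f f' = (TensorProduct.congr (LinearEquiv.refl k B)
      (LinearEquiv.ofBijective f' hf')).toLinearMap ∘ₗ
      (LinearEquiv.ofLinearMap T T' h2 h1).toLinearMap ∘ₗ
      (TensorProduct.congr (LinearEquiv.ofBijective f hf) (LinearEquiv.refl k A')).toLinearMap := by
    ext a a'
    simp [combine_tmul, T]
  rw [h3, ← LinearEquiv.coe_trans, ← LinearEquiv.coe_trans]
  exact LinearEquiv.bijective _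

end Combine

/-! ### Iteration over tensor powers -/

section TensorPower

variable {k : Type u} [Field k] {H : Type v} [Ring H] [HopfAlgebra k H] (R : RMatrix k H)
variable {A : Type*} [AddCommMonoid A] [Module k A] {B : Type w} [Ring B] [Algebra k B]
variable {A' : Type*} [AddCommMonoid A'] [Module k A'] {B' : Type*} [Ring B'] [Algebra k B']

local infixr:75 " ⊛ " => conv

theorem snocEquiv_mul (m : ℕ) (x y : (⨂[k] _ : Fin m, B) ⊗[k] B) :
    snocEquiv k B m (x * y) = snocEquiv k B m x * snocEquiv k B m y := by
  induction x with
  | zero => simp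
  | add x x' hx hx' => simp only [map_add, add_mul, hx, hx']
  | tmul t b =>
  induction y with
  | zero => simp
  | add x x' hx hx' => simp only [map_add, mul_add, hx, hx']
  | tmul s c =>
  induction t using PiTensorProduct.induction_on with
  | add x y hx hy => simp only [TensorProduct.add_tmul, add_mul, map_add, hx, hy]
  | smul_tprod r x =>
  induction s using PiTensorProduct.induction_on with
  | add x y hx hy => simp only [TensorProduct.add_tmul, mul_add, map_add, hx, hy]
  | smul_tprod r' y =>
    simp only [← TensorProduct.smul_tmul', smul_mul_smul_comm, map_smul,
      Algebra.TensorProduct.tmul_mul_tmul, PiTensorProduct.tprod_mul_tprod, snocEquiv_tprod_tmul]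
    congr 2
    funext i
    refine Fin.lastCases ?_ (fun j => ?_) i <;> simp

theorem snocEquiv_one (m : ℕ) : snocEquiv k B m 1 = 1 := by
  rw [Algebra.TensorProduct.one_def, PiTensorProduct.one_def, snocEquiv_tprod_tmul,
    PiTensorProduct.one_def]
  congr 1
  funext i
  refine Fin.lastCases ?_ (fun j => ?_) i <;> simp

variable (k B) in
/-- The identification `B^{⊗m} ⊗ B ≃ B^{⊗(m+1)}` as an isomorphism of algebras. -/
def snocAlgEquiv (m : ℕ) : (⨂[k] _ : Fin m, B) ⊗[k] B ≃ₐ[k] (⨂[k] _ : Fin (m + 1), B) :=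
  AlgEquiv.ofLinearEquiv (snocEquiv k B m) (snocEquiv_one m) (snocEquiv_mul m)

theorem snocAlgEquiv_apply (m : ℕ) (x : (⨂[k] _ : Fin m, B) ⊗[k] B) :
    snocAlgEquiv k B m x = snocEquiv k B m x := rfl

theorem IsAdjointMorphism.transport {X : HModAlg k H A} {ν : H →ₗ[k] B} {f : A →ₗ[k] B}
    (hf : IsAdjointMorphism X ν f) (e : A ≃ₗ[k] A') (φ : B ≃ₐ[k] B') :
    IsAdjointMorphism (X.transport e) (φ.toAlgHom.toLinearMap ∘ₗ ν)
      (φ.toAlgHom.toLinearMap ∘ₗ f ∘ₗ e.symm.toLinearMap) := by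
  refine ⟨⟨fun x y => ?_, ?_⟩, fun h x => ?_⟩
  · simp [HModAlg.transport, hf.1.1, adjoint]
  · simp [HModAlg.transport, hf.1.2, adjoint]
  · have := map_adjointAct φ.toAlgHom ν h (f (e.symm x))
    simp only [AlgEquiv.toAlgHom_apply] at this
    have h2 := hf.2 h (e.symm x)
    simp only [adjoint] at h2
    simp only [HModAlg.transport, LinearMap.comp_apply, LinearEquiv.coe_coe, adjoint,
      LinearEquiv.conj_apply, LinearEquiv.symm_apply_apply, h2]
    exact this

/-- The morphism `h ↦ ν(h₍ₘ₎) ⊗ ⋯ ⊗ ν(h₍₁₎)`. -/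
def momentPow (ν : H →ₗ[k] B) : (m : ℕ) → H →ₗ[k] (⨂[k] _ : Fin m, B)
  | 0 => convUnit
  | m + 1 => (snocAlgEquiv k B m).toAlgHom.toLinearMap ∘ₗ tensorMoment (momentPow ν m) ν

instance convUnit_isHom : IsHom (convUnit : H →ₗ[k] B) where
  map_one := by simp [convUnit]
  map_mul a b := by simp [convUnit]

instance momentPow_isHom (ν : H →ₗ[k] B) [IsHom ν] : (m : ℕ) → IsHom (momentPow ν m)
  | 0 => convUnit_isHom
  | m + 1 => by
    have := momentPow_isHom ν m
    exact IsHom.comp _ _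

/-- The map `A^{⊗m} → B^{⊗m}` obtained from `f : A → B` by iterating `combine`. -/
def combinePow (ν : H →ₗ[k] B) (X : HModAlg k H A) (f : A →ₗ[k] B) :
    (m : ℕ) → (⨂[k] _ : Fin m, A) →ₗ[k] (⨂[k] _ : Fin m, B)
  | 0 => (PiTensorProduct.isEmptyEquiv (Fin 0)).symm.toLinearMap ∘ₗ
      (PiTensorProduct.isEmptyEquiv (Fin 0)).toLinearMap
  | m + 1 => (snocAlgEquiv k B m).toAlgHom.toLinearMap ∘ₗ
      combine R (momentPow ν m) X (combinePow ν X f m) f ∘ₗ (snocEquiv k A m).symm.toLinearMap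

theorem isEmptyEquiv_symm_eq_algebraMap (c : k) :
    (PiTensorProduct.isEmptyEquiv (R := k) (s := fun _ : Fin 0 => B) (Fin 0)).symm c =
      algebraMap k _ c := by
  rw [PiTensorProduct.isEmptyEquiv_symm_apply, Algebra.algebraMap_eq_smul_one,
    PiTensorProduct.one_def]
  congr 2
  funext i
  exact i.elim0

theorem tprod_isEmptyElim :
    PiTensorProduct.tprod k (isEmptyElim : Fin 0 → B) = (1 : ⨂[k] _ : Fin 0, B) := by
  rw [PiTensorProduct.one_def]
  congr 1
  funext i
  exact i.elim0

theorem combinePow_isAdjointMorphism {ν : H →ₗ[k] B} [IsHom ν] {X : HModAlg k H A}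
    {f : A →ₗ[k] B} (hX : X.IsModuleAlgebra) (hf : IsAdjointMorphism X ν f) (m : ℕ) :
    IsAdjointMorphism (braidedPow R X m) (momentPow ν m) (combinePow R ν X f m) := by
  induction m with
  | succ m ih =>
    rw [braidedPow_succ]
    exact (combine_isAdjointMorphism R hX ih hf).transport _ _
  | zero =>
    refine ⟨⟨fun x y => ?_, ?_⟩, fun h x => ?_⟩
    · simp [braidedPow, powMul, combinePow, tprod_isEmptyElim, adjoint]
      exact smul_comm _ _ _
    · simp [braidedPow, combinePow, tprod_isEmptyElim, adjoint]
    · have h1 := (adjoint_isModuleAlgebra (momentPow ν 0)).one_act h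
      simp only [adjoint] at h1
      simp only [braidedPow, powAct, combinePow, LinearMap.comp_apply, LinearEquiv.coe_coe,
        isEmptyEquiv_symm_eq_algebraMap, adjoint, Algebra.algebraMap_eq_smul_one, map_smul, h1]
      simp [smul_smul, mul_comm]

theorem combinePow_bijective {ν : H →ₗ[k] B} [IsHom ν] {X : HModAlg k H A}
    {f : A →ₗ[k] B} (hX : X.IsModuleAlgebra) (hf : Function.Bijective f) (m : ℕ) :
    Function.Bijective (combinePow R ν X f m) := by
  induction m with
  | zero =>
    simp only [combinePow, ← LinearEquiv.coe_trans]
    exact LinearEquiv.bijective _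
  | succ m ih =>
    simp only [combinePow, LinearMap.coe_comp]
    exact (snocAlgEquiv k B m).bijective.comp
      ((combine_bijective R hX ih hf).comp (snocEquiv k A m).symm.bijective)

/-! ## Formulas for the moment maps -/

theorem allLegs_succ (F : H →ₗ[k] B) (m : ℕ) :
    allLegs F (m + 1) = (snocEquiv k B m).toLinearMap ∘ₗ
      TensorProduct.map (allLegs F m) F ∘ₗ Coalgebra.comul := by
  have h : PiTensorProduct.map (fun _ : Fin (m + 1) => F) ∘ₗ (snocEquiv k H m).toLinearMap =
      (snocEquiv k B m).toLinearMap ∘ₗ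
        TensorProduct.map (PiTensorProduct.map (fun _ : Fin m => F)) F := by
    ext c x
    simp only [LinearMap.compMultilinearMap_apply, TensorProduct.AlgebraTensorModule.curry_apply,
      TensorProduct.curry_apply, LinearMap.coe_restrictScalars, LinearMap.comp_apply,
      LinearEquiv.coe_coe, snocEquiv_tprod_tmul, TensorProduct.map_tmul,
      PiTensorProduct.map_tprod]
    congr 1
    funext i
    refine Fin.lastCases ?_ (fun j => ?_) i <;> simp
  rw [allLegs, iterComul, ← LinearMap.comp_assoc, h]
  ext x
  simp only [LinearMap.comp_apply, TensorProduct.map_map]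
  rfl

/-- The antipode reverses the coproduct and thereby undoes the reversal in `tensorMoment`. This is
why the legs in the defining formulas come in increasing order. -/
theorem anti_tensorMoment (ν : H →ₗ[k] B) (ν' : H →ₗ[k] B') :
    anti (tensorMoment ν ν') = TensorProduct.map (anti ν) (anti ν') ∘ₗ Coalgebra.comul := by
  rw [tensorMoment, anti_conv_eq]
  ext h
  rw [conv_apply _ _ (Coalgebra.Repr.arbitrary k h), LinearMap.comp_apply,
    ← (Coalgebra.Repr.arbitrary k h).eq]
  simp [anti_apply, leftMap_apply, rightMap_apply]

theorem tensorMoment_eq (ν : H →ₗ[k] B) (ν' : H →ₗ[k] B') :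
    tensorMoment ν ν' = TensorProduct.map ν ν' ∘ₗ (TensorProduct.comm k H H).toLinearMap ∘ₗ
      Coalgebra.comul := by
  rw [tensorMoment]
  ext h
  rw [conv_apply _ _ (Coalgebra.Repr.arbitrary k h), LinearMap.comp_apply, LinearMap.comp_apply,
    ← (Coalgebra.Repr.arbitrary k h).eq]
  simp [leftMap_apply, rightMap_apply]

theorem anti_momentPow (ν : H →ₗ[k] B) (m : ℕ) : anti (momentPow ν m) = allLegs (anti ν) m := by
  induction m with
  | zero =>
    ext h
    simp only [anti_apply, momentPow, convUnit, allLegs, iterComul, LinearMap.comp_apply,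
      LinearEquiv.coe_coe, PiTensorProduct.isEmptyEquiv_symm_apply, map_smul,
      PiTensorProduct.map_tprod, HopfAlgebra.counit_antipode, Algebra.linearMap_apply,
      Algebra.algebraMap_eq_smul_one, PiTensorProduct.one_def]
    congr 2
    funext i
    exact i.elim0
  | succ m ih =>
    rw [allLegs_succ, ← ih, ← anti_tensorMoment]
    rfl

/-- The map `b, b₁ ⊗ ⋯ ⊗ bₘ ↦ b ⊗ b₁ ⊗ ⋯ ⊗ bₘ`. -/
def consMap (m : ℕ) : B →ₗ[k] (⨂[k] _ : Fin m, B) →ₗ[k] (⨂[k] _ : Fin (m + 1), B) :=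
  PiTensorProduct.lift.toLinearMap ∘ₗ
    (PiTensorProduct.tprod k : MultilinearMap k (fun _ : Fin (m + 1) => B) _).curryLeft

theorem consMap_tprod (m : ℕ) (b : B) (c : Fin m → B) :
    consMap m b (PiTensorProduct.tprod k c) =
      PiTensorProduct.tprod k (Fin.cons b c : Fin (m + 1) → B) := by
  simp [consMap]

theorem consMap_snocEquiv (m : ℕ) (b : B) (t : ⨂[k] _ : Fin m, B) (c : B) :
    consMap (m + 1) b (snocEquiv k B m (t ⊗ₜ c)) =
      snocEquiv k B (m + 1) (consMap m b t ⊗ₜ c) := by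
  induction t using PiTensorProduct.induction_on with
  | add x y hx hy => simp only [TensorProduct.add_tmul, map_add, hx, hy]
  | smul_tprod r x =>
    simp only [← TensorProduct.smul_tmul', map_smul, snocEquiv_tprod_tmul, consMap_tprod,
      Fin.cons_snoc_eq_snoc_cons]

/-- The iterated coproduct splits off its last leg, which is the first tensor factor after reversal;
hence `consMap` instead of `snocEquiv`. -/
theorem allLegsRev_succ (F : H →ₗ[k] B) (m : ℕ) :
    allLegsRev F (m + 1) = TensorProduct.lift ((consMap m ∘ₗ F).flip ∘ₗ allLegsRev F m) ∘ₗ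
      Coalgebra.comul := by
  have h : PiTensorProduct.lift (((PiTensorProduct.tprod k).compLinearMap
      (fun _ => F)).domDomCongr (Fin.revPerm (n := m + 1))) ∘ₗ (snocEquiv k H m).toLinearMap =
      TensorProduct.lift ((consMap m ∘ₗ F).flip ∘ₗ PiTensorProduct.lift
        (((PiTensorProduct.tprod k).compLinearMap (fun _ => F)).domDomCongr
          (Fin.revPerm (n := m)))) := by
    ext c x
    simp only [LinearMap.compMultilinearMap_apply, TensorProduct.AlgebraTensorModule.curry_apply,
      TensorProduct.curry_apply, LinearMap.coe_restrictScalars, LinearMap.comp_apply,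
      LinearEquiv.coe_coe, snocEquiv_tprod_tmul, PiTensorProduct.lift.tprod,
      MultilinearMap.domDomCongr_apply, MultilinearMap.compLinearMap_apply,
      TensorProduct.lift.tmul, LinearMap.flip_apply, consMap_tprod]
    congr 1
    funext i
    refine Fin.cases ?_ (fun j => ?_) i
    · simp
    · simp [Fin.rev_succ]
      rfl
  rw [allLegsRev, iterComul, ← LinearMap.comp_assoc, h]
  ext x
  simp only [LinearMap.comp_apply, allLegsRev]
  generalize (Coalgebra.comul x : H ⊗[k] H) = t
  induction t with
  | zero => simp
  | add x y hx hy => simp only [map_add, hx, hy]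
  | tmul x y => simp

/-- One side is built by adding factors on the left, the other by adding them on the right. For m +
2 factors, both are rewritten with one factor added at each end, and coassociativity identifies
them. This uses the cases m and m + 1, hence the two-step induction. -/
theorem allLegsRev_eq_momentPow (F : H →ₗ[k] B) (m : ℕ) : allLegsRev F m = momentPow F m := by
  have h0 : allLegsRev F 0 = momentPow F 0 := by
    ext h
    simp only [momentPow, convUnit, allLegsRev, iterComul, LinearMap.comp_apply,
      LinearEquiv.coe_coe, PiTensorProduct.isEmptyEquiv_symm_apply, map_smul,
      PiTensorProduct.lift.tprod, Algebra.linearMap_apply,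
      Algebra.algebraMap_eq_smul_one, PiTensorProduct.one_def, MultilinearMap.domDomCongr_apply,
      MultilinearMap.compLinearMap_apply]
    congr 2
    funext i
    exact i.elim0
  have hs : ∀ m, momentPow F (m + 1) = (snocEquiv k B m).toLinearMap ∘ₗ
      TensorProduct.map (momentPow F m) F ∘ₗ (TensorProduct.comm k H H).toLinearMap ∘ₗ
      Coalgebra.comul := by
    intro m
    rw [momentPow, tensorMoment_eq]
    rfl
  induction m using Nat.twoStepInduction with
  | zero => exact h0
  | one =>
    rw [allLegsRev_succ, hs, h0]
    have e1 : ∀ b : B, consMap 0 b (1 : ⨂[k] _ : Fin 0, B) =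
        snocEquiv k B 0 ((1 : ⨂[k] _ : Fin 0, B) ⊗ₜ b) := by
      intro b
      rw [PiTensorProduct.one_def, snocEquiv_tprod_tmul, consMap_tprod]
      congr 1
      funext i
      rw [Fin.fin_one_eq_zero i]
      rfl
    have e2 : TensorProduct.lift ((consMap 0 ∘ₗ F).flip ∘ₗ momentPow F 0) =
        ((consMap 0).flip 1 ∘ₗ F) ∘ₗ (TensorProduct.lid k H).toLinearMap ∘ₗ
          LinearMap.rTensor H Coalgebra.counit := by
      ext x y
      simp [momentPow, convUnit, Algebra.algebraMap_eq_smul_one]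
    have e3 : (snocEquiv k B 0).toLinearMap ∘ₗ TensorProduct.map (momentPow F 0) F ∘ₗ
        (TensorProduct.comm k H H).toLinearMap =
        ((consMap 0).flip 1 ∘ₗ F) ∘ₗ (TensorProduct.rid k H).toLinearMap ∘ₗ
          LinearMap.lTensor H Coalgebra.counit := by
      ext x y
      simp [momentPow, convUnit, Algebra.algebraMap_eq_smul_one, e1, ← TensorProduct.smul_tmul']
    ext h
    have a := LinearMap.congr_fun e2 (Coalgebra.comul h)
    have b := LinearMap.congr_fun e3 (Coalgebra.comul h)
    simp only [LinearMap.comp_apply, Coalgebra.rTensor_counit_comul,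
      Coalgebra.lTensor_counit_comul] at a b ⊢
    rw [a, b]
    simp
  | more m ih1 ih2 =>
    let Γ : H ⊗[k] (H ⊗[k] H) →ₗ[k] (⨂[k] _ : Fin (m + 2), B) :=
      (snocEquiv k B (m + 1)).toLinearMap ∘ₗ (TensorProduct.comm k _ _).toLinearMap ∘ₗ
        TensorProduct.map F (TensorProduct.lift ((consMap m ∘ₗ F).flip ∘ₗ momentPow F m))
    have e1 : TensorProduct.lift ((consMap (m + 1) ∘ₗ F).flip ∘ₗ momentPow F (m + 1)) =
        Γ ∘ₗ (TensorProduct.assoc k H H H).toLinearMap ∘ₗ LinearMap.rTensor H Coalgebra.comul := by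
      ext x y
      simp only [TensorProduct.AlgebraTensorModule.curry_apply, TensorProduct.curry_apply,
        LinearMap.coe_restrictScalars, LinearMap.comp_apply, TensorProduct.lift.tmul, hs,
        LinearMap.flip_apply, LinearMap.rTensor_tmul, LinearEquiv.coe_coe]
      generalize (Coalgebra.comul x : H ⊗[k] H) = t
      induction t with
      | zero => simp
      | add x y hx hy => simp only [map_add, TensorProduct.add_tmul, hx, hy]
      | tmul x y => simp [Γ, consMap_snocEquiv]
    have e2 : (snocEquiv k B (m + 1)).toLinearMap ∘ₗ TensorProduct.map (momentPow F (m + 1)) F ∘ₗ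
        (TensorProduct.comm k H H).toLinearMap = Γ ∘ₗ LinearMap.lTensor H Coalgebra.comul := by
      ext x y
      simp [← ih2, allLegsRev_succ, ih1, Γ]
    rw [allLegsRev_succ, ih2, hs (m + 1)]
    ext h
    have a := LinearMap.congr_fun e1 (Coalgebra.comul h)
    have b := LinearMap.congr_fun e2 (Coalgebra.comul h)
    simp only [LinearMap.comp_apply, LinearEquiv.coe_coe, Coalgebra.coassoc_apply] at a b ⊢
    rw [a, b]

/-! ## Formulas for the morphism on the factors -/

theorem legs_snoc (F : H →ₗ[k] B) (N m : ℕ) (hm : m ≤ N) (z : Fin N → B) (b : B) (h : H) :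
    snocEquiv k B N (legs F N m hm z h ⊗ₜ b) =
      legs F (N + 1) m (hm.trans N.le_succ) (Fin.snoc z b : Fin (N + 1) → B) h := by
  simp only [legs, LinearMap.comp_apply]
  induction iterComul k H m h using PiTensorProduct.induction_on with
  | add x y hx hy => simp only [TensorProduct.add_tmul, map_add, hx, hy]
  | smul_tprod r c =>
    simp only [← TensorProduct.smul_tmul', map_smul, PiTensorProduct.lift.tprod, fillMultilinear,
      MultilinearMap.mk'_apply, snocEquiv_tprod_tmul]
    congr 2
    funext i
    refine Fin.lastCases ?_ (fun j => ?_) i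
    · simp [hm]
    · simp

theorem allLegs_snoc (F : H →ₗ[k] B) (m : ℕ) (b : B) (z : Fin (m + 1) → B) (h : H) :
    snocEquiv k B m (allLegs F m h ⊗ₜ b) =
      legs F (m + 1) m m.le_succ (Function.update z (Fin.last m) b) h := by
  simp only [legs, allLegs, LinearMap.comp_apply]
  induction iterComul k H m h using PiTensorProduct.induction_on with
  | add x y hx hy => simp only [TensorProduct.add_tmul, map_add, hx, hy]
  | smul_tprod r c =>
    simp only [← TensorProduct.smul_tmul', map_smul, PiTensorProduct.lift.tprod, fillMultilinear,
      MultilinearMap.mk'_apply, snocEquiv_tprod_tmul, PiTensorProduct.map_tprod]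
    congr 2
    funext i
    refine Fin.lastCases ?_ (fun j => ?_) i
    · simp
    · simp

/-- The unit turns the second leg of R into its counit, and (id ⊗ ε)(R) = 1. Factors after the
chosen one therefore contribute only units. -/
theorem combine_tmul_one {ν : H →ₗ[k] B} [IsHom ν] {X' : HModAlg k H A'} {f : A →ₗ[k] B}
    {ν' : H →ₗ[k] B'} {f' : A' →ₗ[k] B'} (hX' : X'.IsModuleAlgebra)
    (hf' : IsAdjointMorphism X' ν' f') (a : A) :
    combine R ν X' f f' (a ⊗ₜ X'.one) = f a ⊗ₜ 1 := by
  have h : ∑ i, (Coalgebra.counit (R.snd i) : k) • anti ν (R.fst i) = 1 := by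
    simp only [← map_smul, ← map_sum, R.sum_counit_smul_fst]
    rw [anti_apply, HopfAlgebra.antipode_one, IsHom.map_one]
  rw [combine_tmul]
  simp only [hX'.one_act, map_smul, hf'.1.2, ← TensorProduct.smul_tmul]
  rw [← TensorProduct.sum_tmul]
  simp only [← mul_smul_comm]
  rw [← Finset.mul_sum, h, mul_one]
  rfl

theorem update_const_snoc {C : Type*} (m : ℕ) (c x : C) (j : Fin m) :
    (Fin.snoc (Function.update (fun _ => c) j x) c : Fin (m + 1) → C) =
      Function.update (fun _ => c) j.castSucc x := by
  funext i
  refine Fin.lastCases ?_ (fun l => ?_) i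
  · simp [Function.update_of_ne (Fin.castSucc_lt_last j).ne']
  · rw [Fin.snoc_castSucc]
    by_cases h : l = j
    · subst h; simp
    · rw [Function.update_of_ne h, Function.update_of_ne (fun e => h (Fin.castSucc_injective _ e))]

theorem update_last_snoc {C : Type*} (m : ℕ) (c x : C) :
    (Fin.snoc (fun _ => c) x : Fin (m + 1) → C) =
      Function.update (fun _ => c) (Fin.last m) x := by
  funext i
  refine Fin.lastCases ?_ (fun l => ?_) i
  · simp
  · rw [Fin.snoc_castSucc, Function.update_of_ne (Fin.castSucc_lt_last l).ne]

/-- Units after position i contribute 1. When i is the last position, the preceding factors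
contribute ν ∘ S on the legs of R₁, by `anti_momentPow`. -/
theorem combinePow_update {ν : H →ₗ[k] B} [IsHom ν] {X : HModAlg k H A}
    {f : A →ₗ[k] B} (hX : X.IsModuleAlgebra) (hf : IsAdjointMorphism X ν f) (m : ℕ) (i : Fin m)
    (x : A) :
    combinePow R ν X f m (PiTensorProduct.tprod k (Function.update (fun _ => X.one) i x)) =
      ∑ r, legs (anti ν) m i.1 i.isLt.le
        (Function.update (fun _ => 1) i (f (X.act (R.snd r) x))) (R.fst r) := by
  induction m with
  | zero => exact i.elim0
  | succ m ih =>
    simp only [combinePow, LinearMap.comp_apply, LinearEquiv.coe_coe, AlgHom.toLinearMap_apply,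
      AlgEquiv.toAlgHom_apply]
    refine Fin.lastCases ?_ (fun j => ?_) i
    · rw [← update_last_snoc, ← snocEquiv_tprod_tmul, LinearEquiv.symm_apply_apply, combine_tmul,
        map_sum]
      refine Finset.sum_congr rfl fun r _ => ?_
      have h1 : combinePow R ν X f m (PiTensorProduct.tprod k fun _ => X.one) = 1 :=
        (combinePow_isAdjointMorphism R hX hf m).1.2
      rw [h1, one_mul, anti_momentPow]
      exact allLegs_snoc _ _ _ _ _
    · rw [← update_const_snoc, ← snocEquiv_tprod_tmul, LinearEquiv.symm_apply_apply,
        combine_tmul_one R hX hf, ih, TensorProduct.sum_tmul, map_sum]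
      refine Finset.sum_congr rfl fun r _ => ?_
      rw [snocAlgEquiv_apply, legs_snoc, update_const_snoc]
      rfl

end TensorPower

/-! ## Operators on tensor products and intertwiners -/

section Intertwiners

variable {k : Type*} [Field k] {H : Type*} [Ring H] [HopfAlgebra k H] (R : RMatrix k H)

local infixr:75 " ⊛ " => conv

section

variable {E E' : Type*} [Ring E] [Algebra k E] [Ring E'] [Algebra k E']

theorem comp_conv (φ : E →ₐ[k] E') (f g : H →ₗ[k] E) :
    φ.toLinearMap ∘ₗ (f ⊛ g) = (φ.toLinearMap ∘ₗ f) ⊛ (φ.toLinearMap ∘ₗ g) := by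
  ext h
  rw [LinearMap.comp_apply, conv_apply _ _ (Coalgebra.Repr.arbitrary k h),
    conv_apply _ _ (Coalgebra.Repr.arbitrary k h)]
  simp

theorem RMatrix.map_el (φ : E →ₐ[k] E') (f g : H →ₗ[k] E) :
    φ (R.el f g) = R.el (φ.toLinearMap ∘ₗ f) (φ.toLinearMap ∘ₗ g) := by
  simp [RMatrix.el]

end

variable {M N P : Type*} [AddCommGroup M] [Module k M] [AddCommGroup N] [Module k N]
  [AddCommGroup P] [Module k P]

/-- The linear map `T` intertwines `f` and `g`: `T ∘ f(h) = g(h) ∘ T` for all `h`. -/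
def Intertwines (T : M →ₗ[k] N) (f : H →ₗ[k] Module.End k M) (g : H →ₗ[k] Module.End k N) : Prop :=
  ∀ h x, T (f h x) = g h (T x)

namespace Intertwines

variable {T : M →ₗ[k] N} {f p q : H →ₗ[k] Module.End k M} {f' p' q' : H →ₗ[k] Module.End k N}

theorem of_comp (h : ∀ x, T ∘ₗ f x = f' x ∘ₗ T) : Intertwines T f f' :=
  fun x => LinearMap.congr_fun (h x)

theorem conv (hf : Intertwines T f f') (hp : Intertwines T p p') :
    Intertwines T (f ⊛ p) (f' ⊛ p') := by
  intro h x
  rw [conv_apply _ _ (Coalgebra.Repr.arbitrary k h), conv_apply _ _ (Coalgebra.Repr.arbitrary k h)]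
  simp [LinearMap.sum_apply, hf _ _, hp _ _]

theorem anti (hf : Intertwines T f f') : Intertwines T (anti f) (anti f') := fun _ => hf _

theorem el (hf : Intertwines T f f') (hp : Intertwines T p p') (x : M) :
    T (R.el f p x) = R.el f' p' (T x) := by
  simp [RMatrix.el, LinearMap.sum_apply, hf _ _, hp _ _]

theorem inv (hf : Intertwines T f f') (hp : Intertwines T p p') (x : M) :
    T (R.inv f p x) = R.inv f' p' (T x) := hf.anti.el R hp x

theorem repOp (hf : Intertwines T f f') (hp : Intertwines T p p') (hq : Intertwines T q q')
    (x : M) : T (R.repOp f p q x) = R.repOp f' p' q' (T x) := by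
  rw [RMatrix.repOp, Module.End.mul_apply, hp.inv R (hf.conv hq), hq.el R hf]
  rfl

theorem exchange {s : H →ₗ[k] Module.End k M} {s' : H →ₗ[k] Module.End k N}
    (hf : Intertwines T f f') (hp : Intertwines T p p') (hq : Intertwines T q q')
    (hs : Intertwines T s s') (x : M) :
    T (R.exchange f p q s x) = R.exchange f' p' q' s' (T x) := by
  simp only [RMatrix.exchange, RMatrix.partialExchange, Module.End.mul_apply]
  rw [hs.inv R hf, hf.el R hq, hp.el R (hq.conv hs)]

theorem comp {U : N →ₗ[k] P} {f'' : H →ₗ[k] Module.End k P} (hU : Intertwines U f' f'')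
    (hT : Intertwines T f f') : Intertwines (U ∘ₗ T) f f'' := by
  intro h x
  simp [hT h x, hU h _]

end Intertwines

variable (N) in
/-- The operators `f(h) ⊗ id` on `M ⊗ N`. -/
def onLeft (f : H →ₗ[k] Module.End k M) : H →ₗ[k] Module.End k (M ⊗[k] N) :=
  (Module.End.rTensorAlgHom k M N).toLinearMap ∘ₗ f

variable (M) in
/-- The operators `id ⊗ f(h)` on `M ⊗ N`. -/
def onRight (f : H →ₗ[k] Module.End k N) : H →ₗ[k] Module.End k (M ⊗[k] N) :=
  (Module.End.lTensorAlgHom k N M).toLinearMap ∘ₗ f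

@[simp]
theorem onLeft_tmul (f : H →ₗ[k] Module.End k M) (h : H) (x : M) (y : N) :
    onLeft N f h (x ⊗ₜ y) = f h x ⊗ₜ y := rfl

@[simp]
theorem onRight_tmul (f : H →ₗ[k] Module.End k N) (h : H) (x : M) (y : N) :
    onRight M f h (x ⊗ₜ y) = x ⊗ₜ f h y := rfl

instance (f : H →ₗ[k] Module.End k M) [IsHom f] : IsHom (onLeft N f) := IsHom.comp _ _

instance (f : H →ₗ[k] Module.End k N) [IsHom f] : IsHom (onRight M f) := IsHom.comp _ _

instance (f g : H →ₗ[k] Module.End k M) [h : Commuting f g] :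
    Commuting (onLeft N f) (onLeft N g) :=
  ⟨fun a b => by
    simp only [onLeft, LinearMap.comp_apply, AlgHom.toLinearMap_apply, ← map_mul, h.comm]⟩

instance (f g : H →ₗ[k] Module.End k N) [h : Commuting f g] :
    Commuting (onRight M f) (onRight M g) :=
  ⟨fun a b => by
    simp only [onRight, LinearMap.comp_apply, AlgHom.toLinearMap_apply, ← map_mul, h.comm]⟩

instance (f : H →ₗ[k] Module.End k M) (g : H →ₗ[k] Module.End k N) :
    Commuting (onLeft N f) (onRight M g) :=
  ⟨fun a b => by ext; simp⟩

theorem onLeft_conv (f g : H →ₗ[k] Module.End k M) :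
    onLeft N (f ⊛ g) = onLeft N f ⊛ onLeft N g := comp_conv _ _ _

theorem onRight_conv (f g : H →ₗ[k] Module.End k N) :
    onRight M (f ⊛ g) = onRight M f ⊛ onRight M g := comp_conv _ _ _

theorem Intertwines.rTensor {T : M →ₗ[k] N} {f : H →ₗ[k] Module.End k M}
    {f' : H →ₗ[k] Module.End k N} (hT : Intertwines T f f') :
    Intertwines (LinearMap.rTensor P T) (onLeft P f) (onLeft P f') :=
  .of_comp fun h => by ext; simp [hT _ _]

theorem Intertwines.lTensor {T : M →ₗ[k] N} {f : H →ₗ[k] Module.End k M}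
    {f' : H →ₗ[k] Module.End k N} (hT : Intertwines T f f') :
    Intertwines (LinearMap.lTensor P T) (onRight P f) (onRight P f') :=
  .of_comp fun h => by ext; simp [hT _ _]

theorem intertwines_rTensor_onRight (T : M →ₗ[k] N) (f : H →ₗ[k] Module.End k P) :
    Intertwines (LinearMap.rTensor P T) (onRight M f) (onRight N f) :=
  .of_comp fun h => by ext; simp

theorem intertwines_lTensor_onLeft (T : M →ₗ[k] N) (f : H →ₗ[k] Module.End k P) :
    Intertwines (LinearMap.lTensor P T) (onLeft M f) (onLeft N f) :=
  .of_comp fun h => by ext; simp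

theorem intertwines_mk (x : M) (f : H →ₗ[k] Module.End k N) :
    Intertwines (TensorProduct.mk k M N x) f (onRight M f) := fun _ _ => rfl

theorem intertwines_mk_flip (y : N) (f : H →ₗ[k] Module.End k M) :
    Intertwines ((TensorProduct.mk k M N).flip y) f (onLeft N f) := fun _ _ => rfl

theorem intertwines_assoc_symm_left (f : H →ₗ[k] Module.End k M) :
    Intertwines (TensorProduct.assoc k M N P).symm.toLinearMap (onLeft (N ⊗[k] P) f)
      (onLeft P (onLeft N f)) :=
  .of_comp fun h => by ext; simp

theorem intertwines_assoc_symm_middle (f : H →ₗ[k] Module.End k N) :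
    Intertwines (TensorProduct.assoc k M N P).symm.toLinearMap (onRight M (onLeft P f))
      (onLeft P (onRight M f)) :=
  .of_comp fun h => by ext; simp

theorem intertwines_assoc_symm_right (f : H →ₗ[k] Module.End k P) :
    Intertwines (TensorProduct.assoc k M N P).symm.toLinearMap (onRight M (onRight N f))
      (onRight (M ⊗[k] N) f) :=
  .of_comp fun h => by ext; simp

theorem tensorAct_eq_conv (f : H →ₗ[k] Module.End k M) (g : H →ₗ[k] Module.End k N) (h : H)
    (x : M ⊗[k] N) : tensorAct f g h x = (onLeft N f ⊛ onRight M g) h x := by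
  induction x with
  | zero => simp
  | add x y hx hy => simp only [map_add, hx, hy]
  | tmul x y =>
    rw [conv_apply _ _ (Coalgebra.Repr.arbitrary k h), tensorAct_tmul,
      ← (Coalgebra.Repr.arbitrary k h).eq]
    simp [LinearMap.sum_apply]

theorem tensorAct_anti (f : H →ₗ[k] Module.End k M) (g : H →ₗ[k] Module.End k N) (h : H)
    (x : M ⊗[k] N) :
    tensorAct (anti f) (anti g) h x = anti (onRight M g ⊛ onLeft N f) h x := by
  rw [tensorAct_eq_conv, anti_conv_eq]
  rfl

end Intertwiners

/-! ## Module-algebras with two commuting actions -/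

section Coregular

variable {k : Type*} [Field k] {H : Type*} [Ring H] [HopfAlgebra k H] (R : RMatrix k H)
variable {V : Type*} [AddCommGroup V] [Module k V]

local infixr:75 " ⊛ " => conv

instance Commuting.convUnit_left {E : Type*} [Ring E] [Algebra k E] (f : H →ₗ[k] E) :
    Commuting convUnit f := ⟨fun _ _ => Algebra.commutes _ _⟩

theorem RMatrix.inv_convUnit_left {E : Type*} [Ring E] [Algebra k E] (f : H →ₗ[k] E) [IsHom f] :
    R.inv convUnit f = 1 := by
  have := R.inv_mul_el convUnit f
  rwa [R.el_convUnit_left, mul_one] at this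

theorem RMatrix.inv_convUnit_right {E : Type*} [Ring E] [Algebra k E] (f : H →ₗ[k] E) [IsHom f] :
    R.inv f convUnit = 1 := by
  have := R.inv_mul_el f convUnit
  rwa [R.el_convUnit_right, mul_one] at this

/-- The product `μ` with unit `e` is associative and unital, and it is compatible with the actions
`L` and `Y` of `H`, the latter with respect to the opposite coproduct. -/
structure IsCoregular (L Y : H →ₗ[k] Module.End k V) (μ : V →ₗ[k] V →ₗ[k] V) (e : V) : Prop where
  assoc : ∀ x y z, μ (μ x y) z = μ x (μ y z)
  one_mul : ∀ x, μ e x = x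
  mul_one : ∀ x, μ x e = x
  left_mul : Intertwines (TensorProduct.lift μ) (onLeft V L ⊛ onRight V L) L
  right_mul : Intertwines (TensorProduct.lift μ) (onRight V Y ⊛ onLeft V Y) Y
  left_one : ∀ h, L h e = (Coalgebra.counit h : k) • e
  right_one : ∀ h, Y h e = (Coalgebra.counit h : k) • e

/-- The product of `L₀,₁(H)`, in terms of the translations `L`, `Y` and the product `μ`. -/
def braidedProduct (L Y : H →ₗ[k] Module.End k V) (μ : V →ₗ[k] V →ₗ[k] V) : V →ₗ[k] V →ₗ[k] V :=
  TensorProduct.curry (TensorProduct.lift μ ∘ₗ R.el (onRight V L ⊛ onRight V Y) (onLeft V L))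

theorem braidedProduct_apply (L Y : H →ₗ[k] Module.End k V) (μ : V →ₗ[k] V →ₗ[k] V) (x y : V) :
    braidedProduct R L Y μ x y = TensorProduct.lift μ
      (R.el (onRight V L ⊛ onRight V Y) (onLeft V L) (x ⊗ₜ y)) := rfl

/-- The structure maps of `L₀,₁(H)`, in terms of the translations `L`, `Y`, the product `μ` and its
unit `e`. -/
def braidedAlgebra (L Y : H →ₗ[k] Module.End k V) (μ : V →ₗ[k] V →ₗ[k] V) (e : V) :
    HModAlg k H V where
  mul := braidedProduct R L Y μ
  one := e
  act := anti (L ⊛ Y)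

variable {L Y : H →ₗ[k] Module.End k V} [IsHom L] [IsHom Y] [Commuting L Y]
  {μ : V →ₗ[k] V →ₗ[k] V} {e : V}

theorem IsCoregular.left_one' (hV : IsCoregular L Y μ e) :
    Intertwines (LinearMap.toSpanSingleton k V e) convUnit L := by
  intro h c
  simp [convUnit, hV.left_one, smul_smul, mul_comm]

theorem IsCoregular.right_one' (hV : IsCoregular L Y μ e) :
    Intertwines (LinearMap.toSpanSingleton k V e) convUnit Y := by
  intro h c
  simp [convUnit, hV.right_one, smul_smul, mul_comm]

theorem intertwines_mk_counit {M : Type*} [AddCommGroup M] [Module k M]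
    {f : H →ₗ[k] Module.End k V} (hf : ∀ h, f h e = (Coalgebra.counit h : k) • e) :
    Intertwines (TensorProduct.mk k V M e) convUnit (onLeft M f) := by
  intro h x
  simp [convUnit, hf, ← TensorProduct.smul_tmul']

theorem intertwines_mk_flip_counit {M : Type*} [AddCommGroup M] [Module k M]
    {f : H →ₗ[k] Module.End k V} (hf : ∀ h, f h e = (Coalgebra.counit h : k) • e) :
    Intertwines ((TensorProduct.mk k M V).flip e) convUnit (onRight M f) := by
  intro h x
  simp [convUnit, hf]

/-- The operator `x ⊗ (y ⊗ z) ↦ μ(x, y) ⊗ z`. -/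
def mulFirst (μ : V →ₗ[k] V →ₗ[k] V) : V ⊗[k] (V ⊗[k] V) →ₗ[k] V ⊗[k] V :=
  LinearMap.rTensor V (TensorProduct.lift μ) ∘ₗ (TensorProduct.assoc k V V V).symm.toLinearMap

/-- The operator `x ⊗ (y ⊗ z) ↦ x ⊗ μ(y, z)`. -/
def mulLast (μ : V →ₗ[k] V →ₗ[k] V) : V ⊗[k] (V ⊗[k] V) →ₗ[k] V ⊗[k] V :=
  LinearMap.lTensor V (TensorProduct.lift μ)

/-- The operator `x ⊗ y ↦ x ⊗ (y ⊗ z)`. -/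
def insertLast (z : V) : V ⊗[k] V →ₗ[k] V ⊗[k] (V ⊗[k] V) :=
  LinearMap.lTensor V ((TensorProduct.mk k V V).flip z)

/-- The operator `x ⊗ z ↦ x ⊗ (y ⊗ z)`. -/
def insertMiddle (y : V) : V ⊗[k] V →ₗ[k] V ⊗[k] (V ⊗[k] V) :=
  LinearMap.lTensor V (TensorProduct.mk k V V y)

section Slots

variable (f g : H →ₗ[k] Module.End k V)

theorem insertLast_left (z : V) :
    Intertwines (insertLast z) (onLeft V f) (onLeft (V ⊗[k] V) f) :=
  intertwines_lTensor_onLeft _ _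

theorem insertLast_right (z : V) :
    Intertwines (insertLast z) (onRight V f) (onRight V (onLeft V f)) :=
  (intertwines_mk_flip z f).lTensor

theorem insertMiddle_left (z : V) :
    Intertwines (insertMiddle z) (onLeft V f) (onLeft (V ⊗[k] V) f) :=
  intertwines_lTensor_onLeft _ _

theorem insertMiddle_right (z : V) :
    Intertwines (insertMiddle z) (onRight V f) (onRight V (onRight V f)) :=
  (intertwines_mk z f).lTensor

theorem mulFirst_right :
    Intertwines (mulFirst μ) (onRight V (onRight V f)) (onRight V f) :=
  (intertwines_rTensor_onRight _ f).comp (intertwines_assoc_symm_right f)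

theorem mulLast_left : Intertwines (mulLast μ) (onLeft (V ⊗[k] V) f) (onLeft V f) :=
  intertwines_lTensor_onLeft _ _

end Slots

/-- An iterated product is expressed by operators on three slots, so that the operator identities
proved in an arbitrary algebra apply. -/
theorem braidedProduct_tmul (x y z : V) :
    braidedProduct R L Y μ x y ⊗ₜ[k] z = mulFirst μ
      (R.el (onRight V (onLeft V L) ⊛ onRight V (onLeft V Y)) (onLeft (V ⊗[k] V) L)
        (x ⊗ₜ (y ⊗ₜ z))) := by
  have h := ((insertLast_right L z).conv (insertLast_right Y z)).el R (insertLast_left L z)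
    (x ⊗ₜ y)
  have h2 : insertLast z (x ⊗ₜ[k] y) = x ⊗ₜ (y ⊗ₜ z) := rfl
  rw [h2] at h
  rw [← h, braidedProduct_apply]
  generalize R.el (onRight V L ⊛ onRight V Y) (onLeft V L) (x ⊗ₜ[k] y) = w
  induction w with
  | zero => simp
  | add a b ha hb => simp only [map_add, TensorProduct.add_tmul, ha, hb]
  | tmul a b => rfl

theorem tmul_braidedProduct (x y z : V) :
    x ⊗ₜ[k] braidedProduct R L Y μ y z = mulLast μ
      (R.el (onRight V (onRight V L) ⊛ onRight V (onRight V Y)) (onRight V (onLeft V L))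
        (x ⊗ₜ (y ⊗ₜ z))) := by
  have h := ((intertwines_mk x (onRight V L)).conv (intertwines_mk x (onRight V Y))).el R
    (intertwines_mk x (onLeft V L)) (y ⊗ₜ z)
  rw [TensorProduct.mk_apply, TensorProduct.mk_apply] at h
  rw [← h, braidedProduct_apply]
  rfl

namespace IsCoregular

theorem mulFirst_left (hV : IsCoregular L Y μ e) :
    Intertwines (mulFirst μ) (onLeft (V ⊗[k] V) L ⊛ onRight V (onLeft V L)) (onLeft V L) := by
  have := hV.left_mul.rTensor (P := V)
  rw [onLeft_conv] at this
  exact this.comp ((intertwines_assoc_symm_left L).conv (intertwines_assoc_symm_middle L))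

theorem mulFirst_left' (hV : IsCoregular L Y μ e) :
    Intertwines (mulFirst μ) (onRight V (onLeft V Y) ⊛ onLeft (V ⊗[k] V) Y) (onLeft V Y) := by
  have := hV.right_mul.rTensor (P := V)
  rw [onLeft_conv] at this
  exact this.comp ((intertwines_assoc_symm_middle Y).conv (intertwines_assoc_symm_left Y))

theorem mulLast_right (hV : IsCoregular L Y μ e) :
    Intertwines (mulLast μ) (onRight V (onLeft V L) ⊛ onRight V (onRight V L)) (onRight V L) := by
  have := hV.left_mul.lTensor (P := V)
  rwa [onRight_conv] at this

theorem mulLast_right' (hV : IsCoregular L Y μ e) :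
    Intertwines (mulLast μ) (onRight V (onRight V Y) ⊛ onRight V (onLeft V Y)) (onRight V Y) := by
  have := hV.right_mul.lTensor (P := V)
  rwa [onRight_conv] at this

theorem lift_mulFirst (hV : IsCoregular L Y μ e) (w : V ⊗[k] (V ⊗[k] V)) :
    TensorProduct.lift μ (mulFirst μ w) = TensorProduct.lift μ (mulLast μ w) := by
  have : TensorProduct.lift μ ∘ₗ mulFirst μ = TensorProduct.lift μ ∘ₗ mulLast μ := by
    ext x y z
    simp [mulFirst, mulLast, hV.assoc]
  exact LinearMap.congr_fun this w

/-- The compatibility of μ with the translations moves all images of R in front of μ. Associativity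
of μ then leaves `product_assoc`, and the action on products leaves `product_equivariant`. The unit
turns its slot into the counit, where the images of R are 1. -/
theorem isModuleAlgebra (hV : IsCoregular L Y μ e) :
    (braidedAlgebra R L Y μ e).IsModuleAlgebra where
  mul_assoc x y z := by
    simp only [braidedAlgebra]
    rw [braidedProduct_apply, braidedProduct_tmul,
      ← ((mulFirst_right L).conv (mulFirst_right Y)).el R hV.mulFirst_left, hV.lift_mulFirst,
      ← Module.End.mul_apply, R.product_assoc,
      Module.End.mul_apply, (hV.mulLast_right.conv hV.mulLast_right').el R (mulLast_left L),
      ← tmul_braidedProduct, ← braidedProduct_apply]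
  one_mul x := by
    simp only [braidedAlgebra]
    rw [braidedProduct_apply, ← TensorProduct.mk_apply, ← ((intertwines_mk e L).conv
      (intertwines_mk e Y)).el R (intertwines_mk_counit hV.left_one), R.el_convUnit_right]
    exact hV.one_mul x
  mul_one x := by
    simp only [braidedAlgebra]
    have h : x ⊗ₜ[k] e = (TensorProduct.mk k V V).flip e x := rfl
    rw [braidedProduct_apply, h, ← ((intertwines_mk_flip_counit hV.left_one).conv
      (intertwines_mk_flip_counit hV.right_one)).el R (intertwines_mk_flip e L), convUnit_conv,
      R.el_convUnit_left]
    exact hV.mul_one x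
  act_one x := by
    simp [braidedAlgebra, anti_apply, IsHom.map_one (f := L ⊛ Y)]
  act_mul h h' x := by
    simp [braidedAlgebra, anti_apply, IsHom.map_mul (f := L ⊛ Y),
      HopfAlgebra.antipode_mul_antidistrib]
  mul_act h x y := by
    have e1 : TensorProduct.lift (braidedProduct R L Y μ) =
        TensorProduct.lift μ ∘ₗ R.el (onRight V L ⊛ onRight V Y) (onLeft V L) := by
      ext; rfl
    simp only [braidedAlgebra]
    rw [e1, tensorAct_anti, braidedProduct_apply, onLeft_conv, onRight_conv, anti_apply,
      anti_apply, LinearMap.comp_apply, ← Module.End.mul_apply (R.el _ _),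
      ← R.product_equivariant, Module.End.mul_apply]
    exact ((hV.left_mul.conv hV.right_mul) _ _).symm
  one_act h := by
    have := (hV.left_one'.conv hV.right_one') (HopfAlgebra.antipode k h) 1
    rw [convUnit_conv, LinearMap.toSpanSingleton_apply, LinearMap.toSpanSingleton_apply,
      one_smul] at this
    simp only [braidedAlgebra, anti_apply]
    rw [← this]
    simp [convUnit]

end IsCoregular

/-- The exchange operator of `L₁,₀(H)`. -/
def exchangeOp (L Y : H →ₗ[k] Module.End k V) : Module.End k (V ⊗[k] V) :=
  R.exchange (onLeft V L) (onLeft V Y) (onRight V L) (onRight V Y)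

/-- The hexagons of the criterion are `exchange_product_left` and `exchange_product_right`, read on
V ⊗ (V ⊗ V). The auxiliary `h12`, `h13`, `h23` identify the exchange of two slots with the exchange
on V ⊗ V. Equivariance is `exchange_mul`, evaluated at S(h). -/
theorem IsCoregular.twisted_isModuleAlgebra (hV : IsCoregular L Y μ e) {ι : Type*} [Fintype ι]
    (f g : ι → V →ₗ[k] V) {τ : V ⊗[k] V →ₗ[k] V ⊗[k] V}
    (hτ : ∀ x y, τ (y ⊗ₜ x) = exchangeOp R L Y (x ⊗ₜ y))
    (hfg : ∀ x y, exchangeOp R L Y (x ⊗ₜ y) = ∑ i, f i x ⊗ₜ[k] g i y) :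
    (twisted (braidedAlgebra R L Y μ e) (braidedAlgebra R L Y μ e) τ).IsModuleAlgebra := by
  have h12 : ∀ w z, R.exchange (onLeft (V ⊗[k] V) L) (onLeft (V ⊗[k] V) Y)
      (onRight V (onLeft V L)) (onRight V (onLeft V Y)) (insertLast z w) =
      insertLast z (exchangeOp R L Y w) := fun w z =>
    ((insertLast_left L z).exchange R (insertLast_left Y z) (insertLast_right L z)
      (insertLast_right Y z) w).symm
  have h13 : ∀ w z, R.exchange (onLeft (V ⊗[k] V) L) (onLeft (V ⊗[k] V) Y)
      (onRight V (onRight V L)) (onRight V (onRight V Y)) (insertMiddle z w) =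
      insertMiddle z (exchangeOp R L Y w) := fun w z =>
    ((insertMiddle_left L z).exchange R (insertMiddle_left Y z) (insertMiddle_right L z)
      (insertMiddle_right Y z) w).symm
  have h23 : ∀ w z, R.exchange (onRight V (onLeft V L)) (onRight V (onLeft V Y))
      (onRight V (onRight V L)) (onRight V (onRight V Y)) (TensorProduct.mk k V (V ⊗[k] V) z w) =
      TensorProduct.mk k V (V ⊗[k] V) z (exchangeOp R L Y w) := fun w z =>
    ((intertwines_mk z _).exchange R (intertwines_mk z _) (intertwines_mk z _)
      (intertwines_mk z _) w).symm
  refine QuantumModuli.twisted_isModuleAlgebra (hV.isModuleAlgebra R) (hV.isModuleAlgebra R) f g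
    (fun a b => by rw [hτ, hfg]) (fun a a' b => ?_) (fun a b b' => ?_) (fun b => ?_) (fun a => ?_)
    (fun h a b => ?_)
  · rw [← hfg]
    change exchangeOp R L Y (braidedProduct R L Y μ a a' ⊗ₜ[k] b) = _
    rw [braidedProduct_tmul, exchangeOp,
      ← hV.mulFirst_left.exchange R hV.mulFirst_left' (mulFirst_right L) (mulFirst_right Y),
      ← Module.End.mul_apply, R.exchange_product_left, Module.End.mul_apply, Module.End.mul_apply]
    have e1 : a ⊗ₜ[k] (a' ⊗ₜ[k] b) = insertMiddle a' (a ⊗ₜ b) := rfl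
    have e2 : ∀ x y, insertMiddle a' (x ⊗ₜ[k] y) =
      TensorProduct.mk k V (V ⊗[k] V) x (a' ⊗ₜ y) := fun x y => rfl
    rw [e1, h13, hfg]
    simp only [map_sum, e2, h23, hfg]
    simp only [TensorProduct.mk_apply, ← braidedProduct_tmul]
    rfl
  · rw [← hfg]
    change exchangeOp R L Y (a ⊗ₜ[k] braidedProduct R L Y μ b b') = _
    rw [tmul_braidedProduct, exchangeOp,
      ← (mulLast_left L).exchange R (mulLast_left Y) hV.mulLast_right hV.mulLast_right',
      ← Module.End.mul_apply, R.exchange_product_right, Module.End.mul_apply, Module.End.mul_apply]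
    have e1 : a ⊗ₜ[k] (b ⊗ₜ[k] b') = insertMiddle b (a ⊗ₜ b') := rfl
    have e2 : ∀ x y, insertMiddle b (x ⊗ₜ[k] y) = insertLast y (x ⊗ₜ b) := fun x y => rfl
    have e3 : ∀ x y z : V, insertLast z (x ⊗ₜ[k] y) = x ⊗ₜ[k] (y ⊗ₜ[k] z) := fun x y z => rfl
    rw [e1, h13, hfg]
    simp only [map_sum, e2, h12, hfg]
    simp only [e3, ← tmul_braidedProduct]
    rfl
  · rw [← hfg]
    change exchangeOp R L Y (TensorProduct.mk k V V e b) = _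
    rw [exchangeOp, ← (intertwines_mk_counit hV.left_one).exchange R
      (intertwines_mk_counit hV.right_one) (intertwines_mk e L) (intertwines_mk e Y),
      RMatrix.exchange, RMatrix.partialExchange, R.el_convUnit_left, R.el_convUnit_left,
      R.inv_convUnit_right]
    rfl
  · rw [← hfg]
    change exchangeOp R L Y ((TensorProduct.mk k V V).flip e a) = _
    rw [exchangeOp, ← (intertwines_mk_flip e L).exchange R
      (intertwines_mk_flip e Y) (intertwines_mk_flip_counit hV.left_one)
      (intertwines_mk_flip_counit hV.right_one),
      RMatrix.exchange, RMatrix.partialExchange, R.el_convUnit_right, convUnit_conv,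
      R.el_convUnit_right, R.inv_convUnit_left]
    rfl
  · have e1 : ∀ w, τ w = exchangeOp R L Y (TensorProduct.comm k V V w) := by
      have : τ = exchangeOp R L Y ∘ₗ (TensorProduct.comm k V V).toLinearMap := by
        ext; simp [hτ]
      exact LinearMap.congr_fun this
    have e2 : Intertwines (TensorProduct.comm k V V).toLinearMap (onRight V (L ⊛ Y))
        (onLeft V (L ⊛ Y)) := .of_comp fun h => by ext; simp
    have e3 : Intertwines (TensorProduct.comm k V V).toLinearMap (onLeft V (L ⊛ Y))
        (onRight V (L ⊛ Y)) := .of_comp fun h => by ext; simp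
    change tensorAct (anti (L ⊛ Y)) (anti (L ⊛ Y)) h _ =
      τ (tensorAct (anti (L ⊛ Y)) (anti (L ⊛ Y)) h _)
    rw [tensorAct_anti, tensorAct_anti, hτ, e1, anti_apply]
    refine Eq.trans ?_ (congrArg _ (e2.conv e3 _ _).symm)
    rw [onLeft_conv, onRight_conv, exchangeOp, ← Module.End.mul_apply, ← R.exchange_mul]
    rfl

/-- The representation of `L₀,₁(H)` which restricts that of `L₁,₀(H)`, in terms of the translations
`L`, `Y` and the product `μ`. -/
def braidedRep (L Y : H →ₗ[k] Module.End k V) (μ : V →ₗ[k] V →ₗ[k] V) : V →ₗ[k] Module.End k V :=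
  TensorProduct.curry
    (TensorProduct.lift μ ∘ₗ R.repOp (onLeft V L) (onLeft V Y) (onRight V L))

theorem braidedRep_apply (L Y : H →ₗ[k] Module.End k V) (μ : V →ₗ[k] V →ₗ[k] V) (x y : V) :
    braidedRep R L Y μ x y = TensorProduct.lift μ
      (R.repOp (onLeft V L) (onLeft V Y) (onRight V L) (x ⊗ₜ y)) := rfl

theorem tmul_braidedRep (x y z : V) :
    x ⊗ₜ[k] braidedRep R L Y μ y z = mulLast μ
      (R.repOp (onRight V (onLeft V L)) (onRight V (onLeft V Y)) (onRight V (onRight V L))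
        (x ⊗ₜ (y ⊗ₜ z))) := by
  have h := (intertwines_mk x (onLeft V L)).repOp R (intertwines_mk x (onLeft V Y))
    (intertwines_mk x (onRight V L)) (y ⊗ₜ z)
  rw [TensorProduct.mk_apply, TensorProduct.mk_apply] at h
  rw [← h, braidedRep_apply]
  rfl

theorem IsCoregular.braidedRep_mul (hV : IsCoregular L Y μ e) (x y : V) :
    braidedRep R L Y μ (braidedProduct R L Y μ x y) =
      braidedRep R L Y μ x * braidedRep R L Y μ y := by
  ext z
  rw [braidedRep_apply, braidedProduct_tmul,
    ← hV.mulFirst_left.repOp R hV.mulFirst_left' (mulFirst_right L), ← Module.End.mul_apply,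
    R.repOp_product, hV.lift_mulFirst, Module.End.mul_apply,
    (mulLast_left L).repOp R (mulLast_left Y) hV.mulLast_right, ← tmul_braidedRep,
    ← braidedRep_apply, Module.End.mul_apply]

theorem IsCoregular.braidedRep_one (hV : IsCoregular L Y μ e) : braidedRep R L Y μ e = 1 := by
  ext x
  rw [braidedRep_apply, ← TensorProduct.mk_apply,
    ← (intertwines_mk_counit hV.left_one).repOp R (intertwines_mk_counit hV.right_one)
      (intertwines_mk e L), RMatrix.repOp, R.inv_convUnit_left, R.el_convUnit_right]
  exact hV.one_mul x

/-- By `conv_mul_repOp`, an operator (Y ⊛ L)(a) applied after the representation acts diagonally on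
the form and the vector. In the adjoint action its part on the vector is cancelled by the factor on
the right, and only the coadjoint action on the form remains. -/
theorem IsCoregular.braidedRep_act (hV : IsCoregular L Y μ e) (h : H) (x : V) :
    braidedRep R L Y μ (anti (L ⊛ Y) h x) = adjointAct (Y ⊛ L) h (braidedRep R L Y μ x) := by
  have key : ∀ a w, (Y ⊛ L) a (TensorProduct.lift μ
      (R.repOp (onLeft V L) (onLeft V Y) (onRight V L) w)) = TensorProduct.lift μ
      (R.repOp (onLeft V L) (onLeft V Y) (onRight V L)
        ((onRight V (Y ⊛ L) ⊛ onLeft V (L ⊛ Y)) a w)) := by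
    intro a w
    rw [← (hV.right_mul.conv hV.left_mul) a, ← Module.End.mul_apply, R.conv_mul_repOp, onLeft_conv,
      onRight_conv]
    rfl
  ext z
  rw [adjointAct_repr _ _ (Coalgebra.Repr.arbitrary k h)]
  simp only [LinearMap.sum_apply, Module.End.mul_apply, braidedRep_apply, key, ← map_sum]
  have e1 : anti (onRight V (Y ⊛ L) ⊛ onLeft V (L ⊛ Y)) ⊛ onRight V (Y ⊛ L) =
      anti (onLeft V (L ⊛ Y)) := by
    rw [anti_conv_eq, conv_assoc, anti_conv, conv_convUnit]
  have e2 := LinearMap.congr_fun (LinearMap.congr_fun e1 h) (x ⊗ₜ[k] z)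
  rw [conv_apply _ _ (Coalgebra.Repr.arbitrary k h)] at e2
  simp only [LinearMap.sum_apply, Module.End.mul_apply, onRight_tmul, anti_apply,
    onLeft_tmul] at e2
  rw [e2]
  rfl

end Coregular

/-! ## The coregular actions on the restricted dual -/

section RestrictedDual

variable {k : Type u} [Field k] {H : Type v} [Ring H] [HopfAlgebra k H] (R : RMatrix k H)

local infixr:75 " ⊛ " => conv

instance restrictedDual.instAddCommGroup : AddCommGroup (restrictedDual k H) :=
  Submodule.addCommGroup (R := k) (M := Module.Dual k H) _

variable (k H) in
/-- The left coregular action, as a morphism to the algebra of endomorphisms of `H°`. -/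
def leftTrans : H →ₗ[k] Module.End k (restrictedDual k H) := lact

variable (hS : Function.Bijective (HopfAlgebra.antipode k : H →ₗ[k] H))

/-- The right coregular action, as a morphism `h ↦ (φ ↦ φ ◁ S⁻¹(h))` to the algebra of
endomorphisms of `H°`. -/
def rightTrans : H →ₗ[k] Module.End k (restrictedDual k H) := ract ∘ₗ antipodeInv hS

theorem leftTrans_apply (a : H) (φ : restrictedDual k H) (x : H) :
    (leftTrans k H a φ).1 x = φ.1 (x * a) := rfl

theorem ract_apply (a : H) (φ : restrictedDual k H) (x : H) : (ract a φ).1 x = φ.1 (a * x) := rfl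

theorem rightTrans_antipode (a : H) : rightTrans hS (HopfAlgebra.antipode k a) = ract a := by
  simp only [rightTrans, LinearMap.comp_apply, antipodeInv, LinearEquiv.coe_coe]
  congr 1
  exact (LinearEquiv.ofBijective _ hS).symm_apply_apply a

theorem anti_rightTrans : anti (rightTrans hS) = ract := by
  ext a : 1
  exact rightTrans_antipode hS a

theorem ract_mul (a b : H) (φ : restrictedDual k H) : ract (a * b) φ = ract b (ract a φ) := by
  ext x
  simp [ract_apply, mul_assoc]

instance : IsHom (leftTrans k H) where
  map_one := by ext φ x; simp [leftTrans_apply]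
  map_mul a b := by ext φ x; simp [leftTrans_apply, mul_assoc]

/-- The translations φ ↦ φ ◁ h reverse products, and S⁻¹ restores their order. Surjectivity of S
allows every argument to be written as S(a), so S⁻¹ never has to be computed with. -/
instance : IsHom (rightTrans hS) where
  map_one := by
    rw [← HopfAlgebra.antipode_one (R := k), rightTrans_antipode]
    ext φ x
    simp [ract_apply]
  map_mul a b := by
    obtain ⟨a, rfl⟩ := hS.2 a
    obtain ⟨b, rfl⟩ := hS.2 b
    rw [← HopfAlgebra.antipode_mul_antidistrib, rightTrans_antipode, rightTrans_antipode,
      rightTrans_antipode]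
    ext φ x
    simp [ract_mul]

instance : Commuting (leftTrans k H) (rightTrans hS) where
  comm a b := by
    obtain ⟨b, rfl⟩ := hS.2 b
    rw [rightTrans_antipode]
    ext φ x
    simp [leftTrans_apply, ract_apply, mul_assoc]

theorem star_apply (φ ψ : restrictedDual k H) (x : H) : (star φ ψ).1 x =
    LinearMap.mul' k k (TensorProduct.map φ.1 ψ.1 (Coalgebra.comul x)) := rfl

/-- The opposite coproduct in `right_mul` is due to S⁻¹: after substituting S(h) for h it becomes
the usual compatibility of ◁ with ⋆. -/
theorem isCoregular : IsCoregular (leftTrans k H) (rightTrans hS) star (eps k H) where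
  assoc φ ψ χ := Subtype.ext (conv_assoc φ.1 ψ.1 χ.1)
  one_mul φ := Subtype.ext (convUnit_conv φ.1)
  mul_one φ := Subtype.ext (conv_convUnit φ.1)
  left_mul := by
    refine .of_comp fun h => ?_
    ext φ ψ x
    simp only [TensorProduct.AlgebraTensorModule.curry_apply, TensorProduct.curry_apply,
      LinearMap.coe_restrictScalars, LinearMap.comp_apply, TensorProduct.lift.tmul,
      ← tensorAct_eq_conv]
    rw [tensorAct_tmul, leftTrans_apply, star_apply, Bialgebra.comul_mul]
    generalize (Coalgebra.comul h : H ⊗[k] H) = t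
    induction t with
    | zero => simp
    | add a b ha hb => simp only [mul_add, map_add, ha, hb, Submodule.coe_add, LinearMap.add_apply]
    | tmul a b =>
      simp only [TensorProduct.map_tmul, TensorProduct.lift.tmul, LinearMap.flip_apply,
        star_apply]
      generalize (Coalgebra.comul x : H ⊗[k] H) = s
      induction s with
      | zero => simp
      | add a b ha hb => simp only [add_mul, map_add, ha, hb]
      | tmul a b => simp [leftTrans_apply]
  right_mul := by
    refine .of_comp fun h => ?_
    obtain ⟨h, rfl⟩ := hS.2 h
    ext φ ψ x
    simp only [TensorProduct.AlgebraTensorModule.curry_apply, TensorProduct.curry_apply,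
      LinearMap.coe_restrictScalars, LinearMap.comp_apply, TensorProduct.lift.tmul,
      rightTrans_antipode]
    rw [← anti_apply, ← tensorAct_anti, tensorAct_tmul, anti_rightTrans, ract_apply, star_apply,
      Bialgebra.comul_mul]
    generalize (Coalgebra.comul h : H ⊗[k] H) = t
    induction t with
    | zero => simp
    | add a b ha hb => simp only [add_mul, map_add, ha, hb, Submodule.coe_add, LinearMap.add_apply]
    | tmul a b =>
      simp only [TensorProduct.map_tmul, TensorProduct.lift.tmul, LinearMap.flip_apply,
        star_apply]
      generalize (Coalgebra.comul x : H ⊗[k] H) = s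
      induction s with
      | zero => simp
      | add a b ha hb => simp only [mul_add, map_add, ha, hb]
      | tmul a b => simp [ract_apply]
  left_one h := by
    ext x
    simp [leftTrans_apply, eps, mul_comm]
  right_one h := by
    obtain ⟨h, rfl⟩ := hS.2 h
    rw [rightTrans_antipode]
    ext x
    simp [ract_apply, eps]

theorem coad_eq : coad = anti (leftTrans k H ⊛ rightTrans hS) := by
  rw [anti_conv_eq, anti_rightTrans]
  ext h : 1
  simp only [coad, conv, LinearMap.comp_apply]
  generalize (Coalgebra.comul h : H ⊗[k] H) = t
  induction t with
  | zero => simp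
  | add a b ha hb => simp only [map_add, ha, hb]
  | tmul a b =>
    ext φ x
    simp [ract_apply, anti, leftTrans, lact, mul_assoc]

theorem DAct_eq : DAct = anti (rightTrans hS ⊛ leftTrans k H) := by
  rw [anti_conv_eq, anti_rightTrans]
  ext h : 1
  simp only [DAct, conv, LinearMap.comp_apply]
  generalize (Coalgebra.comul h : H ⊗[k] H) = t
  induction t with
  | zero => simp
  | add a b ha hb => simp only [map_add, ha, hb]
  | tmul a b => rfl

theorem RMatrix.el_apply {M : Type*} [AddCommGroup M] [Module k M]
    (f g : H →ₗ[k] Module.End k M) (x : M) :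
    R.el f g x = ∑ i, f (R.fst i) (g (R.snd i) x) := by
  simp [RMatrix.el, LinearMap.sum_apply]

/-- The hexagon splits the operator of the product into two images of R. In the one with right
translations, (S ⊗ S)(R) = R removes S⁻¹ from the first leg and puts S on the second, as in the
definition of the product. -/
theorem L01_eq : L01 R = braidedAlgebra R (leftTrans k H) (rightTrans hS) star (eps k H) := by
  rw [L01, braidedAlgebra, HModAlg.mk.injEq]
  refine ⟨?_, rfl, coad_eq hS⟩
  ext φ ψ : 2
  rw [braidedProduct_apply, R.el_conv_left,
    ← R.el_anti_anti (E := Module.End k (restrictedDual k H ⊗[k] restrictedDual k H))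
      (onRight (restrictedDual k H) (rightTrans hS))
      (onLeft (restrictedDual k H) (leftTrans k H))]
  simp only [LinearMap.sum_apply, LinearMap.compl₁₂_apply, Module.End.mul_apply, R.el_apply,
    map_sum, anti_apply, onLeft_tmul, onRight_tmul, rightTrans_antipode, TensorProduct.lift.tmul]
  rw [Finset.sum_comm]
  refine Finset.sum_congr rfl fun i _ => Finset.sum_congr rfl fun j _ => ?_
  rw [← Module.End.mul_apply (leftTrans k H _) (leftTrans k H _), ← IsHom.map_mul]
  rfl

theorem L01_isModuleAlgebra (hS : Function.Bijective (HopfAlgebra.antipode k : H →ₗ[k] H)) :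
    (L01 R).IsModuleAlgebra := by
  rw [L01_eq R hS]
  exact (isCoregular hS).isModuleAlgebra R

/-- The four factors of `exchange_eq` correspond, from left to right, to the copies R⁴, R³, R², R¹.
In the last two, (S ⊗ S)(R) = R removes S⁻¹ from the right translations. -/
theorem exchangeOp_tmul (φ ψ : restrictedDual k H) :
    exchangeOp R (leftTrans k H) (rightTrans hS) (φ ⊗ₜ ψ) = exchange10 R (ψ ⊗ₜ φ) := by
  rw [exchangeOp, R.exchange_eq, R.inv_eq,
    ← R.el_anti_anti (E := Module.End k (restrictedDual k H ⊗[k] restrictedDual k H))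
      (onLeft (restrictedDual k H) (rightTrans hS))
      (onRight (restrictedDual k H) (rightTrans hS)),
    ← R.el_anti_anti (E := Module.End k (restrictedDual k H ⊗[k] restrictedDual k H))
      (onLeft (restrictedDual k H) (rightTrans hS))
      (onRight (restrictedDual k H) (leftTrans k H))]
  simp only [exchange10, LinearMap.comp_apply, LinearEquiv.coe_coe, TensorProduct.comm_tmul,
    LinearMap.sum_apply, TensorProduct.map_tmul, Module.End.mul_apply, R.el_apply,
    map_sum, anti_apply, onLeft_tmul, onRight_tmul, rightTrans_antipode]
  refine Finset.sum_congr rfl fun i _ => Finset.sum_congr rfl fun j _ => ?_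
  rw [Finset.sum_comm]
  refine Finset.sum_congr rfl fun l _ => Finset.sum_congr rfl fun m _ => ?_
  congr 1
  · ext x
    simp [ract_apply, leftTrans, lact, mul_assoc]
  · ext x
    simp [ract_apply, leftTrans, lact, mul_assoc]

theorem L10_isModuleAlgebra (hS : Function.Bijective (HopfAlgebra.antipode k : H →ₗ[k] H)) :
    (L10 R).IsModuleAlgebra := by
  have := (isCoregular hS).twisted_isModuleAlgebra R (τ := exchange10 R)
    (fun i : Fin R.card × Fin R.card × Fin R.card × Fin R.card =>
      lact (R.snd i.2.2.2 * R.fst i.2.2.1) ∘ₗ ract (R.fst i.1 * R.fst i.2.1))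
    (fun i => lact (R.snd i.2.2.1 * HopfAlgebra.antipode k (R.snd i.1)) ∘ₗ
      ract (R.snd i.2.1 * R.fst i.2.2.2))
    (fun x y => (exchangeOp_tmul R hS x y).symm) (fun x y => by
      rw [exchangeOp_tmul]
      simp [exchange10, Fintype.sum_prod_type])
  rwa [← L01_eq] at this

theorem repB_eq : repB R = braidedRep R (leftTrans k H) (rightTrans hS) star := by
  ext φ ψ : 2
  rw [braidedRep_apply, RMatrix.repOp, RMatrix.inv_conv_right]
  simp only [repB, LinearMap.sum_apply, LinearMap.compl₁₂_apply, Module.End.mul_apply, R.el_apply,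
    R.inv_eq,
    map_sum, anti_apply, onLeft_tmul, onRight_tmul, rightTrans_antipode, TensorProduct.lift.tmul]
  rw [Finset.sum_comm]
  refine Finset.sum_congr rfl fun i _ => Finset.sum_congr rfl fun j _ =>
    Finset.sum_congr rfl fun l _ => ?_
  congr 1
  · congr 1
    ext x
    simp [ract_apply, leftTrans, lact, mul_assoc]
  · ext x
    simp [leftTrans, lact, mul_assoc]

end RestrictedDual

/-! ## The morphism from `L₀,₁(H)` to `H` -/

section Phi

variable {k : Type u} [Field k] {H : Type v} [Ring H] [HopfAlgebra k H] (R : RMatrix k H)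

local infixr:75 " ⊛ " => conv

instance : IsHom (LinearMap.id : H →ₗ[k] H) := ⟨rfl, fun _ _ => rfl⟩

instance {B : Type*} [Ring B] [Algebra k B] {B' : Type*} [Ring B'] [Algebra k B']
    (f g : H →ₗ[k] B') [h : Commuting f g] : Commuting (rightMap B f) (rightMap B g) :=
  ⟨fun a b => by simp [rightMap_apply, h.comm]⟩

/-- The map `x ⊗ y ↦ φ(x) y`. -/
def evalLeft (X : Type*) [AddCommGroup X] [Module k X] (φ : Module.Dual k H) : H ⊗[k] X →ₗ[k] X :=
  (TensorProduct.lid k X).toLinearMap ∘ₗ LinearMap.rTensor X φ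

@[simp]
theorem evalLeft_tmul (X : Type*) [AddCommGroup X] [Module k X] (φ : Module.Dual k H) (h : H)
    (x : X) : evalLeft X φ (h ⊗ₜ x) = φ h • x := by
  simp [evalLeft]

theorem Phi01_eq (φ : restrictedDual k H) :
    Phi01 R φ =
      evalLeft H φ.1 (R.monodromy (leftMap H LinearMap.id) (rightMap H LinearMap.id)) := by
  rw [Phi01_apply, RMatrix.monodromy]
  have h1 : R.elt = R.el (leftMap H LinearMap.id) (rightMap H LinearMap.id) := by
    simp [RMatrix.el, leftMap_apply, rightMap_apply, R.elt_eq_sum]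
  have h2 : TensorProduct.comm k H H R.elt =
      R.el (rightMap H LinearMap.id) (leftMap H LinearMap.id) := by
    simp [RMatrix.el, leftMap_apply, rightMap_apply, R.elt_eq_sum]
  rw [h2]
  nth_rewrite 1 [h1]
  rfl

theorem coad_apply (φ : restrictedDual k H) (x : H) {h : H} {ι : Type*}
    (r : Coalgebra.Repr k h ι) : (coad h φ).1 x =
      ∑ i ∈ r.index, φ.1 (r.left i * x * HopfAlgebra.antipode k (r.right i)) := by
  simp only [coad, LinearMap.comp_apply, ← r.eq, map_sum, TensorProduct.lift.tmul,
    LinearMap.sum_apply, Submodule.coe_sum, mul_assoc]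
  rfl

theorem Phi01_coad (h : H) (φ : restrictedDual k H) :
    Phi01 R (coad h φ) =
    adjointAct (LinearMap.id : H →ₗ[k] H) h (Phi01 R φ) := by
  rw [Phi01_eq, Phi01_eq, adjointAct_repr _ _ (Coalgebra.Repr.arbitrary k h)]
  have := LinearMap.congr_fun (R.mul_monodromy_mul_anti (leftMap H LinearMap.id)
    (rightMap H LinearMap.id)) h
  rw [conv_apply _ _ (Coalgebra.Repr.arbitrary k h),
    conv_apply _ _ (Coalgebra.Repr.arbitrary k h)] at this
  replace this := congrArg (evalLeft H φ.1) this
  generalize R.monodromy (leftMap H LinearMap.id) (rightMap H LinearMap.id) = m at *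
  refine Eq.trans ?_ (this.trans ?_)
  · clear this
    induction m with
    | zero => simp
    | add a b ha hb =>
      simp only [LinearMap.comp_apply, LinearMap.mulRight_apply, map_sum] at ha hb ⊢
      simp only [map_add, mul_add, add_mul, Finset.sum_add_distrib, ha, hb]
    | tmul a b =>
      rw [evalLeft_tmul, coad_apply _ _ (Coalgebra.Repr.arbitrary k h)]
      simp [leftMap_apply, anti_apply, Finset.sum_smul]
  · clear this
    induction m with
    | zero => simp
    | add a b ha hb =>
      simp only [LinearMap.comp_apply, LinearMap.mulRight_apply, map_sum] at ha hb ⊢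
      simp only [map_add, mul_add, add_mul, Finset.sum_add_distrib, ha, hb]
    | tmul a b => simp [rightMap_apply, anti_apply]

theorem Phi01_eps : Phi01 R (eps k H) = 1 := by
  let T : H ⊗[k] H →ₐ[k] H := (Algebra.TensorProduct.lid k H).toAlgHom.comp
    (Algebra.TensorProduct.map (Bialgebra.counitAlgHom k H) (AlgHom.id k H))
  have hT : ∀ x, evalLeft H (eps k H).1 x = T x := fun x => rfl
  have h1 : T.toLinearMap ∘ₗ leftMap H LinearMap.id = convUnit := by
    ext x
    simp [T, leftMap_apply, convUnit, Algebra.algebraMap_eq_smul_one]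
  have h2 : T.toLinearMap ∘ₗ rightMap H LinearMap.id = LinearMap.id := by
    ext x
    simp [T, rightMap_apply]
  rw [Phi01_eq, hT, RMatrix.monodromy, map_mul, RMatrix.map_el, RMatrix.map_el, h1, h2,
    R.el_convUnit_left, R.el_convUnit_right, one_mul]

theorem L01_mul_apply (φ ψ : restrictedDual k H) (x : H) {ι : Type*} (r : Coalgebra.Repr k x ι) :
    ((L01 R).mul φ ψ).1 x = ∑ i, ∑ j, ∑ l ∈ r.index,
      φ.1 (r.left l * (R.snd j * HopfAlgebra.antipode k (R.snd i))) *
        ψ.1 (R.fst i * (r.right l * R.fst j)) := by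
  simp only [L01, LinearMap.sum_apply, Submodule.coe_sum, LinearMap.compl₁₂_apply, star_apply,
    ← r.eq, map_sum]
  rfl

theorem RMatrix.map_monodromy {E E' : Type*} [Ring E] [Algebra k E] [Ring E'] [Algebra k E']
    (φ : E →ₐ[k] E') (f g : H →ₗ[k] E) :
    φ (R.monodromy f g) = R.monodromy (φ.toLinearMap ∘ₗ f) (φ.toLinearMap ∘ₗ g) := by
  rw [RMatrix.monodromy, map_mul, R.map_el, R.map_el, RMatrix.monodromy]

/-- The identity `sum_mul_monodromy` in H ⊗ (H ⊗ H), paired with φ on the first leg and ψ on the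
second. The coproduct of the product φψ turns the first leg of RR' into f ⊛ g. -/
theorem Phi01_mul (φ ψ : restrictedDual k H) :
    Phi01 R ((L01 R).mul φ ψ) = Phi01 R φ * Phi01 R ψ := by
  let f : H →ₗ[k] H ⊗[k] (H ⊗[k] H) := leftMap (H ⊗[k] H) LinearMap.id
  let g : H →ₗ[k] H ⊗[k] (H ⊗[k] H) := rightMap H (leftMap H LinearMap.id)
  let p : H →ₗ[k] H ⊗[k] (H ⊗[k] H) := rightMap H (rightMap H LinearMap.id)
  let T : H ⊗[k] H →ₐ[k] H ⊗[k] (H ⊗[k] H) :=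
    (Algebra.TensorProduct.assoc k k k H H H).toAlgHom.comp
      (Algebra.TensorProduct.map (Bialgebra.comulAlgHom k H) (AlgHom.id k H))
  let T₁ : H ⊗[k] H →ₐ[k] H ⊗[k] (H ⊗[k] H) :=
    Algebra.TensorProduct.map (AlgHom.id k H) Algebra.TensorProduct.includeRight
  let T₂ : H ⊗[k] H →ₐ[k] H ⊗[k] (H ⊗[k] H) := Algebra.TensorProduct.includeRight
  have key := congrArg (evalLeft H ψ.1 ∘ₗ evalLeft (H ⊗[k] H) φ.1) (R.sum_mul_monodromy f g p)
  have hp : T.toLinearMap ∘ₗ rightMap H LinearMap.id = p := by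
    ext x
    simp [T, p, rightMap_apply, Algebra.TensorProduct.one_def]
  have hf : T.toLinearMap ∘ₗ leftMap H LinearMap.id = f ⊛ g := by
    ext x
    rw [conv_apply _ _ (Coalgebra.Repr.arbitrary k x)]
    simp only [LinearMap.comp_apply, leftMap_apply, T, AlgHom.toLinearMap_apply, AlgHom.comp_apply,
      Algebra.TensorProduct.map_tmul, Bialgebra.comulAlgHom_apply, LinearMap.id_apply, f, g]
    rw [← (Coalgebra.Repr.arbitrary k x).eq]
    simp [TensorProduct.sum_tmul, rightMap_apply, leftMap_apply]
  have hf₁ : T₁.toLinearMap ∘ₗ leftMap H LinearMap.id = f := by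
    ext x
    simp [T₁, f, leftMap_apply, Algebra.TensorProduct.one_def]
  have hp₁ : T₁.toLinearMap ∘ₗ rightMap H LinearMap.id = p := by
    ext x
    simp [T₁, p, rightMap_apply]
  have hg₂ : T₂.toLinearMap ∘ₗ leftMap H LinearMap.id = g := rfl
  have hp₂ : T₂.toLinearMap ∘ₗ rightMap H LinearMap.id = p := rfl
  have e1 : R.monodromy (f ⊛ g) p =
      T (R.monodromy (leftMap H LinearMap.id) (rightMap H LinearMap.id)) := by
    rw [R.map_monodromy, hf, hp]
  have e2 : R.monodromy f p =
      T₁ (R.monodromy (leftMap H LinearMap.id) (rightMap H LinearMap.id)) := by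
    rw [R.map_monodromy, hf₁, hp₁]
  have e3 : R.monodromy g p =
      T₂ (R.monodromy (leftMap H LinearMap.id) (rightMap H LinearMap.id)) := by
    rw [R.map_monodromy, hg₂, hp₂]
  rw [e1, e2, e3] at key
  rw [Phi01_eq, Phi01_eq, Phi01_eq]
  generalize R.monodromy (leftMap H LinearMap.id) (rightMap H LinearMap.id) = m at key ⊢
  refine Eq.trans ?_ (key.trans ?_)
  · clear key
    induction m with
    | zero => simp
    | add a b ha hb => simp only [map_add, mul_add, add_mul, Finset.sum_add_distrib, ha, hb]
    | tmul x y =>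
      rw [evalLeft_tmul, L01_mul_apply _ _ _ _ (Coalgebra.Repr.arbitrary k x)]
      have hT : T (x ⊗ₜ y) = ∑ l ∈ (Coalgebra.Repr.arbitrary k x).index,
          (Coalgebra.Repr.arbitrary k x).left l ⊗ₜ
            ((Coalgebra.Repr.arbitrary k x).right l ⊗ₜ y) := by
        simp only [T, AlgHom.comp_apply,
          Algebra.TensorProduct.map_tmul, Bialgebra.comulAlgHom_apply]
        rw [← (Coalgebra.Repr.arbitrary k x).eq]
        simp [TensorProduct.sum_tmul]
      rw [hT]
      simp only [RMatrix.el, Finset.mul_sum, Finset.sum_mul, map_sum, Finset.sum_smul, f, g,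
        leftMap_apply, rightMap_apply, LinearMap.id_apply, Algebra.TensorProduct.tmul_mul_tmul,
        one_mul, mul_one, LinearMap.comp_apply, evalLeft_tmul, map_smul, smul_smul, mul_assoc]
  · clear key
    have : ∀ m', (evalLeft H ψ.1 ∘ₗ evalLeft (H ⊗[k] H) φ.1) (T₁ m * T₂ m') =
        evalLeft H φ.1 m * evalLeft H ψ.1 m' := by
      intro m'
      induction m with
      | zero => simp
      | add a b ha hb => simp only [map_add, add_mul, ha, hb]
      | tmul a b =>
        induction m' with
        | zero => simp
        | add a b ha hb => simp only [map_add, mul_add, ha, hb]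
        | tmul c d => simp [T₁, T₂, smul_smul, mul_comm]
    exact this m

theorem Phi01_isAdjointMorphism : IsAdjointMorphism (L01 R) (LinearMap.id : H →ₗ[k] H) (Phi01 R) :=
  ⟨⟨Phi01_mul R, Phi01_eps R⟩, Phi01_coad R⟩

end Phi

/-! ## The exchange relation for the representation of `L₁,₀(H)` -/

section RepExchange

variable {k : Type*} [Field k] {H : Type*} [Ring H] [HopfAlgebra k H] (R : RMatrix k H)
variable {V : Type*} [AddCommGroup V] [Module k V]

local infixr:75 " ⊛ " => conv

theorem RMatrix.el_def {E : Type*} [Ring E] [Algebra k E] (f g : H →ₗ[k] E) :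
    R.el f g = ∑ i, f (R.fst i) * g (R.snd i) := rfl

theorem RMatrix.monodromy_def {E : Type*} [Ring E] [Algebra k E] (f g : H →ₗ[k] E) :
    R.monodromy f g = R.el f g * R.el g f := rfl

variable (k H) in
/-- The left multiplications of `H`. -/
def leftMul : H →ₗ[k] Module.End k H := LinearMap.mul k H

variable (k H) in
/-- The right multiplications of `H`. -/
def rightMul : H →ₗ[k] Module.End k H := (LinearMap.mul k H).flip

@[simp]
theorem leftMul_apply (a b : H) : leftMul k H a b = a * b := rfl

@[simp]
theorem rightMul_apply (a b : H) : rightMul k H a b = b * a := rfl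

instance : IsHom (leftMul k H) where
  map_one := by ext; simp
  map_mul a b := by ext; simp [mul_assoc]

instance : Commuting (leftMul k H) (rightMul k H) where
  comm a b := by ext; simp [mul_assoc]

theorem intertwines_evalLeft {X : Type*} [AddCommGroup X] [Module k X] (φ : Module.Dual k H)
    (f : H →ₗ[k] Module.End k X) : Intertwines (evalLeft X φ) (onRight H f) f :=
  .of_comp fun h => by ext; simp

theorem evalLeft_lTensor {X X' : Type*} [AddCommGroup X] [Module k X] [AddCommGroup X']
    [Module k X'] (φ : Module.Dual k H) (T : X →ₗ[k] X') (w : H ⊗[k] X) :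
    evalLeft X' φ (LinearMap.lTensor H T w) = T (evalLeft X φ w) := by
  induction w with
  | zero => simp
  | add x y hx hy => simp only [map_add, hx, hy]
  | tmul x y => simp

variable (ι : V →ₗ[k] Module.Dual k H)

/-- The map `x ⊗ y ↦ (ι(y) ⊗ id)(N(1 ⊗ x ⊗ z))`. -/
def pairWith (N : Module.End k (H ⊗[k] (V ⊗[k] V))) (z : V) : V ⊗[k] V →ₗ[k] V ⊗[k] V :=
  TensorProduct.lift (LinearMap.mk₂ k
    (fun x y => evalLeft (V ⊗[k] V) (ι y) (N (1 ⊗ₜ (x ⊗ₜ z))))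
    (fun x x' y => by simp [TensorProduct.add_tmul, TensorProduct.tmul_add])
    (fun c x y => by simp [← TensorProduct.smul_tmul'])
    (fun x y y' => by simp [evalLeft, LinearMap.rTensor_add])
    (fun c x y => by simp [evalLeft, LinearMap.rTensor_smul]))

theorem pairWith_tmul (N : Module.End k (H ⊗[k] (V ⊗[k] V))) (x y z : V) :
    pairWith ι N z (x ⊗ₜ y) = evalLeft (V ⊗[k] V) (ι y) (N (1 ⊗ₜ (x ⊗ₜ z))) := rfl

theorem pairWith_sum {κ : Type*} (s : Finset κ) (N : κ → Module.End k (H ⊗[k] (V ⊗[k] V))) (z : V)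
    (w : V ⊗[k] V) : pairWith ι (∑ i ∈ s, N i) z w = ∑ i ∈ s, pairWith ι (N i) z w := by
  induction w with
  | zero => simp
  | add x y hx hy => simp only [map_add, hx, hy, Finset.sum_add_distrib]
  | tmul x y => simp [pairWith_tmul, LinearMap.sum_apply]

theorem pairWith_onLeft (f : H →ₗ[k] Module.End k V) (N : Module.End k (H ⊗[k] (V ⊗[k] V))) (a : H)
    (z : V) (w : V ⊗[k] V) :
    pairWith ι N z (onLeft V f a w) = pairWith ι (N * onRight H (onLeft V f) a) z w := by
  induction w with
  | zero => simp
  | add x y hx hy => simp only [map_add, hx, hy]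
  | tmul x y => simp [pairWith_tmul]

theorem evalLeft_comp_mulRight {X : Type*} [AddCommGroup X] [Module k X] (φ ψ : Module.Dual k H)
    (a : H) (h : ∀ x, ψ x = φ (x * a)) (w : H ⊗[k] X) :
    evalLeft X ψ w = evalLeft X φ (onLeft X (rightMul k H) a w) := by
  induction w with
  | zero => simp
  | add x y hx hy => simp only [map_add, hx, hy]
  | tmul x y => simp [h]

theorem evalLeft_comp_mulLeft {X : Type*} [AddCommGroup X] [Module k X] (φ ψ : Module.Dual k H)
    (a : H) (h : ∀ x, ψ x = φ (a * x)) (w : H ⊗[k] X) :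
    evalLeft X ψ w = evalLeft X φ (onLeft X (leftMul k H) a w) := by
  induction w with
  | zero => simp
  | add x y hx hy => simp only [map_add, hx, hy]
  | tmul x y => simp [h]

variable {L Y : H →ₗ[k] Module.End k V} [IsHom L] [IsHom Y] [Commuting L Y]

/-- Translation of the form is right multiplication by a on the copy of H. It commutes past N and
reaches the vector 1, where right and left multiplication by a coincide. -/
theorem pairWith_left (hL : ∀ a x y, ι (L a x) y = ι x (y * a))
    {N : Module.End k (H ⊗[k] (V ⊗[k] V))}
    (hN : ∀ a, N * onLeft (V ⊗[k] V) (rightMul k H) a = onLeft (V ⊗[k] V) (rightMul k H) a * N)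
    (a : H) (z : V) (w : V ⊗[k] V) :
    pairWith ι N z (onRight V L a w) =
      pairWith ι (N * onLeft (V ⊗[k] V) (leftMul k H) a) z w := by
  induction w with
  | zero => simp
  | add x y hx hy => simp only [map_add, hx, hy]
  | tmul x y =>
    rw [onRight_tmul, pairWith_tmul, evalLeft_comp_mulRight (ι y) _ a (hL a y),
      ← Module.End.mul_apply, ← hN, pairWith_tmul]
    simp

theorem pairWith_right (hY : ∀ a x y, ι (Y (HopfAlgebra.antipode k a) x) y = ι x (a * y))
    (N : Module.End k (H ⊗[k] (V ⊗[k] V))) (a : H) (z : V) (w : V ⊗[k] V) :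
    pairWith ι N z (onRight V Y (HopfAlgebra.antipode k a) w) =
      pairWith ι (onLeft (V ⊗[k] V) (leftMul k H) a * N) z w := by
  induction w with
  | zero => simp
  | add x y hx hy => simp only [map_add, hx, hy]
  | tmul x y =>
    rw [onRight_tmul, pairWith_tmul, evalLeft_comp_mulLeft (ι y) _ a (hY a y), pairWith_tmul]
    simp

/-- Each of the four images of R in the exchange operator is transferred from the two forms to
operators on H ⊗ (V ⊗ V). Left translations of α enter on the right of N, right translations on the
left. The result is the operator on the right side of `monodromy_mul_repOp`. -/
theorem pairWith_exchangeOp (hL : ∀ a x y, ι (L a x) y = ι x (y * a))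
    (hY : ∀ a x y, ι (Y (HopfAlgebra.antipode k a) x) y = ι x (a * y)) (z : V) (w : V ⊗[k] V) :
    pairWith ι (R.monodromy (onLeft (V ⊗[k] V) (leftMul k H)) (onRight H (onRight V L))) z
        (exchangeOp R L Y w) =
      pairWith ι (R.inv (onRight H (onLeft V Y)) (onLeft (V ⊗[k] V) (leftMul k H)) *
        R.el (onLeft (V ⊗[k] V) (leftMul k H)) (onRight H (onLeft V L)) *
        R.monodromy (onLeft (V ⊗[k] V) (leftMul k H)) (onRight H (onRight V L)) *
        R.el (onRight H (onLeft V L)) (onLeft (V ⊗[k] V) (leftMul k H)) *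
        R.el (onRight H (onLeft V Y)) (onLeft (V ⊗[k] V) (leftMul k H))) z w := by
  set A : H →ₗ[k] Module.End k (H ⊗[k] (V ⊗[k] V)) := onLeft (V ⊗[k] V) (leftMul k H) with hA
  set B : H →ₗ[k] Module.End k (H ⊗[k] (V ⊗[k] V)) := onLeft (V ⊗[k] V) (rightMul k H) with hB
  set L₁ : H →ₗ[k] Module.End k (H ⊗[k] (V ⊗[k] V)) := onRight H (onLeft V L) with hL₁
  set L₂ : H →ₗ[k] Module.End k (H ⊗[k] (V ⊗[k] V)) := onRight H (onRight V L) with hL₂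
  set Y₁ : H →ₗ[k] Module.End k (H ⊗[k] (V ⊗[k] V)) := onRight H (onLeft V Y) with hY₁
  let E := Module.End k (H ⊗[k] (V ⊗[k] V))
  have i1 : Commuting (E := E) A B := by rw [hA, hB]; infer_instance
  have i2 : Commuting (E := E) L₁ B := by rw [hL₁, hB]; infer_instance
  have i3 : Commuting (E := E) L₂ B := by rw [hL₂, hB]; infer_instance
  have i4 : Commuting (E := E) Y₁ B := by rw [hY₁, hB]; infer_instance
  have i5 : Commuting (E := E) L₂ L₁ := by rw [hL₂, hL₁]; infer_instance
  have i6 : Commuting (E := E) A L₁ := by rw [hA, hL₁]; infer_instance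
  have i7 : Commuting (E := E) A Y₁ := by rw [hA, hY₁]; infer_instance
  have i8 : Commuting (E := E) L₁ Y₁ := by rw [hL₁, hY₁]; infer_instance
  have i9 : Commuting (E := E) L₂ Y₁ := by rw [hL₂, hY₁]; infer_instance
  have mono_comm : ∀ (f : H →ₗ[k] E) [Commuting (E := E) A f]
      [Commuting (E := E) L₂ f] (a : H), R.monodromy A L₂ * f a = f a * R.monodromy A L₂ := by
    intro f _ _ a
    rw [RMatrix.monodromy, mul_assoc, R.mul_comm_of_commuting, ← mul_assoc,
      R.mul_comm_of_commuting, mul_assoc]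
  have n2 : ∀ (f : H →ₗ[k] E) [Commuting (E := E) A f] [Commuting (E := E) L₁ f]
      [Commuting (E := E) L₂ f] (a : H), R.el A L₁ * R.monodromy A L₂ * f a =
        f a * (R.el A L₁ * R.monodromy A L₂) := by
    intro f _ _ _ a
    rw [mul_assoc, mono_comm, ← mul_assoc, R.mul_comm_of_commuting, mul_assoc]
  have n3 : ∀ (f : H →ₗ[k] E) [Commuting (E := E) A f] [Commuting (E := E) L₁ f]
      [Commuting (E := E) L₂ f] (a : H), R.el A L₁ * R.monodromy A L₂ * R.el L₁ A * f a =
        f a * (R.el A L₁ * R.monodromy A L₂ * R.el L₁ A) := by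
    intro f _ _ _ a
    rw [mul_assoc, R.mul_comm_of_commuting, ← mul_assoc, n2, mul_assoc]
  have s1 : ∀ w, pairWith ι (R.monodromy A L₂) z (R.inv (onRight V Y) (onLeft V L) w) =
      pairWith ι (R.el A L₁ * R.monodromy A L₂) z w := by
    intro w
    simp only [R.inv_eq, R.el_apply, anti_apply, map_sum]
    rw [RMatrix.el, Finset.sum_mul, pairWith_sum]
    refine Finset.sum_congr rfl fun i _ => ?_
    rw [pairWith_right ι hY, pairWith_onLeft, mul_assoc, ← hL₁, mono_comm, ← mul_assoc]
  have s2 : ∀ w, pairWith ι (R.el A L₁ * R.monodromy A L₂) z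
      (R.el (onLeft V L) (onRight V L) w) =
      pairWith ι (R.el A L₁ * R.monodromy A L₂ * R.el L₁ A) z w := by
    intro w
    simp only [R.el_apply, map_sum]
    rw [R.el_def (E := E) L₁ A, Finset.mul_sum, pairWith_sum]
    refine Finset.sum_congr rfl fun i _ => ?_
    rw [pairWith_onLeft, pairWith_left ι hL, mul_assoc]
    intro a
    rw [mul_assoc, i2.comm, ← mul_assoc, n2, mul_assoc]
  have s3 : ∀ w, pairWith ι (R.el A L₁ * R.monodromy A L₂ * R.el L₁ A) z
      (R.el (onLeft V Y) (onRight V Y) w) =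
      pairWith ι (R.inv Y₁ A * (R.el A L₁ * R.monodromy A L₂ * R.el L₁ A)) z w := by
    intro w
    rw [← R.el_anti_anti (E := Module.End k (V ⊗[k] V)) (onLeft V Y) (onRight V Y)]
    simp only [R.el_apply, map_sum, anti_apply]
    rw [R.inv_eq, R.el_def (E := E) (anti Y₁) A, Finset.sum_mul, pairWith_sum]
    refine Finset.sum_congr rfl fun i _ => ?_
    rw [pairWith_onLeft, pairWith_right ι hY, ← hY₁, n3, ← mul_assoc, anti_apply, ← hA, i7.comm]
  have s4 : ∀ w, pairWith ι (R.inv Y₁ A * (R.el A L₁ * R.monodromy A L₂ * R.el L₁ A)) z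
      (R.el (onLeft V Y) (onRight V L) w) =
      pairWith ι (R.inv Y₁ A * (R.el A L₁ * R.monodromy A L₂ * R.el L₁ A) * R.el Y₁ A) z w := by
    intro w
    simp only [R.el_apply, map_sum]
    rw [R.el_def (E := E) Y₁ A, Finset.mul_sum, pairWith_sum]
    refine Finset.sum_congr rfl fun i _ => ?_
    rw [pairWith_onLeft, pairWith_left ι hL, mul_assoc]
    intro a
    rw [mul_assoc, i4.comm, ← mul_assoc, mul_assoc (R.inv (E := E) Y₁ A), n3, ← mul_assoc,
      R.inv_mul_comm_of_commuting]
    simp only [mul_assoc]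
    rfl
  rw [exchangeOp, R.exchange_eq]
  simp only [Module.End.mul_apply]
  rw [s1, s2, s3, s4]
  simp only [mul_assoc]

theorem left_Phi_apply {Φ : V →ₗ[k] H} (hΦ : ∀ x, Φ x = evalLeft H (ι x)
      (R.monodromy (leftMap H LinearMap.id) (rightMap H LinearMap.id))) (x y : V) :
    L (Φ x) y = evalLeft V (ι x)
      (R.monodromy (E := Module.End k (H ⊗[k] V)) (onLeft V (leftMul k H)) (onRight H L)
        (1 ⊗ₜ y)) := by
  rw [hΦ]
  simp only [RMatrix.monodromy, RMatrix.el, leftMap_apply, rightMap_apply, LinearMap.id_apply,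
    Finset.sum_mul_sum, map_sum, Algebra.TensorProduct.tmul_mul_tmul, one_mul, mul_one,
    evalLeft_tmul, map_smul, LinearMap.sum_apply, LinearMap.smul_apply, Module.End.mul_apply,
    onLeft_tmul, onRight_tmul, leftMul_apply, IsHom.map_mul (f := L)]

/-- Both sides, applied to z, are evaluations on the copy of H of operators at 1 ⊗ (x ⊗ z). The left
one is computed by `pairWith_exchangeOp`; the right one is the monodromy followed across μ, where it
acts through L₁ ⊛ L₂. They agree by `monodromy_mul_repOp`. -/
theorem rep_exchange {μ : V →ₗ[k] V →ₗ[k] V} {e : V} (hV : IsCoregular L Y μ e)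
    (hL : ∀ a x y, ι (L a x) y = ι x (y * a))
    (hY : ∀ a x y, ι (Y (HopfAlgebra.antipode k a) x) y = ι x (a * y))
    {Φ : V →ₗ[k] H} (hΦ : ∀ x, Φ x = evalLeft H (ι x)
      (R.monodromy (leftMap H LinearMap.id) (rightMap H LinearMap.id))) (x y : V) :
    TensorProduct.lift ((LinearMap.mul k (Module.End k V)).compl₁₂ (braidedRep R L Y μ) (L ∘ₗ Φ))
      (exchangeOp R L Y (x ⊗ₜ y)) = L (Φ y) * braidedRep R L Y μ x := by
  ext z
  have h1 : ∀ w, TensorProduct.lift ((LinearMap.mul k (Module.End k V)).compl₁₂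
      (braidedRep R L Y μ) (L ∘ₗ Φ)) w z = TensorProduct.lift μ
      (R.repOp (onLeft V L) (onLeft V Y) (onRight V L) (pairWith ι (R.monodromy
        (onLeft (V ⊗[k] V) (leftMul k H)) (onRight H (onRight V L))) z w)) := by
    intro w
    induction w with
    | zero => simp
    | add x y hx hy => simp only [map_add, LinearMap.add_apply, hx, hy]
    | tmul x y =>
      have i1 := (intertwines_lTensor_onLeft (TensorProduct.mk k V V x) (leftMul k H))
      have i2 := (intertwines_mk x L).lTensor (P := H)
      have e1 : (1 : H) ⊗ₜ[k] (x ⊗ₜ[k] z) =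
        LinearMap.lTensor H (TensorProduct.mk k V V x) (1 ⊗ₜ z) := rfl
      rw [pairWith_tmul, e1, RMatrix.monodromy, Module.End.mul_apply, ← i2.el R i1, ← i1.el R i2,
        evalLeft_lTensor, ← Module.End.mul_apply, ← RMatrix.monodromy, ← left_Phi_apply R ι hΦ]
      rfl
  have i1 := intertwines_evalLeft (X := V ⊗[k] V) (ι y)
  have j1 := (intertwines_lTensor_onLeft (TensorProduct.lift μ) (leftMul k H))
  have j2 := hV.left_mul.lTensor (P := H)
  rw [onRight_conv] at j2
  have e1 : (1 : H) ⊗ₜ[k] (TensorProduct.lift μ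
      (R.repOp (onLeft V L) (onLeft V Y) (onRight V L) (x ⊗ₜ z))) =
      LinearMap.lTensor H (TensorProduct.lift μ)
        (R.repOp (E := Module.End k (H ⊗[k] (V ⊗[k] V))) (onRight H (onLeft V L))
          (onRight H (onLeft V Y)) (onRight H (onRight V L)) ((1 : H) ⊗ₜ (x ⊗ₜ z))) := by
    have := (intertwines_mk (1 : H) (onLeft V L)).repOp R (intertwines_mk (1 : H) (onLeft V Y))
      (intertwines_mk (1 : H) (onRight V L)) (x ⊗ₜ z)
    rw [TensorProduct.mk_apply, TensorProduct.mk_apply] at this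
    rw [← this]
    rfl
  rw [h1, pairWith_exchangeOp R ι hL hY, pairWith_tmul, ← (i1 _).repOp R (i1 _) (i1 _),
    ← Module.End.mul_apply, Module.End.mul_apply (L (Φ y)), left_Phi_apply R ι hΦ,
    braidedRep_apply, e1,
    R.monodromy_def (E := Module.End k (H ⊗[k] V)) (onLeft V (leftMul k H)),
    Module.End.mul_apply
      (R.el (E := Module.End k (H ⊗[k] V)) (onLeft V (leftMul k H)) (onRight H L)),
    ← j2.el R j1, ← j1.el R j2, evalLeft_lTensor, ← Module.End.mul_apply, ← Module.End.mul_apply,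
    ← RMatrix.monodromy, R.monodromy_mul_repOp]
  simp only [mul_assoc]

end RepExchange

/-! ### The representation ρ₁,₀ is a morphism of module-algebras -/

section RepL10

variable {k : Type u} [Field k] {H : Type v} [Ring H] [HopfAlgebra k H] (R : RMatrix k H)
  (hS : Function.Bijective (HopfAlgebra.antipode k : H →ₗ[k] H))

local infixr:75 " ⊛ " => conv

theorem rho10_exchange (hS : Function.Bijective (HopfAlgebra.antipode k : H →ₗ[k] H))
    (β α : restrictedDual k H) :
    rho10 R (exchange10 R (α ⊗ₜ β)) = repA R α * repB R β := by
  rw [← exchangeOp_tmul R hS, rho10, repB_eq R hS]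
  exact rep_exchange R (restrictedDual k H).subtype (isCoregular hS) (fun _ _ _ => rfl)
    (fun a φ x => by rw [rightTrans_antipode]; rfl) (Phi01_eq R) β α

theorem rho10_mul (hS : Function.Bijective (HopfAlgebra.antipode k : H →ₗ[k] H))
    (x y : restrictedDual k H ⊗[k] restrictedDual k H) :
    rho10 R ((L10 R).mul x y) = rho10 R x * rho10 R y := by
  have hB : ∀ φ ψ, repB R ((L01 R).mul φ ψ) = repB R φ * repB R ψ := by
    rw [repB_eq R hS, L01_eq R hS]
    exact (isCoregular hS).braidedRep_mul R
  have hA : ∀ φ ψ, repA R ((L01 R).mul φ ψ) = repA R φ * repA R ψ := fun φ ψ => by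
    simp only [repA, LinearMap.comp_apply, Phi01_mul]
    exact IsHom.map_mul (f := leftTrans k H) _ _
  induction x with
  | zero => simp
  | add x x' hx hx' => simp only [map_add, LinearMap.add_apply, add_mul, hx, hx']
  | tmul β α =>
    induction y with
    | zero => simp
    | add x x' hx hx' => simp only [map_add, mul_add, hx, hx']
    | tmul β' α' =>
      -- The outer factors β and α' only multiply on the left and on the right. Multiplicativity
      -- therefore reduces to the exchange of the inner factors α and β'.
      have h : ∀ t, rho10 R (TensorProduct.map ((L01 R).mul β) ((L01 R).mul.flip α') t) =
          repB R β * rho10 R t * repA R α' := by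
        intro t
        induction t with
        | zero => simp
        | add x x' hx hx' => simp only [map_add, mul_add, add_mul, hx, hx']
        | tmul x y => simp [rho10, hB, hA, mul_assoc]
      rw [L10, twistedMul_tmul, h, rho10_exchange R hS]
      simp [rho10, mul_assoc]

theorem rho10_isAdjointMorphism :
    IsAdjointMorphism (L10 R) (rightTrans hS ⊛ leftTrans k H) (rho10 R) := by
  refine ⟨⟨rho10_mul R hS, ?_⟩, fun h x => ?_⟩
  · have h1 : repB R (eps k H) = 1 := by
      rw [repB_eq R hS]
      exact (isCoregular hS).braidedRep_one R
    have h2 : repA R (eps k H) = 1 := by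
      simp only [repA, LinearMap.comp_apply, Phi01_eps]
      exact IsHom.map_one (f := leftTrans k H)
    simp [L10, rho10, h1, h2, adjoint]
  · have hB : ∀ h φ, repB R (coad h φ) =
        adjointAct (rightTrans hS ⊛ leftTrans k H) h (repB R φ) := by
      rw [repB_eq R hS, coad_eq hS]
      exact (isCoregular hS).braidedRep_act R
    have hA : ∀ h φ, repA R (coad h φ) =
        adjointAct (rightTrans hS ⊛ leftTrans k H) h (repA R φ) := by
      intro h φ
      have e1 := map_adjointAct (AlgHom.ofLinearMap (leftTrans k H) IsHom.map_one IsHom.map_mul)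
        (LinearMap.id : H →ₗ[k] H) h (Phi01 R φ)
      change leftTrans k H (Phi01 R (coad h φ)) = adjointAct _ h (leftTrans k H (Phi01 R φ))
      rw [adjointAct_conv (leftTrans k H) (rightTrans hS)
        (fun a => Commuting.comm (f := leftTrans k H) _ _)]
      rw [Phi01_coad]
      exact e1
    induction x with
    | zero => simp
    | add x y hx hy => simp only [map_add, hx, hy]
    | tmul β α =>
      have h1 := (adjoint_isModuleAlgebra (rightTrans hS ⊛ leftTrans k H)).mul_act h (repB R β)
        (repA R α)
      simp only [L10, tensorAct_tmul, adjoint] at h1 ⊢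
      have h2 : rho10 R (β ⊗ₜ α) = repB R β * repA R α := by simp [rho10]
      rw [h2]
      refine Eq.trans ?_ h1.symm
      generalize (Coalgebra.comul h : H ⊗[k] H) = t
      induction t with
      | zero => simp
      | add x y hx hy => simp only [map_add, hx, hy]
      | tmul a b => simp [rho10, hA, hB]

end RepL10

/-! ## Bijectivity of the representation of `L₁,₀(H)` -/

section Bijective

variable {k : Type u} [Field k] {H : Type v} [Ring H] [HopfAlgebra k H] (R : RMatrix k H)
  (hS : Function.Bijective (HopfAlgebra.antipode k : H →ₗ[k] H))

local infixr:75 " ⊛ " => conv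

theorem RMatrix.isUnit_el {E : Type*} [Ring E] [Algebra k E] (f g : H →ₗ[k] E) [IsHom f] [IsHom g]
    [Commuting f g] : IsUnit (R.el f g) :=
  ⟨⟨_, _, R.el_mul_inv f g, R.inv_mul_el f g⟩, rfl⟩

theorem RMatrix.isUnit_inv {E : Type*} [Ring E] [Algebra k E] (f g : H →ₗ[k] E) [IsHom f]
    [IsHom g] [Commuting f g] : IsUnit (R.inv f g) :=
  ⟨⟨_, _, R.inv_mul_el f g, R.el_mul_inv f g⟩, rfl⟩

variable (k H) in
/-- The map `β ⊗ h ↦ (ψ ↦ β ⋆ (h ▷ ψ))`. -/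
def heisenberg : restrictedDual k H ⊗[k] H →ₗ[k] Module.End k (restrictedDual k H) :=
  TensorProduct.lift ((LinearMap.mul k (Module.End k (restrictedDual k H))).compl₁₂ star
    (leftTrans k H))

/-- The operator in ρ_b only left-translates the vector. On Φ₀,₁(α) ▷ ψ these translations become
left multiplications of Φ₀,₁(α), so the operator can be applied before h ▷ ψ is formed. -/
theorem rho10_eq_heisenberg (x : restrictedDual k H ⊗[k] restrictedDual k H) :
    rho10 R x = heisenberg k H (R.repOp
      (E := Module.End k (restrictedDual k H ⊗[k] H)) (onLeft H (leftTrans k H))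
      (onLeft H (rightTrans hS)) (onRight (restrictedDual k H) (leftMul k H))
        (LinearMap.lTensor _ (Phi01 R) x)) := by
  ext ψ : 1
  have e1 : ∀ w, heisenberg k H w ψ = TensorProduct.lift star
      (LinearMap.lTensor (restrictedDual k H) ((leftTrans k H).flip ψ) w) := by
    intro w
    induction w with
    | zero => simp
    | add x y hx hy => simp only [map_add, LinearMap.add_apply, hx, hy]
    | tmul x y => rfl
  have e2 : Intertwines ((leftTrans k H).flip ψ) (leftMul k H) (leftTrans k H) := by
    intro a b
    simp [IsHom.map_mul (f := leftTrans k H)]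
  have i1 := intertwines_lTensor_onLeft (P := restrictedDual k H) ((leftTrans k H).flip ψ)
    (leftTrans k H)
  have i2 := intertwines_lTensor_onLeft (P := restrictedDual k H) ((leftTrans k H).flip ψ)
    (rightTrans hS)
  rw [e1, i1.repOp R i2 (e2.lTensor)]
  induction x with
  | zero => simp
  | add x y hx hy => simp only [map_add, LinearMap.add_apply, hx, hy]
  | tmul β α =>
    rw [rho10, repB_eq R hS]
    rfl

/-- With t seen as a map H → H, the value is ψ(x₍₂₎ t(x₍₁₎)). The factors occur in reverse order,
whence the convolution in `Hᵐᵒᵖ`. -/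
theorem heisenberg_apply (t : restrictedDual k H ⊗[k] H) (ψ : restrictedDual k H) (x : H) :
    (heisenberg k H t ψ).1 x = ψ.1 (MulOpposite.unop
      ((((MulOpposite.opLinearEquiv k).toLinearMap ∘ₗ dualTensorHom k H H
        (LinearMap.rTensor H (restrictedDual k H).subtype t)) ⊛
          (MulOpposite.opLinearEquiv k).toLinearMap) x)) := by
  rw [conv_apply _ _ (Coalgebra.Repr.arbitrary k x)]
  induction t with
  | zero => simp
  | add a b ha hb =>
    simp only [map_add, LinearMap.add_apply, LinearMap.comp_add, add_mul, Finset.sum_add_distrib,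
      Submodule.coe_add, ha, hb, MulOpposite.unop_add]
  | tmul β h =>
    simp only [heisenberg, TensorProduct.lift.tmul, LinearMap.compl₁₂_apply, LinearMap.mul_apply',
      Module.End.mul_apply]
    rw [star_apply, ← (Coalgebra.Repr.arbitrary k x).eq]
    simp [leftTrans_apply]

theorem heisenberg_injective (hS : Function.Bijective (HopfAlgebra.antipode k : H →ₗ[k] H))
    [FiniteDimensional k H] (h : restrictedDual k H = ⊤) :
    Function.Injective (heisenberg k H) := by
  rw [injective_iff_map_eq_zero]
  intro t ht
  -- S⁻¹ followed by the passage to `Hᵐᵒᵖ` is an algebra morphism, and its composite with S is the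
  -- identity map H → `Hᵐᵒᵖ`. That map is thus convolution invertible, so G can be recovered from
  -- the convolution product.
  let q : H →ₗ[k] Hᵐᵒᵖ := (MulOpposite.opLinearEquiv k).toLinearMap ∘ₗ antipodeInv hS
  have hq : ∀ a, q (HopfAlgebra.antipode k a) = MulOpposite.op a := fun a =>
    congrArg MulOpposite.op ((LinearEquiv.ofBijective _ hS).symm_apply_apply a)
  have hq' : IsHom q := by
    constructor
    · rw [← HopfAlgebra.antipode_one (R := k), hq]
      rfl
    · intro a b
      obtain ⟨a, rfl⟩ := hS.2 a
      obtain ⟨b, rfl⟩ := hS.2 b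
      rw [← HopfAlgebra.antipode_mul_antidistrib, hq, hq, hq]
      rfl
  have hanti : anti q = (MulOpposite.opLinearEquiv k).toLinearMap := by
    ext a : 1
    exact hq a
  set G : H →ₗ[k] Hᵐᵒᵖ := (MulOpposite.opLinearEquiv k).toLinearMap ∘ₗ dualTensorHom k H H
    (LinearMap.rTensor H (restrictedDual k H).subtype t) with hG
  have h0 : G ⊛ anti q = 0 := by
    ext x
    apply MulOpposite.unop_injective
    rw [LinearMap.zero_apply, MulOpposite.unop_zero]
    refine (Module.forall_dual_apply_eq_zero_iff k _).mp fun ψ => ?_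
    have hψ : ψ ∈ restrictedDual k H := h ▸ Submodule.mem_top
    have := heisenberg_apply t ⟨ψ, hψ⟩ x
    rw [ht] at this
    rw [hanti]
    exact this.symm
  have h1 : G = 0 := by
    rw [← conv_convUnit G, ← anti_conv q, ← conv_assoc, h0]
    ext x
    simp [conv]
  have h2 : dualTensorHom k H H (LinearMap.rTensor H (restrictedDual k H).subtype t) = 0 := by
    ext x
    exact congrArg MulOpposite.unop (LinearMap.congr_fun h1 x)
  have h3 := (dualTensorHomEquiv k H H).injective (h2.trans (map_zero _).symm)
  exact Module.Flat.rTensor_preserves_injective_linearMap (M := H) (restrictedDual k H).subtype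
    (Submodule.subtype_injective _) (h3.trans (map_zero _).symm)

theorem restrictedDual_eq_top [FiniteDimensional k H] (hR : IsFactorizable R) :
    restrictedDual k H = ⊤ :=
  Submodule.eq_top_of_finrank_eq (by
    rw [(LinearEquiv.ofBijective _ hR).finrank_eq, Subspace.dual_finrank_eq])

/-- In the factorization of ρ₁,₀ every map is injective: id ⊗ Φ₀,₁ by factorizability, the middle
operator as a product of invertible images of R, and the Heisenberg representation since H° is the
whole dual. Source and target both have dimension (dim H°)². -/
theorem rho10_bijective (hS : Function.Bijective (HopfAlgebra.antipode k : H →ₗ[k] H))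
    [FiniteDimensional k H] (hR : IsFactorizable R) :
    Function.Bijective (rho10 R) := by
  have hfd : FiniteDimensional k (restrictedDual k H) :=
    (LinearEquiv.ofBijective _ hR).symm.finiteDimensional
  have hinj : Function.Injective (rho10 R) := by
    have e : (rho10 R : _ → _) = heisenberg k H ∘ (R.repOp
        (E := Module.End k (restrictedDual k H ⊗[k] H)) (onLeft H (leftTrans k H))
        (onLeft H (rightTrans hS)) (onRight (restrictedDual k H) (leftMul k H)) : _ → _) ∘
        (LinearMap.lTensor _ (Phi01 R)) :=
      funext (rho10_eq_heisenberg R hS)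
    rw [e]
    refine (heisenberg_injective hS (restrictedDual_eq_top R hR)).comp (Function.Injective.comp ?_
      (Module.Flat.lTensor_preserves_injective_linearMap _ hR.1))
    refine ((Module.End.isUnit_iff _).mp ?_).1
    exact (R.isUnit_inv _ _).mul (R.isUnit_el _ _)
  refine ⟨hinj, (LinearMap.injective_iff_surjective_of_finrank_eq_finrank ?_).mp hinj⟩
  rw [Module.finrank_tensorProduct, Module.finrank_linearMap]

end Bijective

/-! ## Algebra morphisms on braided tensor products -/

section Extensionality

variable {k : Type u} [Field k] {H : Type v} [Ring H] [HopfAlgebra k H] (R : RMatrix k H)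
variable {A : Type*} [AddCommMonoid A] [Module k A] {B : Type*} [AddCommMonoid B] [Module k B]
variable {C : Type*} [AddCommMonoid C] [Module k C]

theorem braidedTensor_mul_tmul_one {X : HModAlg k H A} {Y : HModAlg k H B}
    (hX : X.IsModuleAlgebra) (hY : Y.IsModuleAlgebra) (a a' : A) (b' : B) :
    (braidedTensor R X Y).mul (a ⊗ₜ Y.one) (a' ⊗ₜ b') = X.mul a a' ⊗ₜ b' := by
  have h : braiding R X.act Y.act (Y.one ⊗ₜ a') = a' ⊗ₜ Y.one := by
    simp only [braiding_tmul, hY.one_act, ← TensorProduct.smul_tmul]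
    rw [← TensorProduct.sum_tmul]
    simp only [← LinearMap.map_smul₂]
    rw [← LinearMap.sum_apply, ← map_sum, R.sum_counit_smul_fst, hX.act_one]
  simp only [braidedTensor, twistedMul_tmul, h]
  simp [hY.one_mul]

theorem braidedTensor_mul_one_tmul {X : HModAlg k H A} {Y : HModAlg k H B}
    (hX : X.IsModuleAlgebra) (hY : Y.IsModuleAlgebra) (a : A) (b b' : B) :
    (braidedTensor R X Y).mul (a ⊗ₜ b) (X.one ⊗ₜ b') = a ⊗ₜ Y.mul b b' := by
  have h : braiding R X.act Y.act (b ⊗ₜ X.one) = X.one ⊗ₜ b := by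
    simp only [braiding_tmul, hX.one_act, TensorProduct.smul_tmul]
    rw [← TensorProduct.tmul_sum]
    simp only [← LinearMap.map_smul₂]
    rw [← LinearMap.sum_apply, ← map_sum, R.sum_counit_smul_snd, hY.act_one]
  simp only [braidedTensor, twistedMul_tmul, h]
  simp [hX.mul_one]

theorem HModAlg.IsAlgMorphism.comp_tmul_one {X : HModAlg k H A} {Y : HModAlg k H B}
    {Z : HModAlg k H C} (hX : X.IsModuleAlgebra) (hY : Y.IsModuleAlgebra) {f : A ⊗[k] B →ₗ[k] C}
    (hf : (braidedTensor R X Y).IsAlgMorphism Z f) :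
    X.IsAlgMorphism Z (f ∘ₗ (TensorProduct.mk k A B).flip Y.one) := by
  refine ⟨fun x y => ?_, hf.2⟩
  simp only [LinearMap.comp_apply, LinearMap.flip_apply, TensorProduct.mk_apply, ← hf.1,
    braidedTensor_mul_tmul_one R hX hY]

theorem HModAlg.IsAlgMorphism.comp_one_tmul {X : HModAlg k H A} {Y : HModAlg k H B}
    {Z : HModAlg k H C} (hX : X.IsModuleAlgebra) (hY : Y.IsModuleAlgebra) {f : A ⊗[k] B →ₗ[k] C}
    (hf : (braidedTensor R X Y).IsAlgMorphism Z f) :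
    Y.IsAlgMorphism Z (f ∘ₗ TensorProduct.mk k A B X.one) := by
  refine ⟨fun x y => ?_, hf.2⟩
  simp only [LinearMap.comp_apply, TensorProduct.mk_apply, ← hf.1,
    braidedTensor_mul_one_tmul R hX hY]

/-- The braiding with a unit is the flip, so a ⊗ b = (a ⊗ 1)(1 ⊗ b) and the two factors generate. -/
theorem HModAlg.IsAlgMorphism.braidedTensor_ext {X : HModAlg k H A} {Y : HModAlg k H B}
    {Z : HModAlg k H C} (hX : X.IsModuleAlgebra) (hY : Y.IsModuleAlgebra)
    {f f' : A ⊗[k] B →ₗ[k] C} (hf : (braidedTensor R X Y).IsAlgMorphism Z f)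
    (hf' : (braidedTensor R X Y).IsAlgMorphism Z f') (hl : ∀ a, f (a ⊗ₜ Y.one) = f' (a ⊗ₜ Y.one))
    (hr : ∀ b, f (X.one ⊗ₜ b) = f' (X.one ⊗ₜ b)) : f = f' := by
  refine TensorProduct.ext' fun a b => ?_
  have h := braidedTensor_mul_one_tmul R hX hY a Y.one b
  rw [hY.one_mul] at h
  rw [← h, hf.1, hf'.1, hl, hr]

theorem HModAlg.IsAlgMorphism.braidedPow_ext {X : HModAlg k H A} {Z : HModAlg k H C}
    (hX : X.IsModuleAlgebra) {m : ℕ} {f f' : (⨂[k] _ : Fin m, A) →ₗ[k] C}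
    (hf : (braidedPow R X m).IsAlgMorphism Z f) (hf' : (braidedPow R X m).IsAlgMorphism Z f')
    (h : ∀ i x, f (PiTensorProduct.tprod k (Function.update (fun _ => X.one) i x)) =
      f' (PiTensorProduct.tprod k (Function.update (fun _ => X.one) i x))) : f = f' := by
  induction m with
  | zero =>
    ext c
    have e : c = fun _ => X.one := Subsingleton.elim _ _
    rw [e]
    exact hf.2.trans hf'.2.symm
  | succ m ih =>
    have hmor : ∀ {f : (⨂[k] _ : Fin (m + 1), A) →ₗ[k] C},
        (braidedPow R X (m + 1)).IsAlgMorphism Z f →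
        (braidedTensor R (braidedPow R X m) X).IsAlgMorphism Z
          (f ∘ₗ (snocEquiv k A m).toLinearMap) := by
      intro f hf
      rw [braidedPow_succ] at hf
      refine ⟨fun x y => ?_, hf.2⟩
      have := hf.1 (snocEquiv k A m x) (snocEquiv k A m y)
      simpa [HModAlg.transport] using this
    have hm := braidedPow_isModuleAlgebra R hX m
    have key : f ∘ₗ (snocEquiv k A m).toLinearMap = f' ∘ₗ (snocEquiv k A m).toLinearMap := by
      refine (hmor hf).braidedTensor_ext R hm hX (hmor hf') (fun a => ?_) (fun b => ?_)
      · refine LinearMap.congr_fun (ih ((hmor hf).comp_tmul_one R hm hX)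
          ((hmor hf').comp_tmul_one R hm hX) fun i x => ?_) a
        simp only [LinearMap.comp_apply, LinearMap.flip_apply, TensorProduct.mk_apply,
          LinearEquiv.coe_coe, snocEquiv_tprod_tmul, update_const_snoc, h]
      · simp only [LinearMap.comp_apply, LinearEquiv.coe_coe, braidedPow, snocEquiv_tprod_tmul,
          update_last_snoc, h]
    ext x
    have := LinearMap.congr_fun key ((snocEquiv k A m).symm (PiTensorProduct.tprod k x))
    simpa using this

theorem tensorAct_tmul_one (p : H →ₗ[k] A →ₗ[k] A) {q : H →ₗ[k] B →ₗ[k] B} {b : B}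
    (hq : ∀ h, q h b = (Coalgebra.counit h : k) • b) (h : H) (a : A) :
    tensorAct p q h (a ⊗ₜ b) = p h a ⊗ₜ b := by
  have e : TensorProduct.map (p.flip a) (q.flip b) =
      ((TensorProduct.mk k A B).flip b ∘ₗ p.flip a) ∘ₗ (TensorProduct.rid k H).toLinearMap ∘ₗ
        LinearMap.lTensor H Coalgebra.counit := by
    ext x y
    simp [hq, TensorProduct.smul_tmul']
  rw [tensorAct_tmul, e]
  simp

theorem tensorAct_one_tmul {p : H →ₗ[k] A →ₗ[k] A} (q : H →ₗ[k] B →ₗ[k] B) {a : A}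
    (hp : ∀ h, p h a = (Coalgebra.counit h : k) • a) (h : H) (b : B) :
    tensorAct p q h (a ⊗ₜ b) = a ⊗ₜ q h b := by
  have e : TensorProduct.map (p.flip a) (q.flip b) =
      (TensorProduct.mk k A B a ∘ₗ q.flip b) ∘ₗ (TensorProduct.lid k H).toLinearMap ∘ₗ
        LinearMap.rTensor H Coalgebra.counit := by
    ext x y
    simp [hp, TensorProduct.smul_tmul']
  rw [tensorAct_tmul, e]
  simp

theorem braidedPow_act_update {X : HModAlg k H A} (hX : X.IsModuleAlgebra) (m : ℕ) (h : H)
    (i : Fin m) (x : A) :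
    (braidedPow R X m).act h (PiTensorProduct.tprod k (Function.update (fun _ => X.one) i x)) =
      PiTensorProduct.tprod k (Function.update (fun _ => X.one) i (X.act h x)) := by
  induction m with
  | zero => exact i.elim0
  | succ m ih =>
    rw [braidedPow_succ]
    simp only [HModAlg.transport, LinearMap.comp_apply, LinearEquiv.coe_coe,
      LinearEquiv.conj_apply, braidedTensor]
    refine Fin.lastCases ?_ (fun j => ?_) i
    · rw [← update_last_snoc, ← snocEquiv_tprod_tmul, LinearEquiv.symm_apply_apply,
        ← update_last_snoc, ← snocEquiv_tprod_tmul]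
      exact congrArg _ (tensorAct_one_tmul X.act (braidedPow_isModuleAlgebra R hX m).one_act h x)
    · rw [← update_const_snoc, ← snocEquiv_tprod_tmul, LinearEquiv.symm_apply_apply,
        tensorAct_tmul_one _ hX.one_act, ih, snocEquiv_tprod_tmul, update_const_snoc]

variable {E : Type w} [Semiring E] [Algebra k E]

/-- The entry y is split off as a right factor, so that expressions with separate copies of R in h
and y become bilinear. -/
theorem legs_update (F : H →ₗ[k] E) (m : ℕ) (j : Fin m) (y : E) (h : H) :
    legs F m j.1 j.isLt.le (Function.update (fun _ => 1) j y) h =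
      legs F m j.1 j.isLt.le (fun _ => 1) h *
        PiTensorProduct.tprod k (Function.update (fun _ => 1) j y) := by
  simp only [legs, LinearMap.comp_apply]
  induction iterComul k H j.1 h using PiTensorProduct.induction_on with
  | add x y hx hy => simp only [map_add, add_mul, hx, hy]
  | smul_tprod r c =>
    simp only [map_smul, PiTensorProduct.lift.tprod, fillMultilinear, MultilinearMap.mk'_apply,
      smul_mul_assoc, PiTensorProduct.tprod_mul_tprod]
    congr 2
    funext t
    by_cases ht : t = j
    · subst ht; simp
    · by_cases h : t.1 < j.1
      · simp only [Pi.mul_apply, Function.update_of_ne ht, dif_pos h, mul_one]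
      · simp only [Pi.mul_apply, Function.update_of_ne ht, dif_neg h, mul_one]

end Extensionality

/-! ## Matrix algebras -/

section Matrix

variable {k : Type u} [Field k]

theorem bijective_ofId_matrix {n : Type*} [Unique n] [Fintype n] [DecidableEq n] :
    Function.Bijective (Algebra.ofId k (Matrix n n k)) := by
  refine ⟨(Algebra.ofId k (Matrix n n k)).toRingHom.injective, fun M => ⟨M default default, ?_⟩⟩
  ext i j
  rw [Unique.eq_default i, Unique.eq_default j, Algebra.ofId_apply, Matrix.algebraMap_matrix_apply,
    if_pos rfl]
  rfl

theorem bijective_ofId_tensorPower_zero (E : Type*) [Ring E] [Algebra k E] :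
    Function.Bijective (Algebra.ofId k (⨂[k] _ : Fin 0, E)) := by
  have h : (Algebra.ofId k (⨂[k] _ : Fin 0, E) : k → _) =
      (PiTensorProduct.isEmptyEquiv (R := k) (s := fun _ : Fin 0 => E) (Fin 0)).symm :=
    funext fun c => (isEmptyEquiv_symm_eq_algebraMap c).symm
  rw [h]
  exact LinearEquiv.bijective _

theorem nonempty_tensorPower_algEquiv_matrix {E : Type w} [Ring E] [Algebra k E] {d : ℕ}
    (e : E ≃ₐ[k] Matrix (Fin d) (Fin d) k) (m : ℕ) :
    Nonempty ((⨂[k] _ : Fin m, E) ≃ₐ[k] Matrix (Fin (d ^ m)) (Fin (d ^ m)) k) := by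
  induction m with
  | zero =>
    exact ⟨(AlgEquiv.ofBijective _ (bijective_ofId_tensorPower_zero E)).symm.trans
      ((AlgEquiv.ofBijective _ (bijective_ofId_matrix (k := k) (n := Fin 1))).trans
        (Matrix.reindexAlgEquiv k k (finCongr (pow_zero d).symm)))⟩
  | succ m ih =>
    obtain ⟨e'⟩ := ih
    exact ⟨((snocAlgEquiv k E m).symm.trans (Algebra.TensorProduct.congr e' e)).trans
      (((Matrix.kroneckerTMulAlgEquiv (Fin (d ^ m)) (Fin d) k k k k).trans
        (Algebra.TensorProduct.rid k k k).mapMatrix).trans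
          (Matrix.reindexAlgEquiv k k (finProdFinEquiv.trans (finCongr (pow_succ d m).symm))))⟩

end Matrix

/-! ## The Alekseev morphism -/

section Alekseev

variable {k : Type u} [Field k] {H : Type v} [Ring H] [HopfAlgebra k H] (R : RMatrix k H)
  (hS : Function.Bijective (HopfAlgebra.antipode k : H →ₗ[k] H))

local infixr:75 " ⊛ " => conv

theorem Lgn_isModuleAlgebra (hS : Function.Bijective (HopfAlgebra.antipode k : H →ₗ[k] H))
    (g n : ℕ) : (Lgn R g n).IsModuleAlgebra :=
  braidedTensor_isModuleAlgebra R (braidedPow_isModuleAlgebra R (L10_isModuleAlgebra R hS) g)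
    (braidedPow_isModuleAlgebra R (L01_isModuleAlgebra R hS) n)

/-- The morphism `h ↦ (ψ ↦ S(S⁻¹(h)₍₁₎) ▷ ψ ◁ S⁻¹(h)₍₂₎)` from `H` to `End(H°)`. -/
def endMoment : H →ₗ[k] Module.End k (restrictedDual k H) := rightTrans hS ⊛ leftTrans k H

instance : IsHom (endMoment hS) := inferInstanceAs (IsHom (rightTrans hS ⊛ leftTrans k H))

theorem anti_endMoment : anti (endMoment hS) = DAct := (DAct_eq hS).symm

theorem DAct_comp_antipodeInv : DAct ∘ₗ antipodeInv hS = endMoment hS := by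
  ext a : 1
  rw [← anti_endMoment hS, LinearMap.comp_apply, anti_apply]
  exact congrArg _ ((LinearEquiv.ofBijective _ hS).apply_symm_apply a)

instance Target.instRing (g n : ℕ) : Ring (Target k H g n) :=
  @Algebra.TensorProduct.instRing k (⨂[k] _ : Fin g, Module.End k (restrictedDual k H))
    (⨂[k] _ : Fin n, H) _ _ _ _ _

/-- The morphism `h ↦ targetRight(h)` of algebras from `H` to `End(H°)^{⊗g} ⊗ H^{⊗n}`. -/
def targetMoment (g n : ℕ) : H →ₗ[k] Target k H g n :=
  tensorMoment (momentPow (endMoment hS) g) (momentPow (LinearMap.id : H →ₗ[k] H) n)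

instance (g n : ℕ) : IsHom (E := Target k H g n) (targetMoment hS g n) :=
  inferInstanceAs (IsHom (tensorMoment (momentPow (endMoment hS) g)
    (momentPow (LinearMap.id : H →ₗ[k] H) n)))

theorem targetLeft_eq (g n : ℕ) : targetLeft k H g n =
    anti (E := Target k H g n) (targetMoment hS g n) := by
  rw [targetMoment, anti_tensorMoment, anti_momentPow, anti_momentPow, anti_endMoment]
  rfl

theorem targetRight_eq (g n : ℕ) : targetRight hS g n = targetMoment hS g n := by
  rw [targetMoment, tensorMoment_eq, targetRight, DAct_comp_antipodeInv, allLegsRev_eq_momentPow,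
    allLegsRev_eq_momentPow]

theorem adjointAct_eq_lift {B : Type*} [Ring B] [Algebra k B] (ν : H →ₗ[k] B) :
    adjointAct ν = TensorProduct.lift ((LinearMap.mul k (Module.End k B)).compl₁₂
      (LinearMap.mul k B ∘ₗ anti ν) ((LinearMap.mul k B).flip ∘ₗ ν)) ∘ₗ Coalgebra.comul := by
  ext h x : 2
  rw [adjointAct_apply, conv]
  simp only [LinearMap.comp_apply]
  generalize (Coalgebra.comul h : H ⊗[k] H) = t
  induction t with
  | zero => simp
  | add x y hx hy => simp only [map_add, LinearMap.add_apply, hx, hy]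
  | tmul x y => simp [mul_assoc]

/-- The action in the theorem is an adjoint action: its left multiplier is the composite with S of
the morphism giving its right multiplier. The axioms and the equivariance then follow from the
general construction. -/
theorem target_eq_adjoint (g n : ℕ) : target hS g n =
    adjoint (B := Target k H g n) (targetMoment hS g n) := by
  simp only [target, adjoint, HModAlg.mk.injEq, true_and]
  rw [targetLeft_eq hS, targetRight_eq]
  exact (adjointAct_eq_lift (B := Target k H g n) _).symm

theorem target_isModuleAlgebra (g n : ℕ) : (target hS g n).IsModuleAlgebra := by
  rw [target_eq_adjoint]
  exact adjoint_isModuleAlgebra _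

/-- The Alekseev morphism `L_{g,n}(H) → End(H°)^{⊗g} ⊗ H^{⊗n}`. -/
def alekseev (g n : ℕ) : LgnSpace k H g n →ₗ[k] Target k H g n :=
  combine R (momentPow (endMoment hS) g) (braidedPow R (L01 R) n)
    (combinePow R (endMoment hS) (L10 R) (rho10 R) g)
    (combinePow R (LinearMap.id : H →ₗ[k] H) (L01 R) (Phi01 R) n)

theorem rho10_isAdjointMorphism_endMoment :
    IsAdjointMorphism (L10 R) (endMoment hS) (rho10 R) := rho10_isAdjointMorphism R hS

theorem combinePow_rho10_isAdjointMorphism (g : ℕ) :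
    IsAdjointMorphism (braidedPow R (L10 R) g) (momentPow (endMoment hS) g)
      (combinePow R (endMoment hS) (L10 R) (rho10 R) g) :=
  combinePow_isAdjointMorphism R (L10_isModuleAlgebra R hS)
    (rho10_isAdjointMorphism_endMoment R hS) g

theorem combinePow_Phi01_isAdjointMorphism
    (hS : Function.Bijective (HopfAlgebra.antipode k : H →ₗ[k] H)) (n : ℕ) :
    IsAdjointMorphism (braidedPow R (L01 R) n) (momentPow (LinearMap.id : H →ₗ[k] H) n)
      (combinePow R (LinearMap.id : H →ₗ[k] H) (L01 R) (Phi01 R) n) :=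
  combinePow_isAdjointMorphism R (L01_isModuleAlgebra R hS) (Phi01_isAdjointMorphism R) n

theorem alekseev_isAdjointMorphism (g n : ℕ) :
    IsAdjointMorphism (B := Target k H g n) (Lgn R g n) (targetMoment hS g n) (alekseev R hS g n) :=
  combine_isAdjointMorphism R (braidedPow_isModuleAlgebra R (L01_isModuleAlgebra R hS) n)
    (combinePow_rho10_isAdjointMorphism R hS g) (combinePow_Phi01_isAdjointMorphism R hS n)

theorem alekseev_embL10 (g n : ℕ) (i : Fin g) (x : restrictedDual k H ⊗[k] restrictedDual k H) :
    alekseev R hS g n (embL10 R g n i x) = formulaL10 R g n i x := by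
  rw [alekseev, embL10]
  refine (combine_tmul_one R (braidedPow_isModuleAlgebra R (L01_isModuleAlgebra R hS) n)
    (combinePow_Phi01_isAdjointMorphism R hS n) _).trans ?_
  rw [combinePow_update R (L10_isModuleAlgebra R hS) (rho10_isAdjointMorphism_endMoment R hS),
    TensorProduct.sum_tmul, anti_endMoment]
  rfl

theorem map_tmul_mul {E K : Type*} [Semiring E] [Algebra k E] [Semiring K] [Algebra k K]
    (F : H →ₗ[k] E) {G G' : H →ₗ[k] K} {s : K} (hG : ∀ h, G' h = G h * s) (t : H ⊗[k] H) :
    TensorProduct.map F G' t = TensorProduct.map F G t * (1 ⊗ₜ[k] s) := by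
  induction t with
  | zero => simp
  | add x y hx hy => simp only [map_add, add_mul, hx, hy]
  | tmul x y => simp [hG]

theorem alekseev_embL01 (g n : ℕ) (j : Fin n) (φ : restrictedDual k H) :
    alekseev R hS g n (embL01 R g n j φ) = formulaL01 R g n j φ := by
  have hone : combinePow R (endMoment hS) (L10 R) (rho10 R) g
      (PiTensorProduct.tprod k fun _ => (L10 R).one) = 1 :=
    (combinePow_rho10_isAdjointMorphism R hS g).1.2
  let S : H →ₗ[k] H := HopfAlgebra.antipode k
  let G : H →ₗ[k] (⨂[k] _ : Fin n, H) := legs S n j.1 j.isLt.le (fun _ => 1)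
  let s : H →ₗ[k] (⨂[k] _ : Fin n, H) :=
    (PiTensorProduct.tprod k : MultilinearMap k (fun _ : Fin n => H) _).toLinearMap
      (fun _ => 1) j ∘ₗ Phi01 R ∘ₗ (L01 R).act.flip φ
  have hG : ∀ y h, legs S n j.1 j.isLt.le
      (Function.update (fun _ => 1) j (Phi01 R ((L01 R).act y φ))) h = G h * s y := fun y h =>
    legs_update S n j _ h
  -- Two copies of R occur: one from `combine`, whose first leg spreads over the End factors, and
  -- one from `combinePow`, whose first leg spreads over the H factors before j. The axiom (Δ ⊗
  -- id)(R) = R₁₃R₂₃ merges them into one copy, with second legs multiplied in the order of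
  -- successive right actions on φ.
  have key := congrArg (TensorProduct.lift ((LinearMap.mul k (Target k H g n)).compl₁₂
    (TensorProduct.map (allLegs DAct g) G)
    ((Algebra.TensorProduct.includeRight : _ →ₐ[k] Target k H g n).toLinearMap ∘ₗ s)))
    R.sum_comul_fst
  simp only [map_sum, TensorProduct.lift.tmul, LinearMap.compl₁₂_apply, LinearMap.mul_apply',
    LinearMap.comp_apply, AlgHom.toLinearMap_apply, Algebra.TensorProduct.includeRight_apply,
    TensorProduct.map_tmul, Algebra.TensorProduct.tmul_mul_tmul, mul_one] at key
  rw [formulaL01, alekseev, embL01, combine_tmul, hone, anti_momentPow, anti_endMoment]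
  simp only [one_mul, braidedPow_act_update R (L01_isModuleAlgebra R hS),
    combinePow_update R (L01_isModuleAlgebra R hS) (Phi01_isAdjointMorphism R),
    TensorProduct.tmul_sum]
  have e1 : ∀ r, TensorProduct.map (allLegs DAct g) (legs S n j.1 j.isLt.le
      (Function.update (fun _ => 1) j (Phi01 R ((L01 R).act (R.snd r) φ))))
      (Coalgebra.comul (R.fst r)) = _ := fun r => map_tmul_mul _ (hG (R.snd r)) _
  refine Eq.trans ?_ (Eq.trans key.symm (Finset.sum_congr rfl fun r _ => (e1 r).symm))
  refine Finset.sum_congr rfl fun i _ => Finset.sum_congr rfl fun r _ => ?_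
  rw [← (L01_isModuleAlgebra R hS).act_mul, ← hG]
  rfl

theorem alekseev_unique {g n : ℕ} {Φ Φ' : LgnSpace k H g n →ₗ[k] Target k H g n}
    (hS : Function.Bijective (HopfAlgebra.antipode k : H →ₗ[k] H))
    {Z : HModAlg k H (Target k H g n)}
    (hΦ : (Lgn R g n).IsAlgMorphism Z Φ) (hΦ' : (Lgn R g n).IsAlgMorphism Z Φ')
    (h10 : ∀ i x, Φ (embL10 R g n i x) = Φ' (embL10 R g n i x))
    (h01 : ∀ j φ, Φ (embL01 R g n j φ) = Φ' (embL01 R g n j φ)) : Φ = Φ' := by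
  have hX := L10_isModuleAlgebra R hS
  have hY := L01_isModuleAlgebra R hS
  have hX' := braidedPow_isModuleAlgebra R hX g
  have hY' := braidedPow_isModuleAlgebra R hY n
  exact HModAlg.IsAlgMorphism.braidedTensor_ext R hX' hY' hΦ hΦ'
    (LinearMap.congr_fun (HModAlg.IsAlgMorphism.braidedPow_ext R hX
      (HModAlg.IsAlgMorphism.comp_tmul_one R hX' hY' hΦ)
      (HModAlg.IsAlgMorphism.comp_tmul_one R hX' hY' hΦ') h10))
    (LinearMap.congr_fun (HModAlg.IsAlgMorphism.braidedPow_ext R hY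
      (HModAlg.IsAlgMorphism.comp_one_tmul R hX' hY' hΦ)
      (HModAlg.IsAlgMorphism.comp_one_tmul R hX' hY' hΦ') h01))

theorem alekseev_bijective [FiniteDimensional k H] (hR : IsFactorizable R) (g n : ℕ) :
    Function.Bijective (alekseev R hS g n) :=
  combine_bijective R (braidedPow_isModuleAlgebra R (L01_isModuleAlgebra R hS) n)
    (combinePow_bijective R (L10_isModuleAlgebra R hS) (rho10_bijective R hS hR) g)
    (combinePow_bijective R (L01_isModuleAlgebra R hS) hR n)

theorem nonempty_target_algEquiv_matrix [FiniteDimensional k H] (hR : IsFactorizable R) (g : ℕ) :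
    Nonempty (Target k H g 0 ≃ₐ[k]
      Matrix (Fin (Module.finrank k H ^ g)) (Fin (Module.finrank k H ^ g)) k) := by
  let e := LinearEquiv.ofBijective (Phi01 R) hR
  have hfd : FiniteDimensional k (restrictedDual k H) := e.symm.finiteDimensional
  obtain ⟨e₁⟩ := nonempty_tensorPower_algEquiv_matrix
    (LinearMap.toMatrixAlgEquiv (Module.finBasisOfFinrankEq k (restrictedDual k H) e.finrank_eq)) g
  exact ⟨((Algebra.TensorProduct.congr AlgEquiv.refl
    (AlgEquiv.ofBijective _ (bijective_ofId_tensorPower_zero H)).symm).trans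
    (Algebra.TensorProduct.rid k k _)).trans e₁⟩

end Alekseev

end QuantumModuli

end

/-! ### The theorem -/

theorem propositionA {k : Type*} [Field k] {H : Type*} [Ring H] [HopfAlgebra k H]
    (hS : Function.Bijective (HopfAlgebra.antipode k : H →ₗ[k] H))
    (R : QuantumModuli.RMatrix k H) (g n : ℕ) :
    (QuantumModuli.Lgn R g n).IsModuleAlgebra ∧
    (QuantumModuli.target hS g n).IsModuleAlgebra ∧
    (∃ Φ : QuantumModuli.LgnSpace k H g n →ₗ[k] QuantumModuli.Target k H g n,
      ((QuantumModuli.Lgn R g n).IsAlgMorphism (QuantumModuli.target hS g n) Φ ∧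
        (∀ i x, Φ (QuantumModuli.embL10 R g n i x) = QuantumModuli.formulaL10 R g n i x) ∧
        (∀ j φ, Φ (QuantumModuli.embL01 R g n j φ) = QuantumModuli.formulaL01 R g n j φ)) ∧
      (∀ Φ' : QuantumModuli.LgnSpace k H g n →ₗ[k] QuantumModuli.Target k H g n,
        ((QuantumModuli.Lgn R g n).IsAlgMorphism (QuantumModuli.target hS g n) Φ' ∧
          (∀ i x, Φ' (QuantumModuli.embL10 R g n i x) = QuantumModuli.formulaL10 R g n i x) ∧
          (∀ j φ, Φ' (QuantumModuli.embL01 R g n j φ) = QuantumModuli.formulaL01 R g n j φ)) →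
        Φ' = Φ) ∧
      (QuantumModuli.Lgn R g n).IsEquivariant (QuantumModuli.target hS g n) Φ ∧
      (FiniteDimensional k H → QuantumModuli.IsFactorizable R → Function.Bijective Φ)) ∧
    (FiniteDimensional k H → QuantumModuli.IsFactorizable R →
      ∃ Ψ : QuantumModuli.LgnSpace k H g 0 →ₗ[k]
          Matrix (Fin (Module.finrank k H ^ g)) (Fin (Module.finrank k H ^ g)) k,
        Function.Bijective Ψ ∧ Ψ (QuantumModuli.Lgn R g 0).one = 1 ∧
        ∀ x y, Ψ ((QuantumModuli.Lgn R g 0).mul x y) = Ψ x * Ψ y) := by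
  refine ⟨QuantumModuli.Lgn_isModuleAlgebra R hS g n, QuantumModuli.target_isModuleAlgebra hS g n,
    ⟨QuantumModuli.alekseev R hS g n, ⟨?_, QuantumModuli.alekseev_embL10 R hS g n,
      QuantumModuli.alekseev_embL01 R hS g n⟩, ?_, ?_, fun _ hR =>
      QuantumModuli.alekseev_bijective R hS hR g n⟩, fun _ hR => ?_⟩
  · rw [QuantumModuli.target_eq_adjoint]
    exact (QuantumModuli.alekseev_isAdjointMorphism R hS g n).1
  · rintro Φ' ⟨hΦ', h10, h01⟩
    rw [QuantumModuli.target_eq_adjoint] at hΦ'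
    refine QuantumModuli.alekseev_unique R hS hΦ'
      (QuantumModuli.alekseev_isAdjointMorphism R hS g n).1 (fun i x => ?_) (fun j φ => ?_)
    · rw [h10, QuantumModuli.alekseev_embL10]
    · rw [h01, QuantumModuli.alekseev_embL01]
  · rw [QuantumModuli.target_eq_adjoint]
    exact (QuantumModuli.alekseev_isAdjointMorphism R hS g n).2
  · obtain ⟨e⟩ := QuantumModuli.nonempty_target_algEquiv_matrix R hR g
    have hΦ := (QuantumModuli.alekseev_isAdjointMorphism R hS g 0).1
    refine ⟨e.toLinearMap ∘ₗ QuantumModuli.alekseev R hS g 0,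
      e.bijective.comp (QuantumModuli.alekseev_bijective R hS hR g 0), ?_, fun x y => ?_⟩
    · exact (congrArg e hΦ.2).trans (map_one e)
    · exact (congrArg e (hΦ.1 x y)).trans (map_mul e _ _)
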